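/- All rings are commutative and Noetherian; $\operatorname{edim}$ denotes the minimal number of generators of the maximal ideal of a local ring. Let $(R,\mathfrak m)\to(S,\mathfrak n)$ be a flat local homomorphism of complete local rings with $\dim R=\dim S$, and let $c=\operatorname{edim}S-\operatorname{edim}R$. Then the map factors through ring homomorphisms $$(R,\mathfrak m)\to(T,\mathfrak n_T)\to(S,\mathfrak n)=T/J,$$ where $T\to S$ is surjective with kernel $J$, such that: (1) $R\to T$ is flat and local, $T$ is a complete Noetherian local ring, and $T/\mathfrak mT$ is a complete intersection (that is, its completion is the quotient of a regular local ring by a regular sequence); (2) $J$ is a perfect ideal, i.e. $\operatorname{pd}_T(T/J)=\operatorname{depth}_JT$, where $\operatorname{depth}_JT$ is the maximal length of a $T$-regular sequence contained in $J$, and $\operatorname{pd}_TS=c$ (in particular $c\ge 0$); (3) $J\subseteq\mathfrak n_T^2$. -/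

import Mathlib

universe u v

open IsLocalRing CategoryTheory

/-- The embedding dimension of a Noetherian local ring: the minimal number of generators of its
maximal ideal. -/
noncomputable def edim (A : Type u) [CommRing A] [IsLocalRing A] : ℕ :=
  (maximalIdeal A).spanFinrank

/-- A Noetherian local ring is a complete intersection if its completion is the quotient of a
regular local ring by an ideal generated by a (possibly empty) regular sequence. -/
def IsCompleteIntersectionLocalRing (A : Type u) [CommRing A] : Prop :=
  IsNoetherianRing A ∧ ∃ _ : IsLocalRing A,
    ∃ (Q : Type u) (_ : CommRing Q) (_ : IsRegularLocalRing Q) (rs : List Q),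
      RingTheory.Sequence.IsRegular Q rs ∧
        Nonempty (AdicCompletion (maximalIdeal A) A ≃+* (Q ⧸ Ideal.ofList rs))

/-- The depth of a ring `A` along a proper ideal `J` (the grade of `J`): the supremum of the
lengths of the `A`-regular sequences contained in `J`. -/
noncomputable def depthAlong {A : Type u} [CommRing A] (J : Ideal A) : ℕ∞ :=
  ⨆ (rs : List A) (_ : RingTheory.Sequence.IsRegular A rs) (_ : ∀ r ∈ rs, r ∈ J), (rs.length : ℕ∞)

/-- A proper ideal `J` of `A` is perfect if `pd_A (A / J) = depth_J A`. -/
def IsPerfectIdeal {A : Type u} [CommRing A] (J : Ideal A) : Prop :=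
  J ≠ ⊤ ∧ projectiveDimension (ModuleCat.of A (A ⧸ J)) = ((depthAlong J : ℕ∞) : WithBot ℕ∞)

-- Start from a Cohen factorization `R → T → S`: `T` is complete and flat over `R`, the closed fibre
-- `P = T/𝔪T` is regular of some dimension `n`, and `T → S` is onto with kernel `J`. Three facts tie
-- everything to `n`. Since `S` is `R`-flat, `pd_T S ≤ n`, because syzygies can be cut down along
-- the regular parameters of `P` (`pdlt_of_flat_of_closedFibre`). Since `dim R = dim S`, the fibre
-- `S/𝔪S` is Artinian, so `JP` is primary to the maximal ideal of `P` and `J` contains a `P`-regular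
-- sequence of length `n` (`exists_isRegular_of_forall_pow_mem`). Finally `edim T = edim R + n`
-- (`edim_eq_edim_add_length`).
--
-- These facts are kept as invariants (`IsAdmissibleFactorization`), with "regular" relaxed to
-- "regular local ring modulo a regular sequence" for the closed fibre. If `J` is not inside `𝔫_T²`,
-- prime avoidance gives `z ∈ J` outside `𝔫_T²` and regular on the closed fibre. The local criterion
-- makes `z` regular on `T` and `T/(z)` flat over `R`. Passing to `T/(z)` lowers by one the bound on
-- `pd S` (Nagata, `PDLT.quotient_of_notMem_sq`), the length of the fibre-regular sequence in the
-- kernel (exchange via Ext, `exists_isRegular_quotSMulTop`) and the embedding dimension. The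
-- process stops, at the latest when `n = 0`, because then `S` is free over `T` and `J = 0`.
--
-- At the end the regular sequence of length `n` in `J` forces `pd_T S ≥ n`, so grade and projective
-- dimension both equal `n`. As `J ⊆ 𝔫_T²`, also `edim S = edim T = edim R + n`, so `n = c`.
--
-- The Cohen factorization is built from coefficient rings. Each residue field is the quotient by
-- `p` of a domain that is either a field or discretely valued with uniformizer `p`
-- (`exists_coefficientRing`). Such a ring `A` lifts along surjections from complete rings
-- (`exists_lift_of_isAdicComplete`), as square-zero extensions of a field in its own characteristic
-- split (`exists_section`). With `A` for `R` and `B` for `S`, a completion `D` of `B[x₁,…,x_d]`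
-- maps onto `S`, the map `A → R → S` lifts to `A → D`, and `T` is the `𝔪`-adic completion of `R ⊗_A
-- D`, whose closed fibre is `D/(p)` (`exists_completed_baseChange`).

universe w

open scoped TensorProduct Pointwise

/-! ### The local criterion of flatness. -/

section LocalCriterion

variable {R T M M' : Type*} [CommRing R] [CommRing T] [Algebra R T]
  [AddCommGroup M] [Module R M] [Module T M] [IsScalarTower R T M]
  [AddCommGroup M'] [Module R M'] [Module T M'] [IsScalarTower R T M']

/-- For an `R/I`-module `N`, cancelling the base change identifies `M ⊗_R N` with `N ⊗_{R/I} (R/I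
⊗_R M)`, so `f ⊗ N` depends only on `f` modulo `I`. -/
lemma rTensor_injective_of_baseChange (I : Ideal R) (f : M →ₗ[R] M')
    (N : Type*) [AddCommGroup N] [Module R N] [Module (R ⧸ I) N] [IsScalarTower R (R ⧸ I) N]
    (h1 : Function.Injective ((f.baseChange (R ⧸ I)).lTensor N)) :
    Function.Injective (f.rTensor N) := by
  let e := TensorProduct.AlgebraTensorModule.cancelBaseChange R (R ⧸ I) (R ⧸ I) N M
  let e' := TensorProduct.AlgebraTensorModule.cancelBaseChange R (R ⧸ I) (R ⧸ I) N M'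
  have h2 : ∀ x, f.lTensor N (e x) = e' ((f.baseChange (R ⧸ I)).lTensor N x) := by
    intro x
    induction x with
    | zero => simp
    | add x y hx hy => simp [hx, hy]
    | tmul n y =>
      induction y with
      | zero => simp
      | add x y hx hy => simp [hx, hy, TensorProduct.tmul_add]
      | tmul c m => simp [e, e']
  have h3 : Function.Injective (f.lTensor N) := by
    intro x y hxy
    obtain ⟨x, rfl⟩ := e.surjective x
    obtain ⟨y, rfl⟩ := e.surjective y
    rw [h2, h2] at hxy
    rw [h1 (e'.injective hxy)]
  have h4 : (f.rTensor N) = (TensorProduct.comm R N M').toLinearMap ∘ₗ (f.lTensor N) ∘ₗ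
      (TensorProduct.comm R M N).toLinearMap := by
    ext; simp
  rw [h4]
  simpa using h3

/-- If `f` becomes injective modulo the ideal `I` with `R ⧸ I` a field, then it remains injective
after tensoring with every module killed by `I`. -/
lemma rTensor_injective_of_smul_eq_zero (I : Ideal R) [hI : I.IsMaximal]
    (f : M →ₗ[R] M') (hf : Function.Injective (f.lTensor (R ⧸ I)))
    (N : Type*) [AddCommGroup N] [Module R N] (hN : ∀ r ∈ I, ∀ n : N, r • n = 0) :
    Function.Injective (f.rTensor N) := by
  let : Field (R ⧸ I) := Ideal.Quotient.field I
  have htor : Module.IsTorsionBySet R N (I : Set R) := fun n r => hN r r.2 n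
  let : Module (R ⧸ I) N := htor.module
  have : IsScalarTower R (R ⧸ I) N := htor.isScalarTower
  exact rTensor_injective_of_baseChange I f N
    (Module.Flat.lTensor_preserves_injective_linearMap (M := N) (f.baseChange (R ⧸ I)) hf)

/-- If `f` becomes bijective modulo the ideal `I`, then it remains bijective after tensoring with
every module killed by `I`. -/
lemma rTensor_injective_of_bijective_quotient (I : Ideal R)
    (f : M →ₗ[R] M') (hf : Function.Bijective (f.lTensor (R ⧸ I)))
    (N : Type*) [AddCommGroup N] [Module R N] (hN : ∀ r ∈ I, ∀ n : N, r • n = 0) :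
    Function.Injective (f.rTensor N) := by
  have htor : Module.IsTorsionBySet R N (I : Set R) := fun n r => hN r r.2 n
  let : Module (R ⧸ I) N := htor.module
  have : IsScalarTower R (R ⧸ I) N := htor.isScalarTower
  let e := LinearEquiv.ofBijective (f.baseChange (R ⧸ I)) hf
  exact rTensor_injective_of_baseChange I f N (e.lTensor N).injective

lemma finite_tensorProduct_of_finite [Module.Finite T M]
    (N : Type*) [AddCommGroup N] [Module R N] [Module.Finite R N] :
    Module.Finite T (M ⊗[R] N) := by
  obtain ⟨k, p, hp⟩ := Module.Finite.exists_fin' R N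
  have : Module.Finite T (M ⊗[R] (Fin k → R)) :=
    Module.Finite.equiv (TensorProduct.piScalarRight R T M (Fin k)).symm
  exact Module.Finite.of_surjective (TensorProduct.AlgebraTensorModule.lTensor T M p)
    (LinearMap.lTensor_surjective M hp)

/-- A diagram chase: a kernel element dies in `M ⊗ N/N'`, hence comes from `M ⊗ N'`. Flatness of
`M'` keeps `M' ⊗ N' → M' ⊗ N` injective, so it already dies over `N'`. -/
lemma rTensor_injective_of_exact (f : M →ₗ[R] M') [Module.Flat R M']
    {N : Type*} [AddCommGroup N] [Module R N] (N' : Submodule R N)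
    (h1 : Function.Injective (f.rTensor N')) (h2 : Function.Injective (f.rTensor (N ⧸ N'))) :
    Function.Injective (f.rTensor N) := by
  rw [injective_iff_map_eq_zero]
  intro x hx
  have e1 : N'.mkQ.lTensor M x = 0 := by
    apply h2
    have := LinearMap.congr_fun (LinearMap.rTensor_comp_lTensor (f := f) (g := N'.mkQ)) x
    have h' := LinearMap.congr_fun (LinearMap.lTensor_comp_rTensor (f := f) (g := N'.mkQ)) x
    simp only [LinearMap.comp_apply] at this h'
    rw [this, ← h', hx]
    simp
  have ex : Function.Exact (N'.subtype.lTensor M) (N'.mkQ.lTensor M) :=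
    lTensor_exact M (LinearMap.exact_subtype_mkQ N') N'.mkQ_surjective
  obtain ⟨y, rfl⟩ := (ex x).1 e1
  have e2 : N'.subtype.lTensor M' (f.rTensor N' y) = 0 := by
    have := LinearMap.congr_fun (LinearMap.rTensor_comp_lTensor (f := f) (g := N'.subtype)) y
    have h' := LinearMap.congr_fun (LinearMap.lTensor_comp_rTensor (f := f) (g := N'.subtype)) y
    simp only [LinearMap.comp_apply] at this h'
    rw [h', ← this, hx]
  have e3 : f.rTensor N' y = 0 :=
    Module.Flat.lTensor_preserves_injective_linearMap (M := M') N'.subtype N'.injective_subtype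
      (by simpa using e2)
  rw [h1 (by simpa using e3 : f.rTensor N' y = f.rTensor N' 0)]
  simp

/-- Dévissage along `0 → IN → N → N/IN → 0`: the outer terms are killed by `I ^ n` and by `I`. -/
lemma rTensor_injective_of_pow_smul_eq_zero (I : Ideal R) [hI : I.IsMaximal]
    (f : M →ₗ[R] M') [Module.Flat R M'] (hf : Function.Injective (f.lTensor (R ⧸ I))) (n : ℕ)
    (N : Type*) [AddCommGroup N] [Module R N] (hN : ∀ r ∈ I ^ n, ∀ x : N, r • x = 0) :
    Function.Injective (f.rTensor N) := by
  induction n generalizing N with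
  | zero =>
    exact rTensor_injective_of_smul_eq_zero I f hf N fun r _ x => by
      have := hN 1 (by simp) x
      rw [one_smul] at this
      simp [this]
  | succ n ih =>
    refine rTensor_injective_of_exact f (I • ⊤ : Submodule R N) (ih _ ?_)
      (rTensor_injective_of_smul_eq_zero I f hf _ ?_)
    · rintro r hr ⟨x, hx⟩
      ext
      simp only [SetLike.mk_smul_mk, ZeroMemClass.coe_zero]
      induction hx using Submodule.smul_induction_on' with
      | smul a ha y _ =>
        rw [smul_smul]
        exact hN _ (by rw [pow_succ]; exact Ideal.mul_mem_mul hr ha) y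
      | add x _ y _ hx hy => rw [smul_add, hx, hy, add_zero]
    · intro r hr x
      obtain ⟨x, rfl⟩ := Submodule.Quotient.mk_surjective _ x
      rw [← Submodule.Quotient.mk_smul, Submodule.Quotient.mk_eq_zero]
      exact Submodule.smul_mem_smul hr trivial

variable [IsLocalRing R] [IsLocalRing T] [IsLocalHom (algebraMap R T)]

lemma lTensor_subtype_mem_pow_smul_top {N : Type*} [AddCommGroup N] [Module R N] (n : ℕ)
    (N' : Submodule R N) (hN' : N' ≤ maximalIdeal R ^ n • ⊤) (y : M ⊗[R] N') :
    N'.subtype.lTensor M y ∈ ((maximalIdeal T) ^ n • ⊤ : Submodule T (M ⊗[R] N)) := by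
  induction y with
  | zero => simp
  | add a b ha hb => rw [map_add]; exact add_mem ha hb
  | tmul m y =>
    obtain ⟨y, hy⟩ := y
    simp only [LinearMap.lTensor_tmul, Submodule.subtype_apply]
    have hy' := hN' hy
    clear hy
    induction hy' using Submodule.smul_induction_on' with
    | smul a ha z _ =>
      rw [TensorProduct.tmul_smul, ← algebraMap_smul T a (m ⊗ₜ[R] z)]
      refine Submodule.smul_mem_smul ?_ trivial
      have : (maximalIdeal R ^ n).map (algebraMap R T) ≤ maximalIdeal T ^ n := by
        rw [Ideal.map_pow]
        exact Ideal.pow_right_mono (((local_hom_TFAE (algebraMap R T)).out 0 2).1 ‹_›) n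
      exact this (Ideal.mem_map_of_mem _ ha)
    | add x _ y _ hx hy => rw [TensorProduct.tmul_add]; exact add_mem hx hy

variable [IsNoetherianRing T]

/-- A form of the local criterion of flatness: a map to a flat module that is injective on the
closed fibre remains injective after tensoring with every finite module. -/
theorem rTensor_injective_of_closedFibre [Module.Finite T M] [Module.Flat R M']
    (f : M →ₗ[T] M')
    (hf : Function.Injective ((f.restrictScalars R).lTensor (R ⧸ maximalIdeal R)))
    (N : Type*) [AddCommGroup N] [Module R N] [Module.Finite R N] :
    Function.Injective ((f.restrictScalars R).rTensor N) := by
  rw [injective_iff_map_eq_zero]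
  intro x hx
  -- Modulo `𝔪ⁿN` the map is injective, so a kernel element comes from `M ⊗ 𝔪ⁿN`. Krull's
  -- intersection theorem applies over `T`, where `M ⊗ N` is finite, although it need not be finite
  -- over `R`.
  have key : ∀ n : ℕ, x ∈ ((maximalIdeal T) ^ n • ⊤ : Submodule T (M ⊗[R] N)) := by
    intro n
    let N' : Submodule R N := (maximalIdeal R ^ n • ⊤ : Submodule R N)
    have hinj : Function.Injective ((f.restrictScalars R).rTensor (N ⧸ N')) := by
      refine rTensor_injective_of_pow_smul_eq_zero (maximalIdeal R) _ hf n _ ?_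
      intro r hr x
      obtain ⟨x, rfl⟩ := Submodule.Quotient.mk_surjective _ x
      rw [← Submodule.Quotient.mk_smul, Submodule.Quotient.mk_eq_zero]
      exact Submodule.smul_mem_smul hr trivial
    have e1 : N'.mkQ.lTensor M x = 0 := by
      apply hinj
      have := LinearMap.congr_fun (LinearMap.rTensor_comp_lTensor
        (f := f.restrictScalars R) (g := N'.mkQ)) x
      have h' := LinearMap.congr_fun (LinearMap.lTensor_comp_rTensor
        (f := f.restrictScalars R) (g := N'.mkQ)) x
      simp only [LinearMap.comp_apply] at this h'
      rw [this, ← h', hx]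
      simp
    have ex : Function.Exact (N'.subtype.lTensor M) (N'.mkQ.lTensor M) :=
      lTensor_exact M (LinearMap.exact_subtype_mkQ N') N'.mkQ_surjective
    obtain ⟨y, rfl⟩ := (ex x).1 e1
    exact lTensor_subtype_mem_pow_smul_top n N' le_rfl y
  have hfin : Module.Finite T (M ⊗[R] N) := finite_tensorProduct_of_finite N
  have := Ideal.iInf_pow_smul_eq_bot_of_isLocalRing (M := M ⊗[R] N) (maximalIdeal T)
    (Ideal.IsPrime.ne_top inferInstance)
  rw [← Submodule.mem_bot T, ← this]
  simpa using key

/-- The cokernel of a map into a flat module that is injective on the closed fibre is flat. -/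
theorem flat_of_closedFibre_injective [Module.Finite T M] [Module.Flat R M']
    (f : M →ₗ[T] M')
    (hf : Function.Injective ((f.restrictScalars R).lTensor (R ⧸ maximalIdeal R)))
    {C : Type*} [AddCommGroup C] [Module R C] (g : M' →ₗ[R] C)
    (hg : Function.Surjective g) (hfg : Function.Exact f g) :
    Module.Flat R C := by
  set f' := f.restrictScalars R with hf'
  have hfg' : Function.Exact f' g := hfg
  rw [Module.Flat.iff_lTensor_injective']
  intro a
  exact lTensor_injective_of_exact_of_exact_of_rTensor_injective hfg' hg
    (LinearMap.exact_subtype_mkQ a) a.mkQ_surjective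
    (rTensor_injective_of_closedFibre f hf (R ⧸ a))
    (Module.Flat.lTensor_preserves_injective_linearMap (M := M') a.subtype a.injective_subtype)

theorem injective_of_closedFibre_injective [Module.Finite T M] [Module.Flat R M']
    (f : M →ₗ[T] M')
    (hf : Function.Injective ((f.restrictScalars R).lTensor (R ⧸ maximalIdeal R))) :
    Function.Injective f := by
  have := rTensor_injective_of_closedFibre f hf R
  intro x y hxy
  have h2 : x ⊗ₜ[R] (1 : R) = y ⊗ₜ 1 := this (by simp [hxy])
  simpa using congrArg (TensorProduct.rid R M) h2

end LocalCriterion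

/-! ### Elements and sequences that are regular on the closed fibre. -/

section RegularOnClosedFibre

variable {R T M : Type*} [CommRing R] [CommRing T] [Algebra R T]
  [AddCommGroup M] [Module R M] [Module T M] [IsScalarTower R T M]

lemma exists_one_tmul (I : Ideal R) (x : (R ⧸ I) ⊗[R] M) : ∃ y : M, x = 1 ⊗ₜ y := by
  obtain ⟨y, hy⟩ := Submodule.Quotient.mk_surjective _ (TensorProduct.quotTensorEquivQuotSMul M I x)
  refine ⟨y, (TensorProduct.quotTensorEquivQuotSMul M I).injective ?_⟩
  rw [← hy, ← map_one (Ideal.Quotient.mk I), TensorProduct.quotTensorEquivQuotSMul_mk_tmul]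
  simp

lemma one_tmul_eq_zero_iff (I : Ideal R) (y : M) :
    (1 : R ⧸ I) ⊗ₜ[R] y = 0 ↔ y ∈ (I • ⊤ : Submodule R M) := by
  rw [← (TensorProduct.quotTensorEquivQuotSMul M I).map_eq_zero_iff,
    ← map_one (Ideal.Quotient.mk I), TensorProduct.quotTensorEquivQuotSMul_mk_tmul]
  simp

lemma lTensor_quotient_injective_iff {M' : Type*} [AddCommGroup M'] [Module R M'] (I : Ideal R)
    (f : M →ₗ[R] M') : Function.Injective (f.lTensor (R ⧸ I)) ↔
      ∀ x, f x ∈ (I • ⊤ : Submodule R M') → x ∈ (I • ⊤ : Submodule R M) := by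
  rw [injective_iff_map_eq_zero]
  constructor
  · intro h x hx
    rw [← one_tmul_eq_zero_iff] at hx ⊢
    exact h _ hx
  · intro h x hx
    obtain ⟨y, rfl⟩ := exists_one_tmul I x
    rw [LinearMap.lTensor_tmul, one_tmul_eq_zero_iff] at hx
    rw [one_tmul_eq_zero_iff]
    exact h _ hx

lemma mem_smul_top_iff_mem_map (I : Ideal R) (x : T) :
    x ∈ (I • ⊤ : Submodule R T) ↔ x ∈ I.map (algebraMap R T) := by
  rw [Ideal.smul_top_eq_map]
  rfl

variable [IsLocalRing R] [IsLocalRing T] [IsNoetherianRing T]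
  [IsLocalHom (algebraMap R T)]

/-- This is the local criterion applied to multiplication by `z`: injective on the closed fibre,
hence injective with flat cokernel. -/
theorem isSMulRegular_and_flat_of_closedFibre [Module.Finite T M] [Module.Flat R M] (z : T)
    (hz : ∀ x : M, z • x ∈ (maximalIdeal R • ⊤ : Submodule R M) →
      x ∈ (maximalIdeal R • ⊤ : Submodule R M)) :
    IsSMulRegular M z ∧ Module.Flat R (QuotSMulTop z M) := by
  let f : M →ₗ[T] M := LinearMap.lsmul T M z
  have hf : Function.Injective ((f.restrictScalars R).lTensor (R ⧸ maximalIdeal R)) := by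
    rw [lTensor_quotient_injective_iff]
    exact hz
  refine ⟨injective_of_closedFibre_injective f hf, ?_⟩
  let q : M →ₗ[T] QuotSMulTop z M := (z • ⊤ : Submodule T M).mkQ
  have hq : Function.Surjective q := Submodule.mkQ_surjective _
  have hex : Function.Exact f q := by
    intro x
    refine (Submodule.Quotient.mk_eq_zero _).trans ?_
    rw [Submodule.mem_smul_pointwise_iff_exists]
    simp only [Submodule.mem_top, true_and, Set.mem_range]
    rfl
  exact flat_of_closedFibre_injective f hf (q.restrictScalars R) hq hex

end RegularOnClosedFibre

section QuotientRing

variable {T : Type*} [CommRing T]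

/-- Killing `z` in `T ⧸ I` agrees with the quotient of `T ⧸ (z)` by the image of `I`. -/
noncomputable def quotSMulTopQuotientEquiv (I : Ideal T) (z : T) :
    QuotSMulTop z (T ⧸ I) ≃ₗ[T]
      ((T ⧸ Ideal.span {z}) ⧸ I.map (algebraMap T (T ⧸ Ideal.span {z}))) := by
  let p : T →ₗ[T] QuotSMulTop z (T ⧸ I) := (Submodule.mkQ _) ∘ₗ (Submodule.mkQ I)
  let q : T →ₗ[T] ((T ⧸ Ideal.span {z}) ⧸ I.map (algebraMap T (T ⧸ Ideal.span {z}))) :=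
    ((Submodule.mkQ (I.map (algebraMap T (T ⧸ Ideal.span {z})))).restrictScalars T) ∘ₗ
      (Submodule.mkQ (Ideal.span {z}))
  have hp : Function.Surjective p :=
    (Submodule.mkQ_surjective _).comp (Submodule.mkQ_surjective _)
  have hq : Function.Surjective q :=
    (Submodule.mkQ_surjective (I.map (algebraMap T (T ⧸ Ideal.span {z})))).comp
      (Submodule.mkQ_surjective _)
  have kp : LinearMap.ker p = I ⊔ Ideal.span {z} := by
    ext x
    simp only [p, LinearMap.mem_ker, LinearMap.comp_apply, Submodule.mkQ_apply,
      Submodule.Quotient.mk_eq_zero, Submodule.mem_smul_pointwise_iff_exists,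
      Submodule.mem_sup]
    constructor
    · rintro ⟨b, -, hb⟩
      obtain ⟨b, rfl⟩ := Submodule.Quotient.mk_surjective _ b
      rw [← Submodule.Quotient.mk_smul, Submodule.Quotient.eq] at hb
      exact ⟨x - z • b, by simpa using I.neg_mem hb, z • b,
        Ideal.mul_mem_right _ _ (Ideal.mem_span_singleton_self z), by simp⟩
    · rintro ⟨y, hy, w, hw, rfl⟩
      obtain ⟨c, rfl⟩ := Ideal.mem_span_singleton'.1 hw
      refine ⟨Submodule.Quotient.mk c, trivial, ?_⟩
      rw [← Submodule.Quotient.mk_smul, Submodule.Quotient.eq]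
      simpa [mul_comm c z] using hy
  have kq : LinearMap.ker q = I ⊔ Ideal.span {z} := by
    ext x
    simp only [q, LinearMap.mem_ker, LinearMap.comp_apply, LinearMap.coe_restrictScalars,
      Submodule.mkQ_apply, Submodule.Quotient.mk_eq_zero]
    have : (Submodule.Quotient.mk x : T ⧸ Ideal.span {z}) = algebraMap T _ x := rfl
    rw [this, ← Ideal.mem_comap, Ideal.Quotient.algebraMap_eq,
      Ideal.comap_map_of_surjective _ Ideal.Quotient.mk_surjective,
      ← RingHom.ker_eq_comap_bot, Ideal.mk_ker]
  exact (LinearMap.quotKerEquivOfSurjective p hp).symm ≪≫ₗ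
    Submodule.quotEquivOfEq _ _ (kp.trans kq.symm) ≪≫ₗ LinearMap.quotKerEquivOfSurjective q hq

end QuotientRing

section Lists

open RingTheory.Sequence

variable {R T : Type*} [CommRing R] [CommRing T] [Algebra R T]

/-- With `I = 𝔪T` the second factor is the closed fibre of `T/(z)`. This lets inductions on
fibre-regular sequences replace `T` by `T/(z)`, which is again `R`-flat. -/
lemma isWeaklyRegular_closedFibre_cons_iff (z : T) (zs : List T) :
    IsWeaklyRegular (T ⧸ (I : Ideal T)) (z :: zs) ↔
      IsSMulRegular (T ⧸ I) z ∧
        IsWeaklyRegular ((T ⧸ Ideal.span {z}) ⧸ I.map (algebraMap T (T ⧸ Ideal.span {z})))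
          (zs.map (algebraMap T (T ⧸ Ideal.span {z}))) := by
  rw [isWeaklyRegular_cons_iff, (quotSMulTopQuotientEquiv I z).isWeaklyRegular_congr,
    isWeaklyRegular_map_algebraMap_iff]

lemma isSMulRegular_and_flat_quotient [IsLocalRing R] [IsLocalRing T] [IsNoetherianRing T]
    [IsLocalHom (algebraMap R T)] [Module.Flat R T] (z : T)
    (hz : IsSMulRegular (T ⧸ (maximalIdeal R).map (algebraMap R T)) z) :
    IsSMulRegular T z ∧ Module.Flat R (T ⧸ Ideal.span {z}) := by
  have := isSMulRegular_and_flat_of_closedFibre (R := R) (M := T) z (by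
    intro x hx
    rw [mem_smul_top_iff_mem_map] at hx ⊢
    exact mem_of_isSMulRegular_quotient_of_smul_mem hz hx)
  refine ⟨this.1, ?_⟩
  have h2 := this.2
  have e : QuotSMulTop z T ≃ₗ[R] T ⧸ Ideal.span {z} :=
    (Submodule.quotEquivOfEq _ _ (by simp [← Submodule.ideal_span_singleton_smul])).restrictScalars R
  exact Module.Flat.of_linearEquiv e.symm

lemma isLocalRing_quotient [IsLocalRing T] {I : Ideal T} (hI : I ≤ maximalIdeal T) : IsLocalRing (T ⧸ I) := by
  have : Nontrivial (T ⧸ I) := Ideal.Quotient.nontrivial_iff.2 fun h => by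
    rw [h, top_le_iff] at hI
    exact Ideal.IsPrime.ne_top inferInstance hI
  exact IsLocalRing.of_surjective' (Ideal.Quotient.mk I) Ideal.Quotient.mk_surjective

lemma isLocalHom_algebraMap_quotient [IsLocalRing T] [IsLocalHom (algebraMap R T)] {I : Ideal T} [IsLocalRing (T ⧸ I)] :
    IsLocalHom (algebraMap R (T ⧸ I)) := by
  have : IsLocalHom (algebraMap T (T ⧸ I)) :=
    IsLocalHom.of_surjective _ Ideal.Quotient.mk_surjective
  rw [IsScalarTower.algebraMap_eq R T (T ⧸ I)]
  infer_instance

lemma map_maximalIdeal_quotient [IsLocalRing R] (I : Ideal T) : (maximalIdeal R).map (algebraMap R (T ⧸ I)) =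
    ((maximalIdeal R).map (algebraMap R T)).map (algebraMap T (T ⧸ I)) := by
  rw [Ideal.map_map, ← IsScalarTower.algebraMap_eq]

end Lists

/-- Divide by one element at a time. Each quotient is again a flat local `R`-algebra, so the local
criterion applies again; this is why `T` varies in the induction. -/
theorem isWeaklyRegular_of_closedFibre {R : Type*} [CommRing R] [IsLocalRing R] (n : ℕ) :
    ∀ {T : Type v} [CommRing T] [Algebra R T] [IsLocalRing T] [IsNoetherianRing T]
      [IsLocalHom (algebraMap R T)] [Module.Flat R T] (zs : List T), zs.length = n →
      (∀ z ∈ zs, z ∈ maximalIdeal T) →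
      RingTheory.Sequence.IsWeaklyRegular (T ⧸ (maximalIdeal R).map (algebraMap R T)) zs →
      RingTheory.Sequence.IsWeaklyRegular T zs := by
  induction n with
  | zero =>
    intro T _ _ _ _ _ _ zs hzs _ _
    rw [List.length_eq_zero_iff.1 hzs]
    exact .nil _ _
  | succ n ih =>
    intro T _ _ _ _ _ _ zs hzs hmem hreg
    match zs with
    | [] => simp at hzs
    | z :: zs =>
      rw [isWeaklyRegular_closedFibre_cons_iff] at hreg
      obtain ⟨h1, h2⟩ := isSMulRegular_and_flat_quotient z hreg.1
      have hz : Ideal.span {z} ≤ maximalIdeal T := by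
        rw [Ideal.span_singleton_le_iff_mem]
        exact hmem z (by simp)
      have := isLocalRing_quotient hz
      have : IsLocalHom (algebraMap R (T ⧸ Ideal.span {z})) := isLocalHom_algebraMap_quotient
      rw [RingTheory.Sequence.isWeaklyRegular_cons_iff']
      refine ⟨h1, ?_⟩
      have h3 := ih (zs.map (algebraMap T (T ⧸ Ideal.span {z}))) (by simpa using hzs) (by
          intro y hy
          obtain ⟨w, hw, rfl⟩ := List.mem_map.1 hy
          have hl : IsLocalHom (algebraMap T (T ⧸ Ideal.span {z})) :=
            IsLocalHom.of_surjective _ Ideal.Quotient.mk_surjective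
          have hle := ((local_hom_TFAE (algebraMap T (T ⧸ Ideal.span {z}))).out 0 2).1 hl
          exact hle (Ideal.mem_map_of_mem _ (hmem w (by simp [hw]))))
        (by rw [map_maximalIdeal_quotient]; exact hreg.2)
      have e : QuotSMulTop z T ≃ₗ[T ⧸ Ideal.span {z}] T ⧸ Ideal.span {z} :=
        (Submodule.quotEquivOfEq _ _ (by simp [← Submodule.ideal_span_singleton_smul]) :
          QuotSMulTop z T ≃ₗ[T] T ⧸ Ideal.span {z}).extendScalarsOfSurjective
          Ideal.Quotient.mk_surjective
      exact (e.isWeaklyRegular_congr _).2 h3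

/-! ### Projective dimension under syzygies and quotients. -/

section ProjectiveDimension

variable {A : Type v} [CommRing A]

/-- The module `M` has projective dimension less than `n`. -/
abbrev PDLT (A : Type v) [CommRing A] (M : Type v) [AddCommGroup M] [Module A M] (n : ℕ) : Prop :=
  HasProjectiveDimensionLT (ModuleCat.of A M) n

variable {M N P : Type v} [AddCommGroup M] [Module A M] [AddCommGroup N] [Module A N]
  [AddCommGroup P] [Module A P]

lemma pdlt_zero_iff : PDLT A M 0 ↔ Subsingleton M := by
  rw [PDLT, hasProjectiveDimensionLT_zero_iff_isZero, ModuleCat.isZero_iff_subsingleton]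

lemma pdlt_one_iff : PDLT A M 1 ↔ Module.Projective A M := by
  rw [PDLT, ← projective_iff_hasProjectiveDimensionLT_one, ← IsProjective.iff_projective]

lemma PDLT.mono {m n : ℕ} (h : PDLT A M m) (hmn : m ≤ n) : PDLT A M n :=
  hasProjectiveDimensionLT_of_ge _ m n hmn

lemma PDLT.of_equiv {n : ℕ} (h : PDLT A M n) (e : M ≃ₗ[A] N) : PDLT A N n :=
  hasProjectiveDimensionLT_of_iso e.toModuleIso n

/-- The offset matters: one degree lower the equivalence fails, since `N` may be projective while
the kernel is nonzero. -/
lemma pdlt_ker_iff [Module.Projective A M] (f : M →ₗ[A] N) (hf : Function.Surjective f) (n : ℕ) :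
    PDLT A N (n + 2) ↔ PDLT A (LinearMap.ker f) (n + 1) :=
  (LinearMap.shortExact_shortComplexKer hf).hasProjectiveDimensionLT_X₃_iff n
    ((IsProjective.iff_projective (R := A) M).1 inferInstance)

lemma PDLT.of_exact {f : M →ₗ[A] N} {g : N →ₗ[A] P} (hf : Function.Injective f)
    (hfg : Function.Exact f g) (hg : Function.Surjective g) {n : ℕ} (h₁ : PDLT A M n)
    (h₂ : PDLT A N (n + 1)) : PDLT A P (n + 1) := by
  let S := ModuleCat.shortComplexOfCompEqZero f g hfg.linearMap_comp_eq_zero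
  have hS : S.ShortExact :=
    { exact := ModuleCat.shortComplex_exact _ hfg
      mono_f := (ModuleCat.mono_iff_injective _).2 hf
      epi_g := (ModuleCat.epi_iff_surjective _).2 hg }
  exact hS.hasProjectiveDimensionLT_X₃ n h₁ h₂

lemma quotSMulTop_pdlt_iff [IsNoetherianRing A] [IsLocalRing A] [Module.Finite A M] {x : A}
    (reg : IsSMulRegular M x) (hx : x ∈ maximalIdeal A) (n : ℕ) :
    PDLT A (QuotSMulTop x M) (n + 1) ↔ PDLT A M n := by
  have := ModuleCat.projectiveDimension_quotSMulTop_eq_succ_of_isSMulRegular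
    (ModuleCat.of A M) x reg hx
  rw [PDLT, PDLT, ← projectiveDimension_lt_iff, ← projectiveDimension_lt_iff]
  erw [this]
  push_cast
  generalize projectiveDimension (ModuleCat.of A M) = d
  cases d with
  | bot => simp
  | coe d => cases d with
    | top =>
      have h1 : ((⊤ : ℕ∞) : WithBot ℕ∞) + 1 = ((⊤ : ℕ∞) : WithBot ℕ∞) := rfl
      rw [h1]
      exact iff_of_false (not_lt.2 le_top) (not_lt.2 le_top)
    | coe d => norm_cast; omega

end ProjectiveDimension

/-! ### Change of rings along `A → A/(x)`. -/

section ChangeOfRings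

variable {A : Type v} [CommRing A] [IsNoetherianRing A] [IsLocalRing A]

lemma pdlt_two_of_free_quotient {x : A} (reg : IsSMulRegular A x) (hx : x ∈ maximalIdeal A)
    (k : ℕ) : PDLT A (Fin k → A ⧸ Ideal.span {x}) 2 := by
  have hreg : IsSMulRegular (Fin k → A) x := fun a b h => funext fun i => reg (congrFun h i)
  have h1 : PDLT A (QuotSMulTop x (Fin k → A)) 2 :=
    (quotSMulTop_pdlt_iff hreg hx 1).2 (pdlt_one_iff.2 inferInstance)
  have e : QuotSMulTop x (Fin k → A) ≃ₗ[A] (Fin k → A ⧸ Ideal.span {x}) := by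
    refine (Submodule.quotEquivOfEq _ _ ?_) ≪≫ₗ
      (Submodule.quotientPi fun _ : Fin k => Ideal.span {x})
    ext f
    simp only [Submodule.mem_smul_pointwise_iff_exists, Submodule.mem_pi, Set.mem_univ,
      forall_true_left, Submodule.mem_top, true_and]
    constructor
    · rintro ⟨g, rfl⟩ i
      exact Ideal.mul_mem_right _ _ (Ideal.mem_span_singleton_self x)
    · intro h
      choose g hg using fun i => Ideal.mem_span_singleton'.1 (h i)
      exact ⟨g, funext fun i => by simp [← hg i, mul_comm]⟩
  exact h1.of_equiv e

/-- Finite free `A/(x)`-modules have projective dimension at most one over `A`. A finite free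
resolution over `A/(x)` therefore costs one extra step over `A`. -/
theorem PDLT.restrictScalars_quotient {x : A} (reg : IsSMulRegular A x) (hx : x ∈ maximalIdeal A)
    (n : ℕ) (N : Type v) [AddCommGroup N] [Module A N] [Module (A ⧸ Ideal.span {x}) N]
    [IsScalarTower A (A ⧸ Ideal.span {x}) N] [Module.Finite (A ⧸ Ideal.span {x}) N]
    (h : PDLT (A ⧸ Ideal.span {x}) N n) : PDLT A N (n + 1) := by
  have := isLocalRing_quotient (I := Ideal.span {x}) (T := A)
    ((Ideal.span_singleton_le_iff_mem _).2 hx)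
  induction n generalizing N with
  | zero =>
    rw [pdlt_zero_iff] at h
    exact (pdlt_zero_iff.2 h).mono (by simp)
  | succ n ih =>
    cases n with
    | zero =>
      rw [zero_add, pdlt_one_iff] at h
      have : Module.Free (A ⧸ Ideal.span {x}) N := Module.free_of_flat_of_isLocalRing
      exact (pdlt_two_of_free_quotient reg hx _).of_equiv
        ((Module.finBasis (A ⧸ Ideal.span {x}) N).equivFun.symm.restrictScalars A)
    | succ n =>
      obtain ⟨k, f, hf⟩ := Module.Finite.exists_fin' (A ⧸ Ideal.span {x}) N
      have h1 := ih (LinearMap.ker f) ((pdlt_ker_iff f hf n).1 h)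
      exact PDLT.of_exact (f := (LinearMap.ker f).subtype.restrictScalars A)
        (g := f.restrictScalars A) (LinearMap.ker f).injective_subtype
        (LinearMap.exact_subtype_ker_map f) hf h1
        ((pdlt_two_of_free_quotient reg hx k).mono (by omega))

omit [IsNoetherianRing A] in
-- Lift a basis of `M ⊗ k`. By Nakayama the lifts generate, and a relation among them becomes a
-- linear relation among basis vectors over `k`.
lemma exists_minimal_cover (M : Type v) [AddCommGroup M] [Module A M] [Module.Finite A M] :
    ∃ (k : ℕ) (f : (Fin k → A) →ₗ[A] M), Function.Surjective f ∧
      ∀ x ∈ LinearMap.ker f, ∀ i, x i ∈ maximalIdeal A := by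
  let b := Module.finBasis (ResidueField A) (ResidueField A ⊗[A] M)
  have hs : Function.Surjective (TensorProduct.mk A (ResidueField A) M 1) :=
    TensorProduct.mk_surjective A M (ResidueField A) Ideal.Quotient.mk_surjective
  choose v hv using fun i => hs (b i)
  refine ⟨_, Fintype.linearCombination A v, ?_, ?_⟩
  · rw [← LinearMap.range_eq_top, Fintype.range_linearCombination]
    exact IsLocalRing.span_eq_top_of_tmul_eq_basis v b hv
  · intro x hx i
    rw [LinearMap.mem_ker, Fintype.linearCombination_apply] at hx
    have h2 := congrArg (TensorProduct.mk A (ResidueField A) M 1) hx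
    rw [map_sum, map_zero] at h2
    have h3 : ∑ i, residue A (x i) • b i = 0 := by
      rw [← h2]
      refine Finset.sum_congr rfl fun j _ => ?_
      rw [map_smul, hv, ← algebraMap_smul (ResidueField A) (x j) (b j)]
      rfl
    have h4 := Fintype.linearIndependent_iff.1 b.linearIndependent _ h3 i
    rwa [residue_eq_zero_iff] at h4

omit [IsNoetherianRing A] [IsLocalRing A] in
lemma mem_ideal_smul_pi_iff {k : ℕ} (I : Ideal A) (y : Fin k → A) :
    y ∈ (I • ⊤ : Submodule A (Fin k → A)) ↔ ∀ i, y i ∈ I := by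
  constructor
  · intro h i
    induction h using Submodule.smul_induction_on' with
    | smul a ha z _ => exact I.mul_mem_right _ ha
    | add a _ b _ ha hb => exact I.add_mem ha hb
  · intro h
    have : y = ∑ i, y i • (Pi.single i 1 : Fin k → A) := by
      conv_lhs => rw [← LinearMap.sum_single_apply (fun _ : Fin k => A) y]
      exact Finset.sum_congr rfl fun i _ => by rw [← Pi.single_smul, smul_eq_mul, mul_one]
    rw [this]
    exact Submodule.sum_mem _ fun i _ => Submodule.smul_mem_smul (h i) trivial

omit [IsNoetherianRing A] [IsLocalRing A] in
lemma eq_zero_of_free_of_smul {M : Type v} [AddCommGroup M] [Module A M] [Module.Free A M] {x : A}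
    (reg : IsSMulRegular A x) (hxM : ∀ m : M, x • m = 0) : Subsingleton M := by
  have : IsSMulRegular M x := by
    rw [(Module.Free.chooseBasis A M).repr.isSMulRegular_congr]
    intro a b h
    ext i
    exact reg (DFunLike.congr_fun h i)
  exact ⟨fun a b => this (by simp [hxM])⟩

/-- Nagata: dividing by a regular element outside the square of the maximal ideal lowers the
projective dimension of the modules it kills. -/
theorem PDLT.quotient_of_notMem_sq {x : A} (reg : IsSMulRegular A x) (hx : x ∈ maximalIdeal A)
    (hx2 : x ∉ maximalIdeal A ^ 2) (n : ℕ) (M : Type v) [AddCommGroup M] [Module A M]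
    [Module (A ⧸ Ideal.span {x}) M] [IsScalarTower A (A ⧸ Ideal.span {x}) M] [Module.Finite A M]
    (h : PDLT A M (n + 1)) : PDLT (A ⧸ Ideal.span {x}) M n := by
  have := isLocalRing_quotient (I := Ideal.span {x}) (T := A)
    ((Ideal.span_singleton_le_iff_mem _).2 hx)
  have hmk : algebraMap A (A ⧸ Ideal.span {x}) x = 0 :=
    Ideal.Quotient.eq_zero_iff_mem.2 (Ideal.mem_span_singleton_self x)
  induction n generalizing M with
  | zero =>
    have hxM : ∀ m : M, x • m = 0 := fun m => by
      rw [← algebraMap_smul (A ⧸ Ideal.span {x}) x m, hmk, zero_smul]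
    rw [zero_add, pdlt_one_iff] at h
    have : Module.Free A M := Module.free_of_flat_of_isLocalRing
    exact pdlt_zero_iff.2 (eq_zero_of_free_of_smul reg hxM)
  | succ n ih =>
    have hxM : ∀ m : M, x • m = 0 := fun m => by
      rw [← algebraMap_smul (A ⧸ Ideal.span {x}) x m, hmk, zero_smul]
    obtain ⟨k, f, hf, hmin⟩ := exists_minimal_cover (A := A) M
    -- the kernel `K` contains `x F`
    let K := LinearMap.ker f
    let g : (Fin k → A) →ₗ[A] K := (LinearMap.lsmul A (Fin k → A) x).codRestrict K
      (fun y => by simp [K, hxM])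
    have hg : ∀ y, (g y : Fin k → A) = x • y := fun y => rfl
    have hginj : Function.Injective g := by
      intro a b hab
      have := congrArg Subtype.val hab
      rw [hg, hg] at this
      exact funext fun i => reg (congrFun this i)
    let B := A ⧸ Ideal.span {x}
    -- the cover over the quotient ring
    let fB : (Fin k → B) →ₗ[B] M := Fintype.linearCombination B (fun i => f (Pi.single i 1))
    have hfB : ∀ y : Fin k → A, fB (fun i => algebraMap A B (y i)) = f y := by
      intro y
      simp only [fB, Fintype.linearCombination_apply, algebraMap_smul]
      conv_rhs => rw [← LinearMap.sum_single_apply (fun _ : Fin k => A) y]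
      rw [map_sum]
      refine Finset.sum_congr rfl fun i _ => ?_
      rw [← map_smul, ← Pi.single_smul, smul_eq_mul, mul_one]
    have hfBs : Function.Surjective fB := by
      intro m
      obtain ⟨y, rfl⟩ := hf m
      exact ⟨_, hfB y⟩
    -- Reduction modulo `x` gives `0 → F → K → ker fB → 0` over `A` with `F = Aᵏ`, the first map
    -- being multiplication by `x`. It compares the syzygies of `M` over `A` and over `A/(x)`.
    let q : K →ₗ[A] LinearMap.ker fB :=
      { toFun := fun y => ⟨fun i => algebraMap A B (y.1 i), by
          rw [LinearMap.mem_ker, hfB]; exact y.2⟩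
        map_add' := fun a b => by ext; simp
        map_smul' := fun a b => by
          ext i
          simp [Algebra.smul_def] }
    have hq : Function.Surjective q := by
      rintro ⟨z, hz⟩
      choose y hy using fun i => Ideal.Quotient.mk_surjective (z i)
      have hzy : z = fun i => algebraMap A B (y i) := funext fun i => (hy i).symm
      subst hzy
      rw [LinearMap.mem_ker, hfB] at hz
      exact ⟨⟨y, hz⟩, rfl⟩
    have hgq : Function.Exact g q := by
      intro y
      constructor
      · intro hy
        have h1 : ∀ i, y.1 i ∈ Ideal.span {x} := fun i =>
          Ideal.Quotient.eq_zero_iff_mem.1 (congrFun (congrArg Subtype.val hy) i)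
        choose c hc using fun i => Ideal.mem_span_singleton'.1 (h1 i)
        refine ⟨c, Subtype.ext (funext fun i => ?_)⟩
        rw [hg, ← hc i, mul_comm]
        rfl
      · rintro ⟨c, rfl⟩
        ext i
        have : algebraMap A B x = 0 := hmk
        simp [q, hg, this]
    have : Module.Finite A (LinearMap.ker fB) := Module.Finite.of_surjective q hq
    cases n with
    | zero =>
      have hK : Module.Projective A K :=
        pdlt_one_iff.1 ((pdlt_ker_iff f hf 0).1 h)
      -- Here `x ∉ 𝔪²` enters. If `x y ∈ 𝔪K ⊆ 𝔪²F`, then no coordinate of `y` is a unit, so `F → K`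
      -- is injective modulo `𝔪` and its cokernel is `A`-flat. Being free over `A` and killed by the
      -- regular element `x`, that cokernel vanishes, so `M` is free over `A/(x)`.
      have hfl : Module.Flat A (LinearMap.ker fB) := by
        refine flat_of_closedFibre_injective (R := A) (T := A) g ?_ q hq hgq
        rw [lTensor_quotient_injective_iff]
        intro y hy
        have hle : (maximalIdeal A • ⊤ : Submodule A K).map K.subtype ≤
            ((maximalIdeal A ^ 2 : Ideal A) • ⊤ : Submodule A (Fin k → A)) := by
          rw [Submodule.map_smul'', Submodule.map_top, Submodule.range_subtype, pow_two,
            mul_smul]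
          refine smul_mono_right _ fun z hz => ?_
          rw [mem_ideal_smul_pi_iff]
          exact fun i => hmin z hz i
        have h1 := hle (Submodule.mem_map_of_mem hy)
        rw [mem_ideal_smul_pi_iff] at h1 ⊢
        intro i
        by_contra hi
        have hu : IsUnit (y i) := by simpa using hi
        have h2 : x * y i ∈ maximalIdeal A ^ 2 := h1 i
        exact hx2 ((Ideal.mul_unit_mem_iff_mem _ hu).1 h2)
      have : Module.Free A (LinearMap.ker fB) := Module.free_of_flat_of_isLocalRing
      have hsub : Subsingleton (LinearMap.ker fB) := eq_zero_of_free_of_smul reg fun m => by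
        rw [← algebraMap_smul B x m, hmk, zero_smul]
      rw [zero_add, pdlt_one_iff]
      have hinj : Function.Injective fB := LinearMap.ker_eq_bot.1
        ((Submodule.subsingleton_iff_eq_bot).1 hsub)
      exact Module.Projective.of_equiv (LinearEquiv.ofBijective fB ⟨hinj, hfBs⟩)
    | succ n =>
      have h1 : PDLT A K (n + 2) := (pdlt_ker_iff f hf (n + 1)).1 h
      have h2 : PDLT A (LinearMap.ker fB) (n + 2) :=
        PDLT.of_exact hginj hgq hq ((pdlt_one_iff.2 inferInstance : PDLT A (Fin k → A) 1).mono
          (by omega)) h1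
      rw [pdlt_ker_iff fB hfBs n]
      exact ih _ h2

end ChangeOfRings

/-! ### Regular sequences, Ext vanishing and projective dimension. -/

section Ext

open Abelian RingTheory.Sequence

variable {A : Type v} [CommRing A] [IsNoetherianRing A]

/-- Exchange property of regular sequences: any `M`-regular `z ∈ I` can be the first element of a
regular sequence in `I` of a given possible length. -/
theorem exists_isRegular_quotSMulTop (I : Ideal A) (n : ℕ) (M : Type v) [AddCommGroup M]
    [Module A M] [Module.Finite A M] (hI : I • (⊤ : Submodule A M) < ⊤)
    (hM : ∃ rs : List A, rs.length = n + 1 ∧ (∀ r ∈ rs, r ∈ I) ∧ IsRegular M rs)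
    {z : A} (hz : z ∈ I) (hreg : IsSMulRegular M z) :
    ∃ rs : List A, rs.length = n ∧ (∀ r ∈ rs, r ∈ I) ∧ IsRegular (QuotSMulTop z M) rs := by
  have hI' : I • (⊤ : Submodule A (QuotSMulTop z M)) < ⊤ := by
    refine lt_top_iff_ne_top.2 fun h => hI.ne ?_
    have h1 := congrArg (Submodule.comap (Submodule.mkQ (z • ⊤ : Submodule A M))) h
    rw [Submodule.comap_smul_top_of_surjective I _ (Submodule.mkQ_surjective _),
      Submodule.ker_mkQ, Submodule.comap_top] at h1
    rwa [sup_eq_left.2 _] at h1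
    rw [← Submodule.ideal_span_singleton_smul]
    exact Submodule.smul_mono_left ((Ideal.span_singleton_le_iff_mem I).2 hz)
  -- Existence of a regular sequence of given length is equivalent to vanishing of Ext below that
  -- length. The long exact sequence of `0 → M → M → M/zM → 0` loses exactly one degree.
  have h1 := ((ModuleCat.exists_isRegular_tfae I (n + 1) (ModuleCat.of A M) hI).out 3 1).1 hM
  refine ((ModuleCat.exists_isRegular_tfae I n (ModuleCat.of A (QuotSMulTop z M)) hI').out 1 3).1
    fun i hi => ?_
  have zero1 := AddCommGrpCat.isZero_of_iff_subsingleton.mpr (h1 i (by omega))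
  have zero2 := AddCommGrpCat.isZero_of_iff_subsingleton.mpr (h1 (i + 1) (by omega))
  exact AddCommGrpCat.subsingleton_of_isZero <| ShortComplex.Exact.isZero_of_both_zeros
    ((Ext.covariant_sequence_exact₃' _
      (IsSMulRegular.smulShortComplex_shortExact (M := ModuleCat.of A M) hreg)) i (i + 1) rfl)
    (zero1.eq_zero_of_src _) (zero2.eq_zero_of_tgt _)

/-- For finite `L = Aᵐ/K`, the group `Ext^i(N, L)` sits between `Ext^i(N, Aᵐ)` and `Ext^{i+1}(N,
K)`. The first vanishes by hypothesis, the second because `pd N ≤ i`, and finite `L` suffice to test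
projective dimension. -/
lemma PDLT.pred_of_subsingleton_ext {N : Type v} [AddCommGroup N] [Module A N] [Module.Finite A N]
    {i : ℕ} (h : PDLT A N (i + 1))
    (hext : ∀ m : ℕ, Subsingleton (Ext (ModuleCat.of A N) (ModuleCat.of A (Fin m → A)) i)) :
    PDLT A N i := by
  refine ModuleCat.hasProjectiveDimensionLT_of_forall_finite _ i fun L _ => ?_
  obtain ⟨m, f, hf⟩ := Module.Finite.exists_fin' A L
  have hS := LinearMap.shortExact_shortComplexKer hf
  have zero1 := AddCommGrpCat.isZero_of_iff_subsingleton.mpr (hext m)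
  have zero2 := AddCommGrpCat.isZero_of_iff_subsingleton.mpr
    (h.subsingleton (ModuleCat.of A N) (i + 1) (i + 1) le_rfl
      (ModuleCat.of A (LinearMap.ker f)))
  exact AddCommGrpCat.subsingleton_of_isZero <| ShortComplex.Exact.isZero_of_both_zeros
    ((Ext.covariant_sequence_exact₃' _ hS) i (i + 1) rfl)
    (zero1.eq_zero_of_src _) (zero2.eq_zero_of_tgt _)

/-- The projective dimension of `A ⧸ J` is at least the length of a regular sequence in `J`. -/
theorem not_pdlt_of_isRegular [IsLocalRing A] {J : Ideal A} (hJ : J ≠ ⊤) (rs : List A)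
    (hreg : IsRegular A rs) (hrs : ∀ r ∈ rs, r ∈ J) : ¬ PDLT A (A ⧸ J) rs.length := by
  intro h
  have key : ∀ i m : ℕ, i < rs.length →
      Subsingleton (Ext (ModuleCat.of A (A ⧸ J)) (ModuleCat.of A (Fin m → A)) i) := by
    intro i m hi
    have hmem : ∀ r ∈ rs, r ∈ maximalIdeal A := fun r hr => le_maximalIdeal hJ (hrs r hr)
    -- The zero module is treated apart because no sequence is regular on it.
    rcases Nat.eq_zero_or_pos m with rfl | hm
    · have h0 : Limits.IsZero (ModuleCat.of A (Fin 0 → A)) :=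
        (ModuleCat.isZero_iff_subsingleton).2 inferInstance
      have hz : ∀ e : Ext (ModuleCat.of A (A ⧸ J)) (ModuleCat.of A (Fin 0 → A)) i, e = 0 :=
        fun e => by rw [← e.comp_mk₀_id, h0.eq_of_src (𝟙 _) 0, Ext.mk₀_zero, Ext.comp_zero]
      exact ⟨fun a b => (hz a).trans (hz b).symm⟩
    have : Nonempty (Fin m) := ⟨⟨0, hm⟩⟩
    have hw : IsWeaklyRegular (Fin m → A) rs :=
      ((TensorProduct.rid A (Fin m → A)).isWeaklyRegular_congr rs).1
        (hreg.toIsWeaklyRegular.isWeaklyRegular_lTensor (M₂ := (Fin m → A)))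
    refine ModuleCat.subsingleton_ext_of_exists_isRegular J (ModuleCat.of A (A ⧸ J)) ?_
      (ModuleCat.of A (Fin m → A)) ?_ rs hrs ?_ i hi
    · rw [Module.support_eq_zeroLocus, Ideal.annihilator_quotient]
    · refine lt_top_iff_ne_top.2 (Ne.symm ?_)
      exact Submodule.top_ne_ideal_smul_of_le_jacobson_annihilator
        ((le_maximalIdeal hJ).trans (maximalIdeal_le_jacobson _))
    · exact (IsLocalRing.isRegular_iff_isWeaklyRegular_of_subset_maximalIdeal hmem).2 hw
  -- Starting from `pd < rs.length`, the vanishing of Ext into free modules lowers the bound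
  -- repeatedly down to `pd < 0`, that is `A/J = 0`.
  have h0 : ∀ i, i ≤ rs.length → PDLT A (A ⧸ J) (rs.length - i) := by
    intro i
    induction i with
    | zero => intro _; exact h
    | succ i ih =>
      intro hi
      refine PDLT.pred_of_subsingleton_ext ?_ fun m => key _ m (by omega)
      have := ih (by omega)
      rwa [show rs.length - i = rs.length - (i + 1) + 1 by omega] at this
  have := pdlt_zero_iff.1 (by simpa using h0 rs.length le_rfl)
  exact hJ (Ideal.Quotient.subsingleton_iff.1 this)

end Ext

/-! ### Projective dimension of `R`-flat modules over flat algebras with regular closed fibre. -/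

section FlatModules

/-- Flatness of `M` makes the sequence universally exact. Hence `K ⊗ 𝔞 → F ⊗ 𝔞 → F` is injective,
which gives flatness, and `K ∩ IF = IK`. -/
lemma flat_of_exact_of_flat {R : Type w} [CommRing R] {K F M : Type*} [AddCommGroup K]
    [Module R K] [AddCommGroup F] [Module R F] [AddCommGroup M] [Module R M]
    [Module.Flat R F] [Module.Flat R M] {g : K →ₗ[R] F} {f : F →ₗ[R] M}
    (hg : Function.Injective g) (hgf : Function.Exact g f) (hf : Function.Surjective f) :
    Module.Flat R K ∧ ∀ I : Ideal R, ∀ x : K, g x ∈ (I • ⊤ : Submodule R F) →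
        x ∈ (I • ⊤ : Submodule R K) := by
  have h1 : ∀ (N : Type w) [AddCommGroup N] [Module R N], Function.Injective (g.lTensor N) :=
    fun N _ _ => LinearMap.lTensor_injective_of_exact_of_flat f hf g hg hgf N
  constructor
  · rw [Module.Flat.iff_lTensor_injective']
    intro a
    have h2 : Function.Injective (g.rTensor R ∘ₗ a.subtype.lTensor K) := by
      rw [LinearMap.rTensor_comp_lTensor, ← LinearMap.lTensor_comp_rTensor, LinearMap.coe_comp]
      refine (Module.Flat.lTensor_preserves_injective_linearMap (M := F) a.subtype
        a.injective_subtype).comp ?_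
      have := h1 a
      rwa [LinearMap.lTensor_inj_iff_rTensor_inj] at this
    rw [LinearMap.coe_comp] at h2
    exact h2.of_comp
  · intro I
    exact (lTensor_quotient_injective_iff I g).1 (h1 (R ⧸ I))

end FlatModules

section

variable {R : Type u} [CommRing R]

lemma mem_smul_top_iff_mem_map_smul_top {T M : Type*} [CommRing T] [Algebra R T]
    [AddCommGroup M] [Module R M] [Module T M] [IsScalarTower R T M] (I : Ideal R) (x : M) :
    x ∈ (I • ⊤ : Submodule R M) ↔ x ∈ (I.map (algebraMap R T) • ⊤ : Submodule T M) := by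
  have h := Ideal.smul_restrictScalars I (⊤ : Submodule T M)
  rw [Submodule.restrictScalars_top] at h
  rw [← h, Submodule.restrictScalars_mem]

variable [IsLocalRing R]

/-- A minimal cover is injective modulo `𝔫_T = 𝔪T`, since its kernel lies in `𝔪T` times the free
module. The local criterion over `R` then makes it injective. -/
lemma free_of_flat_of_map_eq_maximalIdeal {T : Type v} [CommRing T] [Algebra R T] [IsLocalRing T]
    [IsNoetherianRing T] [IsLocalHom (algebraMap R T)] [Module.Flat R T]
    (hmax : maximalIdeal T = (maximalIdeal R).map (algebraMap R T))
    (M : Type v) [AddCommGroup M] [Module R M] [Module T M] [IsScalarTower R T M]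
    [Module.Finite T M] [Module.Flat R M] : Module.Free T M := by
  obtain ⟨k, f, hf, hmin⟩ := exists_minimal_cover (A := T) M
  have hinj : Function.Injective f := by
    refine injective_of_closedFibre_injective (R := R) f ?_
    rw [lTensor_quotient_injective_iff]
    intro x hx
    rw [LinearMap.coe_restrictScalars] at hx
    rw [mem_smul_top_iff_mem_map_smul_top (T := T)] at hx ⊢
    have h1 : (⊤ : Submodule T M) = (⊤ : Submodule T (Fin k → T)).map f := by
      rw [Submodule.map_top, LinearMap.range_eq_top.2 hf]
    rw [h1, ← Submodule.map_smul''] at hx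
    obtain ⟨y, hy, hxy⟩ := hx
    have h2 : x - y ∈ ((maximalIdeal R).map (algebraMap R T) • ⊤ : Submodule T (Fin k → T)) := by
      rw [mem_ideal_smul_pi_iff, ← hmax]
      exact hmin _ (by rw [LinearMap.mem_ker, map_sub, hxy, sub_self])
    simpa using Submodule.add_mem _ h2 hy
  exact Module.Free.of_equiv (LinearEquiv.ofBijective f ⟨hinj, hf⟩)

/-- A finite `R`-flat module over a flat local `R`-algebra whose closed fibre has maximal ideal
generated by a regular sequence of length `n` has projective dimension at most `n`. -/
theorem pdlt_of_flat_of_closedFibre (n : ℕ) : ∀ {T : Type v} [CommRing T] [Algebra R T]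
    [IsLocalRing T] [IsNoetherianRing T] [IsLocalHom (algebraMap R T)] [Module.Flat R T]
    (ys : List T), ys.length = n →
    maximalIdeal T = (maximalIdeal R).map (algebraMap R T) ⊔ Ideal.ofList ys →
    RingTheory.Sequence.IsWeaklyRegular (T ⧸ (maximalIdeal R).map (algebraMap R T)) ys →
    ∀ (M : Type v) [AddCommGroup M] [Module R M] [Module T M] [IsScalarTower R T M]
      [Module.Finite T M] [Module.Flat R M], PDLT T M (n + 1) := by
  induction n with
  | zero =>
    intro T _ _ _ _ _ _ ys hlen hmax _ M _ _ _ _ _ _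
    rw [List.length_eq_zero_iff.1 hlen, Ideal.ofList_nil, sup_bot_eq] at hmax
    have := free_of_flat_of_map_eq_maximalIdeal hmax M
    exact pdlt_one_iff.2 inferInstance
  | succ n ih =>
    intro T _ _ _ _ _ _ ys hlen hmax hreg M _ _ _ _ _ _
    match ys with
    | [] => simp at hlen
    | y :: ys =>
      rw [isWeaklyRegular_closedFibre_cons_iff] at hreg
      obtain ⟨hy1, hy2⟩ := isSMulRegular_and_flat_quotient y hreg.1
      have hy : y ∈ maximalIdeal T := by
        rw [hmax, Ideal.ofList_cons]
        exact (le_sup_left.trans le_sup_right : Ideal.span {y} ≤ _) (Ideal.mem_span_singleton_self y)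
      have hyle := (Ideal.span_singleton_le_iff_mem _).2 hy
      have := isLocalRing_quotient hyle
      have : IsLocalHom (algebraMap R (T ⧸ Ideal.span {y})) := isLocalHom_algebraMap_quotient
      obtain ⟨k, f, hf⟩ := Module.Finite.exists_fin' T M
      -- `y` need not be regular on `M`, but it is on the syzygy `K`, which is `R`-flat with `K ∩ 𝔪F
      -- = 𝔪K`. The induction bounds the projective dimension of `K/yK` over `T/(y)`; restriction to
      -- `T` raises the bound by one, and removing `y` gives that one back.
      let K := LinearMap.ker f
      have : Module.Flat R (Fin k → T) :=
        (Module.Flat.of_linearEquiv (DirectSum.linearEquivFunOnFintype R (Fin k) fun _ => T).symm)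
      obtain ⟨hK1, hK2⟩ := flat_of_exact_of_flat (R := R) (g := K.subtype.restrictScalars R)
        (f := f.restrictScalars R) K.injective_subtype (LinearMap.exact_subtype_ker_map f) hf
      obtain ⟨hr1, hr2⟩ := isSMulRegular_and_flat_of_closedFibre (R := R) (M := K) y (by
        intro x hx
        refine hK2 _ x ?_
        have h1 : (y • x : K).1 ∈ (maximalIdeal R • ⊤ : Submodule R (Fin k → T)) := by
          have := Submodule.mem_map_of_mem (f := K.subtype.restrictScalars R) hx
          rw [Submodule.map_smul''] at this
          exact (smul_mono_right (maximalIdeal R) le_top :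
            maximalIdeal R • (⊤ : Submodule R K).map (K.subtype.restrictScalars R) ≤ _) this
        change x.1 ∈ _
        rw [mem_smul_top_iff_mem_map_smul_top (T := T), mem_ideal_smul_pi_iff] at h1 ⊢
        exact fun i => mem_of_isSMulRegular_quotient_of_smul_mem hreg.1 (h1 i))
      rw [pdlt_ker_iff f hf]
      rw [← quotSMulTop_pdlt_iff hr1 hy]
      have : IsScalarTower R (T ⧸ Ideal.span {y}) (QuotSMulTop y K) := by
        refine ⟨fun r t x => ?_⟩
        obtain ⟨t, rfl⟩ := Ideal.Quotient.mk_surjective t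
        have h1 : r • Ideal.Quotient.mk (Ideal.span {y}) t = Ideal.Quotient.mk _ (r • t) := rfl
        have h2 : ∀ (s : T) (x : QuotSMulTop y K),
          Ideal.Quotient.mk (Ideal.span {y}) s • x = s • x := fun s x =>
            algebraMap_smul (T ⧸ Ideal.span {y}) s x
        rw [h1, h2, h2, smul_assoc]
      have := Module.Finite.of_restrictScalars_finite T (T ⧸ Ideal.span {y}) (QuotSMulTop y K)
      refine PDLT.restrictScalars_quotient hy1 hy (n + 1) _ ?_
      refine ih (ys.map (algebraMap T (T ⧸ Ideal.span {y}))) (by simpa using hlen) ?_ ?_ _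
      · rw [map_maximalIdeal_quotient, ← Ideal.map_ofList, ← Ideal.map_sup]
        have h1 : (maximalIdeal T).map (algebraMap T (T ⧸ Ideal.span {y})) =
            maximalIdeal (T ⧸ Ideal.span {y}) :=
          map_maximalIdeal_of_surjective _ Ideal.Quotient.mk_surjective
        rw [← h1, hmax, Ideal.ofList_cons, Ideal.map_sup, Ideal.map_sup, Ideal.map_sup]
        have h2 : (Ideal.span {y}).map (algebraMap T (T ⧸ Ideal.span {y})) = ⊥ :=
          Ideal.map_quotient_self _
        rw [h2, bot_sup_eq]
      · rw [map_maximalIdeal_quotient]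
        exact hreg.2

end

/-! ### Embedding dimension. -/

section EmbeddingDimension

variable {A : Type*} [CommRing A] [IsLocalRing A] [IsNoetherianRing A]

lemma exists_span_maximalIdeal_card_eq_edim (A : Type*) [CommRing A] [IsLocalRing A]
    [IsNoetherianRing A] : ∃ s : Finset A, s.card = edim A ∧ Ideal.span (s : Set A) = maximalIdeal A :=
  (IsNoetherian.noetherian (maximalIdeal A)).exists_span_finset_card_eq_spanFinrank

omit [IsNoetherianRing A] in
lemma edim_le_card (s : Finset A) (hs : Ideal.span (s : Set A) = maximalIdeal A) :
    edim A ≤ s.card := by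
  rw [edim, ← hs, ← Set.ncard_coe_finset s]
  exact Submodule.spanFinrank_span_le_ncard_of_finite s.finite_toSet

lemma le_of_le_sup_maximalIdeal_sq {I : Ideal A} (h : maximalIdeal A ≤ I ⊔ maximalIdeal A ^ 2) :
    maximalIdeal A ≤ I := by
  refine Submodule.le_of_le_smul_of_le_jacobson_bot (I := maximalIdeal A)
    (IsNoetherian.noetherian _) (IsLocalRing.maximalIdeal_le_jacobson _) ?_
  rwa [smul_eq_mul, ← pow_two]

lemma edim_le_of_surjective {B : Type*} [CommRing B] [IsLocalRing B] (f : A →+* B)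
    (hf : Function.Surjective f) : edim B ≤ edim A := by
  have : IsLocalHom f := hf.isLocalHom
  rw [edim, edim, ← map_maximalIdeal_of_surjective f hf]
  exact Ideal.spanFinrank_map_le_of_fg f (IsNoetherian.noetherian _)

/-- A kernel inside `𝔪²` does not change `𝔪/𝔪²`: lifts of minimal generators generate `𝔪` modulo
`𝔪²`, and Nakayama finishes. -/
lemma edim_eq_of_ker_le_sq {B : Type*} [CommRing B] [IsLocalRing B] (f : A →+* B)
    (hf : Function.Surjective f) (hker : RingHom.ker f ≤ maximalIdeal A ^ 2) :
    edim A = edim B := by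
  classical
  refine le_antisymm ?_ (edim_le_of_surjective f hf)
  have : IsLocalHom f := hf.isLocalHom
  have : IsNoetherianRing B := isNoetherianRing_of_surjective A B f hf
  obtain ⟨s, hs, hspan⟩ := exists_span_maximalIdeal_card_eq_edim B
  choose g hg using hf
  rw [← hs]
  refine (edim_le_card (s.image g) ?_).trans Finset.card_image_le
  have h1 : (Ideal.span (s.image g : Set A)).map f = maximalIdeal B := by
    rw [Ideal.map_span, ← hspan, Finset.coe_image, ← Set.image_comp]
    congr 1
    convert Set.image_id _
    exact funext hg
  apply le_antisymm
  · rw [Ideal.span_le, Finset.coe_image, Set.image_subset_iff]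
    intro x hx
    have : f (g x) ∈ maximalIdeal B := by
      rw [hg, ← hspan]; exact Ideal.subset_span hx
    exact (map_mem_nonunits_iff f _).1 this
  · refine le_of_le_sup_maximalIdeal_sq ?_
    intro x hx
    have h2 : f x ∈ (Ideal.span (s.image g : Set A)).map f := by
      rw [h1]; exact (map_mem_nonunits_iff f _).2 hx
    obtain ⟨y, hy, hxy⟩ := (Ideal.mem_map_iff_of_surjective f (fun b => ⟨g b, hg b⟩)).1 h2
    rw [← sub_add_cancel x y, add_comm]
    exact Submodule.add_mem_sup hy (hker (by rw [RingHom.mem_ker, map_sub, hxy, sub_self]))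

lemma edim_quotient_span_singleton_add_one {z : A} (hz : z ∈ maximalIdeal A)
    (hz2 : z ∉ maximalIdeal A ^ 2) [IsLocalRing (A ⧸ Ideal.span {z})] :
    edim (A ⧸ Ideal.span {z}) + 1 = edim A := by
  classical
  let f := Ideal.Quotient.mk (Ideal.span {z})
  have hf : Function.Surjective f := Ideal.Quotient.mk_surjective
  have : IsLocalHom f := hf.isLocalHom
  have hmap := map_maximalIdeal_of_surjective f hf
  apply le_antisymm
  · obtain ⟨s, hs, hspan⟩ := exists_span_maximalIdeal_card_eq_edim A
    obtain ⟨a, ha⟩ : ∃ a : A → A, ∑ x ∈ s, a x * x = z := by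
      rw [← hspan] at hz
      obtain ⟨a, -, ha⟩ := Submodule.mem_span_finset.1 hz
      exact ⟨a, ha⟩
    -- If no coefficient were a unit, `z` would lie in `𝔪²`. Modulo `z` the generator with unit
    -- coefficient is redundant.
    obtain ⟨j, hj, hja⟩ : ∃ j ∈ s, IsUnit (a j) := by
      by_contra! h
      apply hz2
      rw [← ha, pow_two]
      refine Ideal.sum_mem _ fun x hx => Ideal.mul_mem_mul ((mem_maximalIdeal _).2 (h x hx)) ?_
      rw [← hspan]
      exact Ideal.subset_span hx
    have hcard : ((s.erase j).image f).card + 1 ≤ edim A := by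
      rw [← hs, ← Finset.card_erase_add_one hj]
      exact Nat.add_le_add_right Finset.card_image_le 1
    refine le_trans (Nat.add_le_add_right (edim_le_card _ ?_) 1) hcard
    rw [← hmap, ← hspan, Ideal.map_span]
    apply le_antisymm
    · refine Ideal.span_mono ?_
      rw [Finset.coe_image]
      exact Set.image_mono (by simp)
    · rw [Ideal.span_le]
      rintro _ ⟨x, hx, rfl⟩
      by_cases hxj : x = j
      · subst hxj
        have h1 : f (a x) * f x = - ∑ y ∈ s.erase x, f (a y) * f y := by
          rw [eq_neg_iff_add_eq_zero, Finset.add_sum_erase s (fun y => f (a y) * f y) hj]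
          simp only [← map_mul, ← map_sum, ha]
          exact Ideal.Quotient.eq_zero_iff_mem.2 (Ideal.mem_span_singleton_self z)
        have h2 : f (a x) * f x ∈ Ideal.span (((s.erase x).image f : Finset _) : Set _) := by
          rw [h1]
          refine neg_mem (Ideal.sum_mem _ fun y hy => Ideal.mul_mem_left _ _ (Ideal.subset_span ?_))
          rw [Finset.coe_image]
          exact ⟨y, hy, rfl⟩
        exact (Ideal.unit_mul_mem_iff_mem _ (hja.map f)).1 h2
      · exact Ideal.subset_span (by rw [Finset.coe_image]; exact ⟨x, by simpa [hxj] using hx, rfl⟩)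
  · have : IsNoetherianRing (A ⧸ Ideal.span {z}) := inferInstance
    obtain ⟨s, hs, hspan⟩ := exists_span_maximalIdeal_card_eq_edim (A ⧸ Ideal.span {z})
    choose g hg using hf
    rw [← hs]
    refine (edim_le_card (insert z (s.image g)) ?_).trans
      ((Finset.card_insert_le _ _).trans (Nat.add_le_add_right Finset.card_image_le 1))
    have h1 : (Ideal.span (s.image g : Set A)).map f = maximalIdeal _ := by
      rw [Ideal.map_span, ← hspan, Finset.coe_image, ← Set.image_comp]
      congr 1
      convert Set.image_id _
      exact funext hg
    rw [Finset.coe_insert, Ideal.span_insert]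
    have h2 := congrArg (Ideal.comap f) h1
    rw [Ideal.comap_map_of_surjective _ (fun b => ⟨g b, hg b⟩), ← hmap,
      Ideal.comap_map_of_surjective _ (fun b => ⟨g b, hg b⟩)] at h2
    have h3 : Ideal.comap f ⊥ = Ideal.span {z} := Ideal.mk_ker
    rw [h3] at h2
    rw [sup_comm, h2, sup_eq_left]
    exact (Ideal.span_singleton_le_iff_mem _).2 hz

/-- Among any finite family generating the maximal ideal there are `edim A` members that
generate it. -/
lemma exists_subfamily_span_eq_maximalIdeal {ι : Type*} [Finite ι] (g : ι → A)
    (hg : Ideal.span (Set.range g) = maximalIdeal A) :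
    ∃ s : Finset ι, s.card = edim A ∧ Ideal.span (g '' s) = maximalIdeal A := by
  classical
  have hmem : ∀ i, g i ∈ maximalIdeal A := fun i => hg ▸ Ideal.subset_span ⟨i, rfl⟩
  let g' : ι → maximalIdeal A := fun i => ⟨g i, hmem i⟩
  have key : ∀ t : Set ι, Submodule.span A (g' '' t) = ⊤ ↔ Ideal.span (g '' t) = maximalIdeal A := by
    intro t
    have h1 : g '' t = (maximalIdeal A).subtype '' (g' '' t) := by
      rw [← Set.image_comp]; rfl
    have h2 : (⊤ : Submodule A (maximalIdeal A)).map (maximalIdeal A).subtype = maximalIdeal A := by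
      rw [Submodule.map_top, Submodule.range_subtype]
    rw [Ideal.span, h1, ← Submodule.map_span]
    exact (Submodule.map_injective_of_injective
      (Submodule.injective_subtype _)).eq_iff.symm.trans (Eq.congr_right h2)
  have hspan : Submodule.span (ResidueField A)
      (Set.range fun i => (maximalIdeal A).toCotangent (g' i)) = ⊤ := by
    rw [← Set.image_univ, ← Function.comp_def, Set.image_comp,
      CotangentSpace.span_image_eq_top_iff, key, Set.image_univ, hg]
  obtain ⟨κ, a, ha, hspan', hli⟩ := exists_linearIndependent' (ResidueField A)
    (fun i => (maximalIdeal A).toCotangent (g' i))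
  have : Finite κ := Finite.of_injective a ha
  have := Fintype.ofFinite κ
  refine ⟨Finset.univ.image a, ?_, ?_⟩
  · rw [Finset.card_image_of_injective _ ha, Finset.card_univ, ← finrank_span_eq_card hli, hspan',
      hspan, finrank_top, edim, spanFinrank_maximalIdeal_eq_finrank_cotangentSpace]
  · rw [← key, ← CotangentSpace.span_image_eq_top_iff, ← hspan, ← hspan']
    simp only [Finset.coe_image, Finset.coe_univ, Set.image_univ, ← Set.range_comp]
    rfl

end EmbeddingDimension

section

variable {R : Type*} [CommRing R] [IsLocalRing R] [IsNoetherianRing R]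
  {T : Type*} [CommRing T] [IsLocalRing T] [IsNoetherianRing T] [Algebra R T]
  [Module.Flat R T] [IsLocalHom (algebraMap R T)]

/-- Among the images of generators of `𝔪_R`, `edim T` of them generate `𝔫_T`. By faithful flatness,
contracting shows that their preimages already generate `𝔪_R`. -/
lemma edim_eq_of_map_maximalIdeal_eq
    (h : maximalIdeal T = (maximalIdeal R).map (algebraMap R T)) : edim T = edim R := by
  classical
  apply le_antisymm
  · rw [edim, h]
    exact Ideal.spanFinrank_map_le_of_fg _ (IsNoetherian.noetherian _)
  · obtain ⟨s, -, hspan⟩ := exists_span_maximalIdeal_card_eq_edim R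
    obtain ⟨t, ht, htspan⟩ := exists_subfamily_span_eq_maximalIdeal
      (fun x : s => algebraMap R T x) (by
        rw [h, ← hspan, Ideal.map_span]
        congr 1
        ext; simp)
    rw [← ht]
    refine (edim_le_card (t.image (fun x : s => (x : R))) ?_).trans Finset.card_image_le
    have : Module.FaithfullyFlat R T := Module.FaithfullyFlat.of_flat_of_isLocalHom
    have h2 : (Ideal.span ((t.image (fun x : s => (x : R)) : Finset R) : Set R)).map
        (algebraMap R T) = (maximalIdeal R).map (algebraMap R T) := by
      rw [← h, ← htspan, Ideal.map_span, Finset.coe_image, ← Set.image_comp]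
      rfl
    rw [← Ideal.comap_map_eq_self_of_faithfullyFlat (B := T) (maximalIdeal R), ← h2,
      Ideal.comap_map_eq_self_of_faithfullyFlat]

end

/-! ### Regular local rings through regular systems of parameters. -/

section

variable {P : Type*} [CommRing P] [IsLocalRing P] [IsNoetherianRing P]

lemma ringKrullDim_eq_length_of_isWeaklyRegular {ys : List P}
    (hmax : maximalIdeal P = Ideal.ofList ys) (hreg : RingTheory.Sequence.IsWeaklyRegular P ys) :
    ringKrullDim P = ys.length := by
  have h1 : RingTheory.Sequence.IsRegular P ys :=
    ⟨hreg, by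
      rw [← hmax, smul_eq_mul, Ideal.mul_top]
      exact (Ideal.IsPrime.ne_top inferInstance).symm⟩
  rw [← ringKrullDim_add_length_eq_ringKrullDim_of_isRegular ys h1, ← hmax,
    ringKrullDim_eq_zero_of_isField
      ((Ideal.Quotient.maximal_ideal_iff_isField_quotient _).1 inferInstance), zero_add]

omit [IsNoetherianRing P] in
lemma edim_le_length {ys : List P} (hmax : maximalIdeal P = Ideal.ofList ys) :
    edim P ≤ ys.length := by
  classical
  refine (edim_le_card ys.toFinset ?_).trans ys.toFinset_card_le
  rw [hmax, Ideal.ofList]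
  congr 1
  ext; simp

lemma ringKrullDim_le_edim : ringKrullDim P ≤ edim P := ringKrullDim_le_spanFinrank_maximalIdeal P

lemma isRegularLocalRing_of_isWeaklyRegular {ys : List P}
    (hmax : maximalIdeal P = Ideal.ofList ys) (hreg : RingTheory.Sequence.IsWeaklyRegular P ys) :
    IsRegularLocalRing P := by
  refine IsRegularLocalRing.of_spanFinrank_maximalIdeal_le P ?_
  rw [ringKrullDim_eq_length_of_isWeaklyRegular hmax hreg]
  exact_mod_cast edim_le_length hmax

/-- Were `y ∈ 𝔪²`, Nakayama would let `ys` alone generate `𝔪`, contradicting `dim P ≤ edim P` with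
`dim P = ys.length + 1`. -/
lemma notMem_sq_of_isWeaklyRegular_cons {y : P} {ys : List P}
    (hmax : maximalIdeal P = Ideal.ofList (y :: ys))
    (hreg : RingTheory.Sequence.IsWeaklyRegular P (y :: ys)) : y ∉ maximalIdeal P ^ 2 := by
  intro hy
  have h1 : maximalIdeal P = Ideal.ofList ys := by
    apply le_antisymm
    · refine le_of_le_sup_maximalIdeal_sq ?_
      conv_lhs => rw [hmax, Ideal.ofList_cons]
      exact sup_le (((Ideal.span_singleton_le_iff_mem _).2 hy).trans le_sup_right) le_sup_left
    · rw [hmax, Ideal.ofList_cons]; exact le_sup_right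
  have h2 := ringKrullDim_le_edim (P := P)
  rw [ringKrullDim_eq_length_of_isWeaklyRegular hmax hreg] at h2
  have h3 := edim_le_length h1
  have h4 : (y :: ys).length ≤ edim P := by exact_mod_cast h2
  simp at h4
  omega

end

/-! ### Embedding dimension and dimension in terms of the closed fibre. -/

section

variable {R : Type*} [CommRing R] [IsLocalRing R] [IsNoetherianRing R]

lemma maximalIdeal_quotient_eq_ofList {T : Type*} [CommRing T] [IsLocalRing T] (I : Ideal T)
    [IsLocalRing (T ⧸ I)] {ys : List T} (h : maximalIdeal T = I ⊔ Ideal.ofList ys) :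
    maximalIdeal (T ⧸ I) = Ideal.ofList (ys.map (algebraMap T (T ⧸ I))) := by
  have h1 : (maximalIdeal T).map (algebraMap T (T ⧸ I)) = maximalIdeal (T ⧸ I) :=
    map_maximalIdeal_of_surjective _ Ideal.Quotient.mk_surjective
  have h2 : I.map (algebraMap T (T ⧸ I)) = ⊥ := Ideal.map_quotient_self _
  rw [← h1, h, Ideal.map_sup, h2, bot_sup_eq, Ideal.map_ofList]

/-- The embedding dimension of a flat local algebra whose closed fibre is regular. -/
theorem edim_eq_edim_add_length (n : ℕ) : ∀ {T : Type v} [CommRing T] [Algebra R T]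
    [IsLocalRing T] [IsNoetherianRing T] [IsLocalHom (algebraMap R T)] [Module.Flat R T]
    (ys : List T), ys.length = n →
    maximalIdeal T = (maximalIdeal R).map (algebraMap R T) ⊔ Ideal.ofList ys →
    RingTheory.Sequence.IsWeaklyRegular (T ⧸ (maximalIdeal R).map (algebraMap R T)) ys →
    edim T = edim R + n := by
  induction n with
  | zero =>
    intro T _ _ _ _ _ _ ys hlen hmax _
    rw [List.length_eq_zero_iff.1 hlen, Ideal.ofList_nil, sup_bot_eq] at hmax
    exact edim_eq_of_map_maximalIdeal_eq hmax
  | succ n ih =>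
    intro T _ _ _ _ _ _ ys hlen hmax hreg
    match ys with
    | [] => simp at hlen
    | y :: ys =>
      have hreg' := hreg
      rw [isWeaklyRegular_closedFibre_cons_iff] at hreg
      obtain ⟨hy1, hy2⟩ := isSMulRegular_and_flat_quotient y hreg.1
      have hy : y ∈ maximalIdeal T := by
        rw [hmax, Ideal.ofList_cons]
        exact (le_sup_left.trans le_sup_right : Ideal.span {y} ≤ _) (Ideal.mem_span_singleton_self y)
      have hyle := (Ideal.span_singleton_le_iff_mem _).2 hy
      have := isLocalRing_quotient hyle
      have : IsLocalHom (algebraMap R (T ⧸ Ideal.span {y})) := isLocalHom_algebraMap_quotient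
      have := isLocalRing_quotient (IsLocalRing.map_maximalIdeal_le (algebraMap R T))
      -- Membership in `𝔫_T²` would pass to the closed fibre, where `y` is part of a regular system
      -- of parameters.
      have hy3 : y ∉ maximalIdeal T ^ 2 := by
        intro h
        rw [← RingTheory.Sequence.isWeaklyRegular_map_algebraMap_iff
          (T ⧸ (maximalIdeal R).map (algebraMap R T))] at hreg'
        refine notMem_sq_of_isWeaklyRegular_cons (maximalIdeal_quotient_eq_ofList _ hmax) hreg' ?_
        have h1 : (maximalIdeal T).map (algebraMap T (T ⧸ (maximalIdeal R).map (algebraMap R T)))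
            = maximalIdeal _ := map_maximalIdeal_of_surjective _ Ideal.Quotient.mk_surjective
        rw [← h1, ← Ideal.map_pow]
        exact Ideal.mem_map_of_mem _ h
      rw [← edim_quotient_span_singleton_add_one hy hy3,
        ih (ys.map (algebraMap T (T ⧸ Ideal.span {y}))) (by simpa using hlen) ?_ ?_, add_assoc]
      · rw [map_maximalIdeal_quotient, ← Ideal.map_ofList, ← Ideal.map_sup]
        have h1 : (maximalIdeal T).map (algebraMap T (T ⧸ Ideal.span {y})) =
            maximalIdeal (T ⧸ Ideal.span {y}) :=
          map_maximalIdeal_of_surjective _ Ideal.Quotient.mk_surjective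
        rw [← h1, hmax, Ideal.ofList_cons, Ideal.map_sup, Ideal.map_sup, Ideal.map_sup]
        have h2 : (Ideal.span {y}).map (algebraMap T (T ⧸ Ideal.span {y})) = ⊥ :=
          Ideal.map_quotient_self _
        rw [h2, bot_sup_eq]
      · rw [map_maximalIdeal_quotient]
        exact hreg.2

/-- A flat local homomorphism of Noetherian local rings of the same dimension has an Artinian
closed fibre. -/
lemma ringKrullDim_closedFibre_eq_zero {S : Type*} [CommRing S] [IsLocalRing S]
    [IsNoetherianRing S] [Algebra R S] [Module.Flat R S] [IsLocalHom (algebraMap R S)]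
    (hdim : ringKrullDim R = ringKrullDim S)
    [IsLocalRing (S ⧸ (maximalIdeal R).map (algebraMap R S))] :
    ringKrullDim (S ⧸ (maximalIdeal R).map (algebraMap R S)) = 0 := by
  have hlie : (maximalIdeal S).LiesOver (maximalIdeal R) :=
    ⟨Ideal.ext fun x => (map_mem_nonunits_iff (algebraMap R S) x).symm⟩
  -- Flatness gives going down, hence `ht 𝔫 = ht 𝔪 + ht (𝔫/𝔪S)`. All heights are finite, so equal
  -- dimensions leave zero for the fibre.
  have h := Ideal.height_eq_height_add_of_liesOver_of_hasGoingDown (maximalIdeal R) (maximalIdeal S)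
  rw [← maximalIdeal_height_eq_ringKrullDim, ← maximalIdeal_height_eq_ringKrullDim] at hdim
  have h1 : (maximalIdeal S).map (Ideal.Quotient.mk ((maximalIdeal R).map (algebraMap R S))) =
      maximalIdeal _ := map_maximalIdeal_of_surjective _ Ideal.Quotient.mk_surjective
  rw [← maximalIdeal_height_eq_ringKrullDim, ← h1]
  have h2 : (maximalIdeal R).height = (maximalIdeal S).height := by exact_mod_cast hdim
  rw [← h2] at h
  have h3 : (maximalIdeal R).height ≠ ⊤ := Ideal.height_ne_top Ideal.IsPrime.ne_top'
  have h4 := ENat.add_right_injective_of_ne_top h3 (h.symm.trans (add_zero _).symm)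
  rw [h4]
  rfl

end

/-! ### Completeness of quotients. -/

section Completeness

lemma smodEq_pow_smul_top_iff {A : Type*} [CommRing A] (I : Ideal A) (n : ℕ) (x y : A) :
    x ≡ y [SMOD (I ^ n • ⊤ : Submodule A A)] ↔ x - y ∈ I ^ n := by
  rw [SModEq.sub_mem, smul_eq_mul, Ideal.mul_top]

/-- Lift the successive differences of a Cauchy sequence to elements of `I ^ n`; their partial sums
form a Cauchy sequence upstairs, and its limit maps to a limit. -/
lemma IsPrecomplete.of_surjective_ringHom {A B : Type*} [CommRing A] [CommRing B] {I : Ideal A}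
    [IsPrecomplete I A] (f : A →+* B) (hf : Function.Surjective f) :
    IsPrecomplete (I.map f) B := by
  refine ⟨fun b hb => ?_⟩
  have h1 : ∀ n, ∃ d ∈ I ^ n, f d = b (n + 1) - b n := fun n => by
    have := (hb (Nat.le_succ n)).symm
    rw [smodEq_pow_smul_top_iff, ← Ideal.map_pow] at this
    exact (Ideal.mem_map_iff_of_surjective f hf).1 this
  choose d hd hdb using h1
  obtain ⟨a0, ha0⟩ := hf (b 0)
  let a : ℕ → A := fun n => a0 + ∑ i ∈ Finset.range n, d i
  have ha : ∀ n, f (a n) = b n := fun n => by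
    simp only [a, map_add, map_sum, hdb, Finset.sum_range_sub, ha0]
    ring
  obtain ⟨L, hL⟩ := IsPrecomplete.prec (I := I) ‹_› (f := a) (fun {m n} hmn => by
    rw [smodEq_pow_smul_top_iff]
    have : a m - a n = - ∑ i ∈ Finset.Ico m n, d i := by
      rw [Finset.sum_Ico_eq_sub _ hmn]
      simp only [a]
      ring
    rw [this]
    exact neg_mem (Ideal.sum_mem _ fun i hi =>
      Ideal.pow_le_pow_right (Finset.mem_Ico.1 hi).1 (hd i)))
  refine ⟨f L, fun n => ?_⟩
  have := hL n
  rw [smodEq_pow_smul_top_iff] at this ⊢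
  rw [← ha, ← map_sub, ← Ideal.map_pow]
  exact Ideal.mem_map_of_mem f this

lemma IsAdicComplete.of_surjective_ringHom {A B : Type*} [CommRing A] [CommRing B] [IsLocalRing A]
    [IsNoetherianRing A] [IsLocalRing B] [IsAdicComplete (maximalIdeal A) A]
    (f : A →+* B) (hf : Function.Surjective f) : IsAdicComplete (maximalIdeal B) B := by
  have : IsLocalHom f := hf.isLocalHom
  have : IsNoetherianRing B := isNoetherianRing_of_surjective A B f hf
  have h : IsPrecomplete (maximalIdeal B) B := by
    rw [← map_maximalIdeal_of_surjective f hf]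
    exact IsPrecomplete.of_surjective_ringHom f hf
  exact { toIsPrecomplete := h, toIsHausdorff := inferInstance }

end Completeness

/-! ### Quotients of regular local rings by regular sequences. -/

section CompleteIntersection

/-- `B` is the quotient of a regular local ring by a regular sequence. -/
def IsRegularQuotient (B : Type u) [CommRing B] : Prop :=
  ∃ (Q : Type u) (_ : CommRing Q) (_ : IsRegularLocalRing Q) (rs : List Q),
    RingTheory.Sequence.IsRegular Q rs ∧ Nonempty (B ≃+* (Q ⧸ Ideal.ofList rs))

/-- A complete ring is its own completion, so a presentation of `B` itself is enough. -/
lemma IsRegularQuotient.isCompleteIntersectionLocalRing {B : Type u} [CommRing B] [IsLocalRing B]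
    [IsNoetherianRing B] [IsAdicComplete (maximalIdeal B) B] (h : IsRegularQuotient B) :
    IsCompleteIntersectionLocalRing B := by
  obtain ⟨Q, _, _, rs, hrs, ⟨e⟩⟩ := h
  exact ⟨inferInstance, inferInstance, Q, _, ‹_›, rs, hrs,
    ⟨(AdicCompletion.ofAlgEquiv (maximalIdeal B)).symm.toRingEquiv.trans e⟩⟩

lemma IsRegularQuotient.of_isRegularLocalRing (B : Type u) [CommRing B] [IsRegularLocalRing B] :
    IsRegularQuotient B :=
  ⟨B, _, ‹_›, [], RingTheory.Sequence.IsRegular.nil _ _, ⟨by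
    rw [Ideal.ofList_nil]
    exact (RingEquiv.quotientBot B).symm⟩⟩

lemma IsRegularQuotient.of_ringEquiv {B C : Type u} [CommRing B] [CommRing C] (e : B ≃+* C)
    (h : IsRegularQuotient B) : IsRegularQuotient C := by
  obtain ⟨Q, _, _, rs, hrs, ⟨e'⟩⟩ := h
  exact ⟨Q, _, ‹_›, rs, hrs, ⟨e.symm.trans e'⟩⟩

/-- A lift of `z` to the regular ring is appended to the regular sequence. Being a nonunit keeps the
quotient nonzero. -/
lemma IsRegularQuotient.quotient {B : Type u} [CommRing B] (h : IsRegularQuotient B) {z : B}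
    (hz : IsSMulRegular B z) (hz' : ¬ IsUnit z) : IsRegularQuotient (B ⧸ Ideal.span {z}) := by
  obtain ⟨Q, _, _, rs, hrs, ⟨e⟩⟩ := h
  obtain ⟨q, hq⟩ := Ideal.Quotient.mk_surjective (e z)
  have hspan : (Ideal.span {q}).map (Ideal.Quotient.mk (Ideal.ofList rs)) =
      (Ideal.span {z}).map (e : B →+* Q ⧸ Ideal.ofList rs) := by
    rw [Ideal.map_span, Ideal.map_span, Set.image_singleton, Set.image_singleton, hq]
    rfl
  refine ⟨Q, _, ‹_›, rs ++ [q], ⟨?_, ?_⟩, ⟨?_⟩⟩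
  · rw [RingTheory.Sequence.isWeaklyRegular_append_iff]
    refine ⟨hrs.1, ?_⟩
    rw [RingTheory.Sequence.isWeaklyRegular_singleton_iff, smul_eq_mul, Ideal.mul_top]
    intro x y hxy
    apply e.symm.injective
    apply hz
    have key : ∀ x : Q ⧸ Ideal.ofList rs, z * e.symm x = e.symm (q • x) := fun x => by
      rw [Algebra.smul_def, map_mul]
      congr 1
      rw [eq_comm, e.symm_apply_eq, ← hq]
      rfl
    simp only [smul_eq_mul, key]
    exact congrArg _ hxy
  · rw [smul_eq_mul, Ideal.mul_top, Ideal.ofList_append, Ideal.ofList_singleton]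
    intro htop
    apply hz'
    have h1 := congrArg (Ideal.map (Ideal.Quotient.mk (Ideal.ofList rs))) htop
    rw [Ideal.map_top, Ideal.map_sup, Ideal.map_quotient_self, bot_sup_eq, hspan] at h1
    rw [← Ideal.span_singleton_eq_top]
    have h2 := congrArg (Ideal.comap (e : B →+* Q ⧸ Ideal.ofList rs)) h1
    rw [Ideal.comap_top, Ideal.comap_map_of_bijective (e : B →+* Q ⧸ Ideal.ofList rs)
      e.bijective] at h2
    exact h2.symm
  · refine (Ideal.quotientEquiv (Ideal.span {z}) _ e rfl).trans ?_
    refine (Ideal.quotEquivOfEq hspan.symm).trans ?_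
    refine (DoubleQuot.quotQuotEquivQuotSup (Ideal.ofList rs) (Ideal.span {q})).trans ?_
    exact Ideal.quotEquivOfEq (by rw [Ideal.ofList_append, Ideal.ofList_singleton])

end CompleteIntersection

/-! ### Dividing out kernel elements outside the square of the maximal ideal. -/

section

/-- The data of a factorization `R → T → S` with `R → T` flat and `T → S` surjective that
improves when an element of the kernel is divided out. -/
structure IsAdmissibleFactorization (R : Type u) [CommRing R] [IsLocalRing R]
    (S T : Type v) [CommRing S] [CommRing T] [IsLocalRing T] [Algebra R T]
    [Algebra T S] (e n : ℕ) : Prop where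
  isNoetherianRing : IsNoetherianRing T
  surjective : Function.Surjective (algebraMap T S)
  flat : Module.Flat R T
  isLocalHom : IsLocalHom (algebraMap R T)
  isAdicComplete : IsAdicComplete (maximalIdeal T) T
  isRegularQuotient : IsRegularQuotient (T ⧸ (maximalIdeal R).map (algebraMap R T))
  exists_isRegular : ∃ rs : List T, rs.length = n ∧ (∀ r ∈ rs, r ∈ RingHom.ker (algebraMap T S)) ∧
    RingTheory.Sequence.IsRegular (T ⧸ (maximalIdeal R).map (algebraMap R T)) rs
  pdlt : PDLT T S (n + 1)
  edim_eq : edim T = e + n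

variable {R : Type u} [CommRing R] [IsLocalRing R] {S : Type v} [CommRing S] [IsLocalRing S]

lemma exists_mem_notMem_sq_isSMulRegular {T : Type*} [CommRing T] [IsLocalRing T]
    [IsNoetherianRing T] {M : Type*} [AddCommGroup M] [Module T M] [Module.Finite T M] {J : Ideal T}
    (hJ : ¬ J ≤ maximalIdeal T ^ 2) {x : T} (hx : x ∈ J) (hreg : IsSMulRegular M x) :
    ∃ z ∈ J, z ∉ maximalIdeal T ^ 2 ∧ IsSMulRegular M z := by
  by_contra! h
  have hfin : (associatedPrimes T M).Finite := associatedPrimes.finite T M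
  -- Prime avoidance tolerates two non-prime members. Here only `𝔪²` is exempted from primality, so
  -- it fills both exceptional slots; the others are associated primes of `M`, whose union is the
  -- set of non-regular elements.
  have key := (Ideal.subset_union_prime_finite (hfin.insert (maximalIdeal T ^ 2)) (f := id)
    (maximalIdeal T ^ 2) (maximalIdeal T ^ 2) (fun p hp hp1 _ =>
      (hp.resolve_left hp1).isPrime) (I := J)).1 (fun z hz => by
        by_cases hz2 : z ∈ maximalIdeal T ^ 2
        · exact Set.mem_biUnion (Set.mem_insert _ _) hz2
        · have h1 : z ∈ ⋃ p ∈ associatedPrimes T M, (p : Set T) := by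
            rw [biUnion_associatedPrimes_eq_compl_regular]
            exact h z hz hz2
          simp only [Set.mem_iUnion] at h1 ⊢
          obtain ⟨p, hp, hzp⟩ := h1
          exact ⟨p, Set.mem_insert_of_mem _ hp, hzp⟩)
  obtain ⟨p, hp, hJp⟩ := key
  rcases hp with rfl | hp
  · exact hJ hJp
  · have h1 : x ∈ ⋃ p ∈ associatedPrimes T M, (p : Set T) := Set.mem_biUnion hp (hJp hx)
    rw [biUnion_associatedPrimes_eq_compl_regular] at h1
    exact h1 hreg

/-- As long as the kernel leaves `𝔫²`, divide by a fibre-regular `z` in it outside `𝔫²`. The bound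
on the projective dimension, the regular sequence and the embedding dimension fall together by one,
so the same `n` governs all three. -/
theorem IsAdmissibleFactorization.exists_ker_le_sq [Algebra R S] {e : ℕ} (n : ℕ) :
    ∀ (T : Type v) [CommRing T] [IsLocalRing T] [Algebra R T] [Algebra T S] [IsScalarTower R T S],
    IsAdmissibleFactorization R S T e n →
    ∃ (m : ℕ) (T' : Type v) (_ : CommRing T') (_ : IsLocalRing T') (_ : Algebra R T')
      (_ : Algebra T' S) (_ : IsScalarTower R T' S), IsAdmissibleFactorization R S T' e m ∧
        RingHom.ker (algebraMap T' S) ≤ maximalIdeal T' ^ 2 := by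
  induction n with
  | zero =>
    intro T _ _ _ _ _ h
    refine ⟨0, T, _, ‹_›, _, _, ‹_›, h, ?_⟩
    have hpd := h.pdlt
    have := h.isNoetherianRing
    -- For `n = 0` the nonzero module `S` is projective, hence free, over `T`. It is then faithful
    -- and the kernel is zero.
    rw [zero_add, pdlt_one_iff] at hpd
    have : Module.Finite T S := Module.Finite.of_surjective (Algebra.linearMap T S) h.surjective
    have : Module.Free T S := Module.free_of_flat_of_isLocalRing
    have : FaithfulSMul T S := inferInstance
    have hinj : Function.Injective (algebraMap T S) := FaithfulSMul.algebraMap_injective T S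
    rw [(RingHom.injective_iff_ker_eq_bot _).1 hinj]
    exact bot_le
  | succ n ih =>
    intro T _ _ _ _ _ h
    by_cases hJ : RingHom.ker (algebraMap T S) ≤ maximalIdeal T ^ 2
    · exact ⟨n + 1, T, _, ‹_›, _, _, ‹_›, h, hJ⟩
    have := h.isNoetherianRing
    have := h.flat
    have := h.isLocalHom
    have := h.isAdicComplete
    set J := RingHom.ker (algebraMap T S) with hJdef
    have hJtop : J ≠ ⊤ := RingHom.ker_ne_top _
    let P := T ⧸ (maximalIdeal R).map (algebraMap R T)
    obtain ⟨rs, hlen, hmem, hreg⟩ := h.exists_isRegular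
    match rs with
    | [] => simp at hlen
    | x :: rs =>
      obtain ⟨z, hzJ, hz2, hzreg⟩ := exists_mem_notMem_sq_isSMulRegular hJ
        (hmem x List.mem_cons_self) (RingTheory.Sequence.isWeaklyRegular_cons_iff _ _ _ |>.1 hreg.1).1
      have hz : z ∈ maximalIdeal T := le_maximalIdeal hJtop hzJ
      have hJP : J • (⊤ : Submodule T P) < ⊤ := by
        have hP : IsLocalRing P := isLocalRing_quotient (IsLocalRing.map_maximalIdeal_le _)
        rw [lt_top_iff_ne_top, Ne, eq_comm]
        refine Submodule.top_ne_ideal_smul_of_le_jacobson_annihilator ?_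
        exact (le_maximalIdeal hJtop).trans (IsLocalRing.maximalIdeal_le_jacobson _)
      -- `z` need not belong to the given sequence; the exchange property still yields `n` further
      -- elements of `J` regular on `P/zP`.
      obtain ⟨ss, hslen, hsmem, hsreg⟩ := exists_isRegular_quotSMulTop J n P hJP
        ⟨x :: rs, hlen, hmem, hreg⟩ hzJ hzreg
      obtain ⟨hzT, hflat⟩ := isSMulRegular_and_flat_quotient z hzreg
      have hzle := (Ideal.span_singleton_le_iff_mem _).2 hz
      have := isLocalRing_quotient hzle
      have : IsLocalHom (algebraMap R (T ⧸ Ideal.span {z})) := isLocalHom_algebraMap_quotient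
      let T' := T ⧸ Ideal.span {z}
      let φ : T' →+* S := Ideal.Quotient.lift (Ideal.span {z}) (algebraMap T S) (fun a ha =>
        (Ideal.span_singleton_le_iff_mem J).2 hzJ ha)
      let algT'S : Algebra T' S := φ.toAlgebra
      have tower1 : IsScalarTower T T' S := IsScalarTower.of_algebraMap_eq fun t => rfl
      have tower2 : IsScalarTower R T' S := IsScalarTower.of_algebraMap_eq fun r => by
        rw [IsScalarTower.algebraMap_apply R T S]; rfl
      have hsurj : Function.Surjective (algebraMap T' S) := fun s => by
        obtain ⟨t, rfl⟩ := h.surjective s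
        exact ⟨Ideal.Quotient.mk _ t, rfl⟩
      have : Module.Finite T S := Module.Finite.of_surjective (Algebra.linearMap T S) h.surjective
      refine ih T' ⟨inferInstance, hsurj, hflat, ‹_›,
        IsAdicComplete.of_surjective_ringHom (Ideal.Quotient.mk (Ideal.span {z}))
          Ideal.Quotient.mk_surjective, ?_, ?_, ?_, ?_⟩
      · have h1 : IsSMulRegular P (algebraMap T P z) := fun a b hab => hzreg (by
          change z • a = z • b
          rw [← algebraMap_smul P z a, ← algebraMap_smul P z b]
          exact hab)
        have hP : IsLocalRing P := isLocalRing_quotient (IsLocalRing.map_maximalIdeal_le _)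
        have h2 : ¬ IsUnit (algebraMap T P z) := fun hu => by
          have : IsLocalHom (algebraMap T P) :=
            IsLocalHom.of_surjective _ Ideal.Quotient.mk_surjective
          exact hz (isUnit_of_map_unit _ _ hu)
        refine (h.isRegularQuotient.quotient h1 h2).of_ringEquiv ?_
        have e1 : Ideal.span {algebraMap T P z} = (Ideal.span {z}).map (algebraMap T P) := by
          rw [Ideal.map_span, Set.image_singleton]
        refine (Ideal.quotEquivOfEq e1).trans ((DoubleQuot.quotQuotEquivComm _ _).trans ?_)
        exact Ideal.quotEquivOfEq (map_maximalIdeal_quotient (Ideal.span {z})).symm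
      · refine ⟨ss.map (algebraMap T T'), by simpa using hslen, ?_, ?_⟩
        · intro r hr
          obtain ⟨s, hs, rfl⟩ := List.mem_map.1 hr
          exact hsmem s hs
        · rw [map_maximalIdeal_quotient]
          refine ((quotSMulTopQuotientEquiv _ z).toAddEquiv.isRegular_congr
            (bs := ss.map (algebraMap T T')) ?_).1 hsreg
          refine List.forall₂_map_right_iff.2 (List.forall₂_same.2 fun r _ x => ?_)
          exact (map_smul (quotSMulTopQuotientEquiv _ z) r x).trans
            (algebraMap_smul (T ⧸ Ideal.span {z}) r _).symm
      · exact PDLT.quotient_of_notMem_sq hzT hz hz2 (n + 1) S h.pdlt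
      · have h1 := edim_quotient_span_singleton_add_one hz hz2
        have h2 := h.edim_eq
        have h3 : edim (T ⧸ Ideal.span {z}) + 1 = e + n + 1 := h1.trans h2
        exact Nat.succ_injective h3

end

/-! ### Grade, perfection and the factorization obtained from a regular closed fibre. -/

section

open RingTheory.Sequence

/-- An ideal of a local ring whose maximal ideal is nilpotent modulo it contains a regular sequence
as long as any regular sequence of the ring. -/
lemma exists_isRegular_of_forall_pow_mem {P : Type v} [CommRing P] [IsLocalRing P]
    [IsNoetherianRing P] {I : Ideal P} (hI : I ≠ ⊤) (hpow : ∀ x ∈ maximalIdeal P, ∃ k, x ^ k ∈ I)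
    (ys : List P) (hys : ∀ y ∈ ys, y ∈ maximalIdeal P) (hreg : IsWeaklyRegular P ys) :
    ∃ rs : List P, rs.length = ys.length ∧ (∀ r ∈ rs, r ∈ I) ∧ IsRegular P rs := by
  have hlt : ∀ J : Ideal P, J ≠ ⊤ → J • (⊤ : Submodule P P) < ⊤ := fun J hJ => by
    rw [smul_eq_mul, Ideal.mul_top]
    exact lt_top_iff_ne_top.2 hJ
  have hreg' : IsRegular P ys :=
    (isRegular_iff_isWeaklyRegular_of_subset_maximalIdeal hys).2 hreg
  -- The Ext criterion for `𝔪` applies to every nonzero finite module supported in `V(𝔪)`, in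
  -- particular to `P/I`. As the support of `P/I` is `V(I)`, the same vanishing is the criterion for
  -- `I`.
  have h1 := (ModuleCat.exists_isRegular_tfae (maximalIdeal P) ys.length (ModuleCat.of P P)
    (hlt _ (Ideal.IsPrime.ne_top inferInstance))).out 3 0 rfl rfl |>.1 ⟨ys, rfl, hys, hreg'⟩
  have : Nontrivial (P ⧸ I) := Ideal.Quotient.nontrivial_iff.2 hI
  have hsupp : Module.support P (P ⧸ I) = PrimeSpectrum.zeroLocus (I : Set P) := by
    rw [Module.support_eq_zeroLocus, Ideal.annihilator_quotient]
  refine (ModuleCat.exists_isRegular_tfae I ys.length (ModuleCat.of P P) (hlt _ hI)).out 2 3 rfl rfl |>.1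
    ⟨ModuleCat.of P (P ⧸ I), ‹_›, inferInstanceAs (Module.Finite P (P ⧸ I)), hsupp, ?_⟩
  refine h1 (ModuleCat.of P (P ⧸ I)) ‹_› (inferInstanceAs (Module.Finite P (P ⧸ I))) ?_
  intro p hp
  rw [hsupp, PrimeSpectrum.mem_zeroLocus] at hp
  rw [PrimeSpectrum.mem_zeroLocus]
  intro x hx
  obtain ⟨k, hk⟩ := hpow x hx
  exact p.2.mem_of_pow_mem k (hp hk)

/-- Every regular sequence in `J` is at most as long as `pd (T/J)`, so `rs.length ≤ depth ≤ pd ≤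
rs.length`. -/
lemma projectiveDimension_eq_and_depthAlong_eq {T : Type v} [CommRing T] [IsLocalRing T]
    [IsNoetherianRing T] {J : Ideal T} (hJ : J ≠ ⊤) (rs : List T) (hrs : ∀ r ∈ rs, r ∈ J)
    (hreg : IsRegular T rs) (hpd : PDLT T (T ⧸ J) (rs.length + 1)) :
    projectiveDimension (ModuleCat.of T (T ⧸ J)) = (rs.length : ℕ) ∧
      depthAlong J = (rs.length : ℕ) := by
  refine ⟨le_antisymm ((projectiveDimension_le_iff _ _).2 hpd)
    ((projectiveDimension_ge_iff _ _).2 (not_pdlt_of_isRegular hJ rs hreg hrs)), le_antisymm ?_ ?_⟩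
  · refine iSup_le fun ss => iSup_le fun hss => iSup_le fun hmem => ?_
    by_contra! h
    have h1 : rs.length < ss.length := by exact_mod_cast h
    exact not_pdlt_of_isRegular hJ ss hss hmem (hpd.mono h1)
  · exact le_iSup_of_le rs (le_iSup_of_le hreg (le_iSup_of_le hrs le_rfl))

end

/-- A factorization of a flat local homomorphism through a flat algebra with regular closed fibre
can be improved to one with complete intersection closed fibre and kernel inside the square of the
maximal ideal. -/
theorem exists_completeIntersection_factorization
    (R : Type u) [CommRing R] [IsLocalRing R] [IsNoetherianRing R]
    (S : Type v) [CommRing S] [IsLocalRing S] [IsNoetherianRing S]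
    [Algebra R S] [Module.Flat R S] [IsLocalHom (algebraMap R S)]
    (hdim : ringKrullDim R = ringKrullDim S)
    (T : Type v) [CommRing T] [IsLocalRing T] [IsNoetherianRing T]
    [IsAdicComplete (maximalIdeal T) T] [Algebra R T] [Module.Flat R T]
    [IsLocalHom (algebraMap R T)] [Algebra T S] [IsScalarTower R T S]
    (hsurj : Function.Surjective (algebraMap T S)) (ys : List T)
    (hmax : maximalIdeal T = (maximalIdeal R).map (algebraMap R T) ⊔ Ideal.ofList ys)
    (hreg : RingTheory.Sequence.IsWeaklyRegular (T ⧸ (maximalIdeal R).map (algebraMap R T)) ys)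
    (c : ℤ) (hc : (edim S : ℤ) - (edim R : ℤ) = c) :
    ∃ (T : Type v) (_ : CommRing T) (_ : IsLocalRing T) (_ : IsNoetherianRing T)
      (_ : Algebra R T) (_ : Algebra T S) (_ : IsScalarTower R T S) (J : Ideal T),
      Function.Surjective (algebraMap T S) ∧
      J = RingHom.ker (algebraMap T S) ∧
      Module.Flat R T ∧
      IsLocalHom (algebraMap R T) ∧
      IsAdicComplete (maximalIdeal T) T ∧
      IsCompleteIntersectionLocalRing (T ⧸ (maximalIdeal R).map (algebraMap R T)) ∧
      IsPerfectIdeal J ∧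
      (∃ n : ℕ, (n : ℤ) = c ∧ projectiveDimension (ModuleCat.of T S) = (n : WithBot ℕ∞)) ∧
      J ≤ maximalIdeal T ^ 2 := by
  have hfin : Module.Finite T S := Module.Finite.of_surjective (Algebra.linearMap T S) hsurj
  let P := T ⧸ (maximalIdeal R).map (algebraMap R T)
  have hP : IsLocalRing P := isLocalRing_quotient (IsLocalRing.map_maximalIdeal_le _)
  have hmaxP := maximalIdeal_quotient_eq_ofList _ hmax
  have hregP : RingTheory.Sequence.IsWeaklyRegular P (ys.map (algebraMap T P)) :=
    (RingTheory.Sequence.isWeaklyRegular_map_algebraMap_iff P P ys).2 hreg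
  have hPreg : IsRegularLocalRing P := isRegularLocalRing_of_isWeaklyRegular hmaxP hregP
  have hmapT : (maximalIdeal T).map (algebraMap T P) = maximalIdeal P :=
    map_maximalIdeal_of_surjective _ Ideal.Quotient.mk_surjective
  have key : IsAdmissibleFactorization R S T (edim R) ys.length := by
    refine ⟨‹_›, hsurj, ‹_›, ‹_›, ‹_›, IsRegularQuotient.of_isRegularLocalRing P, ?_,
      pdlt_of_flat_of_closedFibre ys.length ys rfl hmax hreg S,
      edim_eq_edim_add_length ys.length ys rfl hmax hreg⟩
    have hJtop : RingHom.ker (algebraMap T S) ≠ ⊤ := RingHom.ker_ne_top _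
    have hlocS : IsLocalRing (S ⧸ (maximalIdeal R).map (algebraMap R S)) :=
      isLocalRing_quotient (IsLocalRing.map_maximalIdeal_le _)
    have hdim0 := ringKrullDim_closedFibre_eq_zero hdim
    have hKD : Ring.KrullDimLE 0 (S ⧸ (maximalIdeal R).map (algebraMap R S)) :=
      (Ring.krullDimLE_iff).2 hdim0.le
    have hTP : Function.Surjective (algebraMap T P) := Ideal.Quotient.mk_surjective
    have hlocTP : IsLocalHom (algebraMap T P) := IsLocalHom.of_surjective _ hTP
    -- `P/JP` is the Artinian ring `S/𝔪S`, so every element of the maximal ideal of `P` has a power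
    -- in `JP`. Elements of `JP` lift to `J` because `T → P` is onto.
    obtain ⟨rs, hlen, hmem, hrs⟩ := exists_isRegular_of_forall_pow_mem
      (I := (RingHom.ker (algebraMap T S)).map (algebraMap T P)) (by
        intro h
        have h1 := (Ideal.map_mono (f := algebraMap T P) (le_maximalIdeal hJtop))
        rw [h, hmapT, top_le_iff] at h1
        exact Ideal.IsPrime.ne_top inferInstance h1) (by
        intro x hx
        obtain ⟨t, rfl⟩ := hTP x
        have ht : t ∈ maximalIdeal T := (map_mem_nonunits_iff (algebraMap T P) t).1 hx
        have : IsLocalHom (algebraMap T S) := IsLocalHom.of_surjective _ hsurj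
        have h1 : algebraMap T S t ∈ maximalIdeal S :=
          (map_mem_nonunits_iff (algebraMap T S) t).2 ht
        have h2 : Ideal.Quotient.mk ((maximalIdeal R).map (algebraMap R S)) (algebraMap T S t) ∈
            maximalIdeal _ := by
          rw [← map_maximalIdeal_of_surjective _ Ideal.Quotient.mk_surjective]
          exact Ideal.mem_map_of_mem _ h1
        obtain ⟨k, hk⟩ := Ring.KrullDimLE.isNilpotent_iff_mem_maximalIdeal.2 h2
        refine ⟨k, ?_⟩
        rw [← map_pow, ← map_pow, Ideal.Quotient.eq_zero_iff_mem,
          IsScalarTower.algebraMap_eq R T S, ← Ideal.map_map] at hk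
        obtain ⟨s, hs, hst⟩ := (Ideal.mem_map_iff_of_surjective _ hsurj).1 hk
        have h3 : algebraMap T P s = 0 := Ideal.Quotient.eq_zero_iff_mem.2 hs
        rw [← map_pow, ← sub_zero (algebraMap T P (t ^ k)), ← h3, ← map_sub]
        refine Ideal.mem_map_of_mem _ ?_
        rw [RingHom.mem_ker, map_sub, hst, sub_self])
      (ys.map (algebraMap T P)) (fun y hy => by
        rw [hmaxP]
        exact Ideal.subset_span hy) hregP
    have hlift : ∀ r ∈ rs, ∃ t ∈ RingHom.ker (algebraMap T S), algebraMap T P t = r :=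
      fun r hr => (Ideal.mem_map_iff_of_surjective _ hTP).1 (hmem r hr)
    choose! g hg1 hg2 using hlift
    have hmap : (rs.map g).map (algebraMap T P) = rs := by
      rw [List.map_map]
      conv_rhs => rw [← List.map_id rs]
      exact List.map_congr_left hg2
    refine ⟨rs.map g, by simpa using hlen, fun t ht => ?_, ?_⟩
    · obtain ⟨r, hr, rfl⟩ := List.mem_map.1 ht
      exact hg1 r hr
    · refine ((AddEquiv.refl P).isRegular_congr (bs := rs) ?_).2 hrs
      conv => arg 3; rw [← hmap]
      exact List.forall₂_map_right_iff.2 (List.forall₂_same.2 fun r _ x =>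
        (algebraMap_smul P r x).symm)
  obtain ⟨n, T', _, _, _, _, _, h, hle⟩ := key.exists_ker_le_sq
  have h1 := h.isNoetherianRing
  have h2 := h.flat
  have h3 := h.isLocalHom
  have h4 := h.isAdicComplete
  have h5 : IsLocalRing (T' ⧸ (maximalIdeal R).map (algebraMap R T')) :=
    isLocalRing_quotient (IsLocalRing.map_maximalIdeal_le _)
  have h6 : IsAdicComplete (maximalIdeal (T' ⧸ (maximalIdeal R).map (algebraMap R T')))
      (T' ⧸ (maximalIdeal R).map (algebraMap R T')) :=
    IsAdicComplete.of_surjective_ringHom (Ideal.Quotient.mk _) Ideal.Quotient.mk_surjective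
  have hJtop : RingHom.ker (algebraMap T' S) ≠ ⊤ := RingHom.ker_ne_top _
  obtain ⟨rs, hlen, hmem, hrs⟩ := h.exists_isRegular
  have hmem' : ∀ r ∈ rs, r ∈ maximalIdeal T' := fun r hr => le_maximalIdeal hJtop (hmem r hr)
  have hrsT : RingTheory.Sequence.IsRegular T' rs :=
    (isRegular_iff_isWeaklyRegular_of_subset_maximalIdeal hmem').2
      (isWeaklyRegular_of_closedFibre n rs hlen hmem' hrs.1)
  let e : (T' ⧸ RingHom.ker (algebraMap T' S)) ≃ₗ[T'] S :=
    (Ideal.quotientKerAlgEquivOfSurjective (f := Algebra.ofId T' S) h.surjective).toLinearEquiv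
  obtain ⟨hpd, hdepth⟩ := projectiveDimension_eq_and_depthAlong_eq hJtop rs hmem hrsT
    (by rw [hlen]; exact h.pdlt.of_equiv e.symm)
  refine ⟨T', _, ‹_›, h1, _, _, ‹_›, _, h.surjective, rfl, h2, h3, h4,
    h.isRegularQuotient.isCompleteIntersectionLocalRing, ⟨hJtop, ?_⟩, ⟨n, ?_, ?_⟩, hle⟩
  · rw [hpd, hdepth]; rfl
  -- The kernel lies in `𝔫²`, so `edim S = edim T' = edim R + n`, which identifies `n` with `c`.
  · have h7 := edim_eq_of_ker_le_sq (algebraMap T' S) h.surjective hle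
    have h8 := h.edim_eq
    rw [← hc, ← h7, h8]
    push_cast
    ring
  · rw [← hlen, ← hpd]
    exact (projectiveDimension_eq_of_iso e.toModuleIso).symm

/-! ### Maps out of completions, and Noetherian complete rings. -/

section AdicCompletion

variable {E : Type*} [CommRing E] (I : Ideal E) {A : Type*} [CommRing A] (J : Ideal A)
  [IsAdicComplete J A] (g : E →+* A)

/-- The extension of a ring homomorphism into a complete ring to the completion of its source. -/
lemma AdicCompletion.exists_ringHom_comp_algebraMap_eq (h : I.map g ≤ J) :
    ∃ f : AdicCompletion I E →+* A, f.comp (algebraMap E (AdicCompletion I E)) = g := by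
  have hn : ∀ n, I ^ n ≤ (J ^ n).comap g := fun n => by
    rw [← Ideal.map_le_iff_le_comap, Ideal.map_pow]
    exact Ideal.pow_right_mono h n
  let f : (n : ℕ) → AdicCompletion I E →+* A ⧸ J ^ n := fun n =>
    (Ideal.quotientMap (J ^ n) g (hn n)).comp (AdicCompletion.evalₐ I n).toRingHom
  have hf : ∀ {m n : ℕ} (hle : m ≤ n), (Ideal.Quotient.factorPow J hle).comp (f n) = f m := by
    intro m n hle
    ext x
    obtain ⟨y, rfl⟩ := AdicCompletion.mk_surjective I E x
    change Ideal.Quotient.factorPow J hle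
      (Ideal.quotientMap (J ^ n) g (hn n) (AdicCompletion.evalₐ I n (AdicCompletion.mk I E y))) =
      Ideal.quotientMap (J ^ m) g (hn m) (AdicCompletion.evalₐ I m (AdicCompletion.mk I E y))
    rw [AdicCompletion.evalₐ_mk, AdicCompletion.evalₐ_mk, ← AdicCompletion.Ideal.mk_eq_mk I hle]
    rfl
  refine ⟨IsAdicComplete.liftRingHom J f hf, ?_⟩
  ext x
  have hJ : IsHausdorff J A := inferInstance
  refine sub_eq_zero.1 (hJ.haus _ fun n => ?_)
  rw [smodEq_pow_smul_top_iff, sub_zero, ← Ideal.Quotient.eq_zero_iff_mem, map_sub, sub_eq_zero,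
    RingHom.comp_apply, IsAdicComplete.mk_liftRingHom]
  change Ideal.quotientMap (J ^ n) g (hn n) (AdicCompletion.evalₐ I n (AdicCompletion.of I E x)) = _
  rw [AdicCompletion.evalₐ_of]
  rfl

end AdicCompletion

section

variable {A : Type*} [CommRing A]

lemma surjective_of_comp_algebraMap_adicCompletion {E : Type*} [CommRing E] {I : Ideal E}
    (hI : I.FG) {J : Ideal A} [IsHausdorff J A] (f : AdicCompletion I E →+* A)
    (hIJ : I.map (f.comp (algebraMap E (AdicCompletion I E))) = J)
    (hsurj : Function.Surjective
      ((Ideal.Quotient.mk J).comp (f.comp (algebraMap E (AdicCompletion I E))))) :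
    Function.Surjective f := by
  have := AdicCompletion.isAdicComplete_self I hI
  rw [← Ideal.map_map] at hIJ
  subst hIJ
  refine surjective_of_mk_map_comp_surjective
    (I := I.map (algebraMap E (AdicCompletion I E))) f ?_
  intro x
  obtain ⟨y, hy⟩ := hsurj x
  exact ⟨_, hy⟩

/-- A complete ring is Noetherian if it is an algebra over a Noetherian ring that maps onto its
quotient by a finitely generated ideal of definition. -/
theorem isNoetherianRing_of_isAdicComplete {B : Type*} [CommRing B] [IsNoetherianRing B]
    (J : Ideal A) (hJ : J.FG) [IsAdicComplete J A] (g : B →+* A)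
    (hg : Function.Surjective ((Ideal.Quotient.mk J).comp g)) : IsNoetherianRing A := by
  obtain ⟨s, hs⟩ := hJ
  let σ := {x // x ∈ s}
  -- The variables go to generators of `J`. Completing at the ideal of the variables gives a power
  -- series ring over `B`, which is Noetherian and maps onto `A`.
  let ev : MvPolynomial σ B →+* A := MvPolynomial.eval₂Hom g (fun x : σ => (x : A))
  let I : Ideal (MvPolynomial σ B) := Ideal.span (Set.range MvPolynomial.X)
  have hI : I.FG := Submodule.fg_span (Set.finite_range _)
  have hmap : I.map ev = J := by
    rw [Ideal.map_span, ← hs, ← Set.range_comp]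
    congr 1
    ext x
    simp [ev, σ]
  obtain ⟨f, hf⟩ := AdicCompletion.exists_ringHom_comp_algebraMap_eq I J ev hmap.le
  have hsurj : Function.Surjective f := by
    refine surjective_of_comp_algebraMap_adicCompletion (J := J) hI f (by rw [hf, hmap]) ?_
    intro x
    obtain ⟨b, hb⟩ := hg x
    refine ⟨MvPolynomial.C b, ?_⟩
    rw [hf, ← hb]
    simp [ev]
  have h1 : IsNoetherianRing (MvPowerSeries σ B) := inferInstance
  have h2 : IsNoetherianRing (AdicCompletion I (MvPolynomial σ B)) :=
    isNoetherianRing_of_ringEquiv _ (MvPowerSeries.toAdicCompletionAlgEquiv σ B).toRingEquiv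
  exact isNoetherianRing_of_surjective _ _ f hsurj

lemma surjective_mk_comp_algebraMap_adicCompletion {I : Ideal A} (hI : I.FG) :
    Function.Surjective ((Ideal.Quotient.mk (I.map (algebraMap A (AdicCompletion I A)))).comp
      (algebraMap A (AdicCompletion I A))) := by
  intro x
  obtain ⟨x, rfl⟩ := Ideal.Quotient.mk_surjective x
  obtain ⟨a, ha⟩ := Ideal.Quotient.mk_surjective (AdicCompletion.evalOneₐ I x)
  refine ⟨a, ?_⟩
  rw [RingHom.comp_apply, Ideal.Quotient.eq, ← AdicCompletion.ker_evalOneₐ_eq_map I hI,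
    RingHom.mem_ker, map_sub, sub_eq_zero]
  exact ha

lemma isNoetherianRing_adicCompletion [IsNoetherianRing A] (I : Ideal A) :
    IsNoetherianRing (AdicCompletion I A) := by
  have hI : I.FG := IsNoetherian.noetherian I
  have := AdicCompletion.isAdicComplete_self I hI
  refine isNoetherianRing_of_isAdicComplete (I.map (algebraMap A (AdicCompletion I A)))
    (hI.map _) (algebraMap A (AdicCompletion I A))
    (surjective_mk_comp_algebraMap_adicCompletion hI)

/-- Completeness for the maximal ideal may be checked modulo an ideal for which the ring is
complete. -/
theorem isAdicComplete_maximalIdeal_of_quotient [IsLocalRing A] [IsNoetherianRing A]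
    (I : Ideal A) [IsAdicComplete I A] [IsLocalRing (A ⧸ I)]
    [IsAdicComplete (maximalIdeal (A ⧸ I)) (A ⧸ I)] : IsAdicComplete (maximalIdeal A) A := by
  -- The plan is to show that `A → C`, with `C` the `𝔪`-adic completion, is onto: first modulo `I`,
  -- from completeness of `A/I`, then on `A` itself, from `I`-adic completeness of `A` and `I`-adic
  -- separatedness of `C`.
  have hI : I ≤ maximalIdeal A := le_maximalIdeal (Ideal.Quotient.nontrivial_iff.1 inferInstance)
  let C := AdicCompletion (maximalIdeal A) A
  have hC : IsNoetherianRing C := isNoetherianRing_adicCompletion _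
  have hCmax : maximalIdeal C = (maximalIdeal A).map (algebraMap A C) :=
    AdicCompletion.maximalIdeal_eq_map
  have hmap : I.map (algebraMap A C) ≤ maximalIdeal C := by
    rw [hCmax]
    exact Ideal.map_mono hI
  have hCI : IsLocalRing (C ⧸ I.map (algebraMap A C)) := isLocalRing_quotient hmap
  have hmod : Function.Surjective ((Ideal.Quotient.mk (maximalIdeal C)).comp (algebraMap A C)) := by
    rw [hCmax]
    exact surjective_mk_comp_algebraMap_adicCompletion (IsNoetherian.noetherian _)
  let f : A ⧸ I →+* C ⧸ I.map (algebraMap A C) :=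
    Ideal.quotientMap _ (algebraMap A C) Ideal.le_comap_map
  have hAI : (maximalIdeal (A ⧸ I)) = (maximalIdeal A).map (Ideal.Quotient.mk I) :=
    (map_maximalIdeal_of_surjective _ Ideal.Quotient.mk_surjective).symm
  have hfmax : (maximalIdeal (A ⧸ I)).map f = maximalIdeal _ := by
    have h1 : (maximalIdeal C).map (Ideal.Quotient.mk (I.map (algebraMap A C))) = maximalIdeal _ :=
      map_maximalIdeal_of_surjective _ Ideal.Quotient.mk_surjective
    rw [hAI, ← h1, hCmax, Ideal.map_map, Ideal.map_map]
    rfl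
  have hf : Function.Surjective f := by
    have : IsHausdorff ((maximalIdeal (A ⧸ I)).map f) (C ⧸ I.map (algebraMap A C)) := by
      rw [hfmax]
      infer_instance
    refine surjective_of_mk_map_comp_surjective (I := maximalIdeal (A ⧸ I)) f ?_
    rw [hfmax]
    intro x
    obtain ⟨y, rfl⟩ := Ideal.Quotient.mk_surjective x
    obtain ⟨c, rfl⟩ := Ideal.Quotient.mk_surjective y
    obtain ⟨a, ha⟩ := hmod (Ideal.Quotient.mk _ c)
    refine ⟨Ideal.Quotient.mk I a, ?_⟩
    rw [RingHom.comp_apply, Ideal.Quotient.eq] at ha ⊢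
    have h2 : f (Ideal.Quotient.mk I a) = Ideal.Quotient.mk _ (algebraMap A C a) := rfl
    rw [h2, ← map_sub, ← map_maximalIdeal_of_surjective
      (Ideal.Quotient.mk (I.map (algebraMap A C))) Ideal.Quotient.mk_surjective]
    exact Ideal.mem_map_of_mem _ ha
  have hsurj : Function.Surjective (algebraMap A C) := by
    have : IsHausdorff (I.map (algebraMap A C)) C :=
      IsHausdorff.of_isLocalRing _ _ fun h => by
        rw [h, top_le_iff] at hmap
        exact Ideal.IsPrime.ne_top inferInstance hmap
    refine surjective_of_mk_map_comp_surjective (I := I) (algebraMap A C) ?_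
    intro x
    obtain ⟨y, rfl⟩ := hf x
    obtain ⟨a, rfl⟩ := Ideal.Quotient.mk_surjective y
    exact ⟨a, rfl⟩
  exact { toIsPrecomplete := AdicCompletion.of_surjective_iff.1 hsurj
          toIsHausdorff := inferInstance }

end

/-! ### Splitting square-zero extensions of fields. -/

section CoefficientField

variable {k : Type*} [Field k] {B : Type*} [CommRing B] (φ : B →+* k)

/-- `k` is separable algebraic over a purely transcendental extension of `ℚ`, and `ℚ` is a
localization of `ℤ`. So `k` is formally smooth over `ℤ` and the identity lifts. -/
lemma exists_section_of_charZero [CharZero k] (hφ : Function.Surjective φ)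
    (hker : ∀ x y, φ x = 0 → φ y = 0 → x * y = 0) :
    ∃ σ : k →+* B, φ.comp σ = RingHom.id k := by
  have h1 : Algebra.FormallySmooth ℚ k := by
    obtain ⟨s, hs⟩ := exists_isTranscendenceBasis ℚ k
    have : Algebra.IsAlgebraic (IntermediateField.adjoin ℚ (Set.range ((↑) : s → k))) k :=
      hs.isAlgebraic_field
    exact .of_algebraicIndependent_of_isSeparable hs.1
  have h2 : Algebra.FormallySmooth ℤ ℚ := .of_isLocalization (nonZeroDivisors ℤ)
  have h3 : Algebra.FormallySmooth ℤ k := .comp ℤ ℚ k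
  refine ⟨(Algebra.FormallySmooth.liftOfSurjective (AlgHom.id ℤ k) φ.toIntAlgHom hφ
    ⟨2, ?_⟩).toRingHom, ?_⟩
  · rw [pow_two, Ideal.zero_eq_bot, eq_bot_iff, Ideal.mul_le]
    exact fun x hx y hy => hker x y hx hy
  · ext x
    exact Algebra.FormallySmooth.liftOfSurjective_apply (AlgHom.id ℤ k) φ.toIntAlgHom hφ _ x

/-- Take a subring maximal among those containing all `p`-th powers and meeting the kernel
trivially. The subring of `p`-th powers qualifies, since a kernel element has square zero, and a
maximal one maps isomorphically onto `k`. -/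
lemma exists_section_of_charP (p : ℕ) [hp : Fact p.Prime] (hpB : (p : B) = 0)
    (hφ : Function.Surjective φ) (hker : ∀ x y, φ x = 0 → φ y = 0 → x * y = 0) :
    ∃ σ : k →+* B, φ.comp σ = RingHom.id k := by
  have : Nontrivial B := φ.domain_nontrivial
  have hB : CharP B p := (CharP.charP_iff_prime_eq_zero hp.out).2 hpB
  have hk : CharP k p := (CharP.charP_iff_prime_eq_zero hp.out).2 (by
    rw [← map_natCast φ, hpB, map_zero])
  obtain ⟨C, -, hC⟩ := zorn_le_nonempty₀
    {C : Subring B | (frobenius B p).range ≤ C ∧ ∀ x ∈ C, φ x = 0 → x = 0}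
    (fun c hc hchain y hy => by
      have hne : c.Nonempty := ⟨y, hy⟩
      refine ⟨sSup c, ⟨(hc hy).1.trans (le_sSup hy), fun x hx hx0 => ?_⟩, fun z hz => le_sSup hz⟩
      obtain ⟨s, hs, hxs⟩ := (Subring.mem_sSup_of_directedOn hne hchain.directedOn).1 hx
      exact (hc hs).2 x hxs hx0)
    (frobenius B p).range ⟨le_rfl, by
      rintro _ ⟨x, rfl⟩ hx
      rw [frobenius_def, map_pow] at hx
      have h1 : φ x = 0 := pow_eq_zero_iff hp.out.ne_zero |>.1 hx
      rw [frobenius_def, ← Nat.sub_add_cancel hp.out.two_le, pow_add, pow_two, hker x x h1 h1,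
        mul_zero]⟩
  obtain ⟨⟨hfrob, hinj⟩, hmax⟩ := hC
  have hpow : ∀ x : B, x ^ p ∈ C := fun x => hfrob ⟨x, rfl⟩
  let ρ : C →+* k := φ.comp C.subtype
  have hρ : Function.Injective ρ := (injective_iff_map_eq_zero ρ).2 fun x hx =>
    Subtype.ext (hinj x x.2 hx)
  -- If `b` lifts `c⁻¹`, then `c⁻¹ = c^(p-1) (c⁻¹)^p` is the image of an element of `C`, because `bᵖ
  -- ∈ C`.
  let F : Subfield k := { ρ.range with
    inv_mem' := by
      rintro _ ⟨c, rfl⟩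
      by_cases h0 : ρ c = 0
      · exact ⟨0, by rw [h0, map_zero, inv_zero]⟩
      obtain ⟨b, hb⟩ := hφ (ρ c)⁻¹
      refine ⟨c ^ (p - 1) * ⟨b ^ p, hpow b⟩, ?_⟩
      have h1 : ρ ⟨b ^ p, hpow b⟩ = (ρ c)⁻¹ ^ p := by rw [← hb, ← map_pow]; rfl
      obtain ⟨q, hq⟩ := Nat.exists_eq_succ_of_ne_zero hp.out.ne_zero
      rw [map_mul, map_pow, h1, inv_pow, hq, Nat.succ_sub_one, pow_succ]
      field_simp }
  let ρ' : C ≃+* F := RingEquiv.ofBijective (ρ.rangeRestrict : C →+* ρ.range)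
    ⟨fun x y h => hρ (congrArg Subtype.val h), ρ.rangeRestrict_surjective⟩
  have hρ' : ∀ c, ((ρ' c : F) : k) = φ c := fun c => rfl
  have hall : ∀ b : k, b ∈ F := by
    intro b
    by_contra hb
    obtain ⟨b', rfl⟩ := hφ b
    let c0 : C := ⟨b' ^ p, hpow b'⟩
    let ev := Polynomial.eval₂RingHom C.subtype b'
    have hCle : C ≤ ev.range := fun x hx => ⟨Polynomial.C ⟨x, hx⟩, by simp [ev]⟩
    have hmem : ev.range ∈ {C : Subring B | (frobenius B p).range ≤ C ∧ ∀ x ∈ C, φ x = 0 → x = 0} := by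
      refine ⟨hfrob.trans hCle, ?_⟩
      rintro _ ⟨g, rfl⟩ hg
      have h1 : Polynomial.aeval (φ b') (g.map (ρ' : C →+* F)) = 0 := by
        rw [Polynomial.aeval_def, Polynomial.eval₂_map, ← hg]
        simp only [ev, Polynomial.coe_eval₂RingHom, Polynomial.hom_eval₂]
        rfl
      -- `Xᵖ - φ(b')ᵖ` is the minimal polynomial of `φ b'` over `F`, and its lift vanishes at `b'`.
      -- So any `g(b')` in the kernel is zero, and `C[b']` contradicts maximality.
      have hirr : Irreducible (Polynomial.X ^ p - Polynomial.C (ρ' c0) : Polynomial F) := by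
        refine X_pow_sub_C_irreducible_of_prime hp.out fun c hc => hb ?_
        have h2 : (c : k) ^ p = φ b' ^ p := by
          rw [← map_pow]
          exact congrArg Subtype.val hc
        have h3 : (c : k) = φ b' := frobenius_inj k p h2
        rw [← h3]
        exact c.2
      have hmin := minpoly.eq_of_irreducible_of_monic hirr (x := φ b') (by
        simp only [map_sub, map_pow, Polynomial.aeval_X, Polynomial.aeval_C]
        rw [← map_pow, sub_eq_zero]
        rfl) (Polynomial.monic_X_pow_sub_C _ hp.out.ne_zero)
      obtain ⟨h, hh⟩ := minpoly.dvd F (φ b') h1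
      rw [← hmin] at hh
      have hh' : g = (Polynomial.X ^ p - Polynomial.C c0) * h.map (ρ'.symm : F →+* C) := by
        have h4 := congrArg (Polynomial.map (ρ'.symm : F →+* C)) hh
        rw [Polynomial.map_map, Polynomial.map_mul] at h4
        simpa using h4
      rw [hh', map_mul]
      simp [ev, c0]
    have hle := hmax hmem hCle
    have hb' : b' ∈ C := hle ⟨Polynomial.X, by simp [ev]⟩
    exact hb ⟨⟨b', hb'⟩, rfl⟩
  have hbij : Function.Bijective ρ := ⟨hρ, fun b => hall b⟩
  refine ⟨C.subtype.comp (RingEquiv.ofBijective ρ hbij).symm.toRingHom, ?_⟩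
  ext x
  exact (RingEquiv.ofBijective ρ hbij).apply_symm_apply x

/-- A square-zero extension of a field killed by the characteristic exponent has a section. -/
theorem exists_section (p : ℕ) [CharP k p] (hpB : (p : B) = 0)
    (hφ : Function.Surjective φ) (hker : ∀ x y, φ x = 0 → φ y = 0 → x * y = 0) :
    ∃ σ : k →+* B, φ.comp σ = RingHom.id k := by
  rcases CharP.char_is_prime_or_zero k p with hp | rfl
  · have : Fact p.Prime := ⟨hp⟩
    exact exists_section_of_charP φ p hpB hφ hker
  · have : CharZero k := CharP.charP_to_charZero k
    exact exists_section_of_charZero φ hφ hker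

end CoefficientField

/-! ### Lifting homomorphisms from coefficient rings. -/

section Lifting

variable {k A : Type*} [Field k] [CommRing A] (p : ℕ) [CharP k p] (π : A →+* k)

include π in
-- Form the fibre product `P = A ×_C B`. Modulo `p` it is a square-zero extension of `k`, hence has
-- a section `σ`. The elements of `P` whose class lies in the image of `σ` project isomorphically
-- onto `A`, and inverting this projection gives the lift.
lemma exists_lift_of_sq_zero (hπ : Function.Surjective π)
    (hker : RingHom.ker π = Ideal.span {(p : A)}) (hreg : ∀ a : A, (p : A) * a = 0 → p = 0 ∨ a = 0)
    {B C : Type*} [CommRing B] [CommRing C] (q : B →+* C) (hq : Function.Surjective q)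
    (hsq : ∀ x y, q x = 0 → q y = 0 → x * y = 0) (hp : ∀ x, q x = 0 → (p : B) * x = 0)
    (φ : A →+* C) : ∃ ψ : A →+* B, q.comp ψ = φ := by
  let P : Subring (A × B) :=
    RingHom.eqLocus (φ.comp (RingHom.fst A B)) (q.comp (RingHom.snd A B))
  have hP : ∀ x : P, φ x.1.1 = q x.1.2 := fun x => x.2
  let I : Ideal P := Ideal.span {(p : P)}
  let θ : P →+* k := π.comp ((RingHom.fst A B).comp P.subtype)
  have hθ : ∀ x : P, θ x = π x.1.1 := fun _ => rfl
  have hpk : π (p : A) = 0 := by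
    rw [← RingHom.mem_ker, hker]
    exact Ideal.mem_span_singleton_self _
  let θ' : P ⧸ I →+* k := Ideal.Quotient.lift I θ (fun a ha => by
    obtain ⟨b, rfl⟩ := Ideal.mem_span_singleton'.1 ha
    rw [map_mul, map_natCast, ← map_natCast π, hpk, mul_zero])
  have hlift : ∀ a : A, ∃ x : P, x.1.1 = a := fun a => by
    obtain ⟨b, hb⟩ := hq (φ a)
    exact ⟨⟨(a, b), hb.symm⟩, rfl⟩
  have hθ' : Function.Surjective θ' := fun t => by
    obtain ⟨a, rfl⟩ := hπ t
    obtain ⟨x, rfl⟩ := hlift a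
    exact ⟨Ideal.Quotient.mk I x, rfl⟩
  -- The first coordinate is a multiple of `p`, so modulo `p` it can be made zero. The second
  -- coordinate then lies in `ker q`, where products vanish.
  have hkerθ : ∀ x : P, θ x = 0 → ∃ y : P, y.1.1 = 0 ∧
      Ideal.Quotient.mk I x = Ideal.Quotient.mk I y := by
    intro x hx
    rw [hθ, ← RingHom.mem_ker, hker, Ideal.mem_span_singleton'] at hx
    obtain ⟨a, ha⟩ := hx
    obtain ⟨z, rfl⟩ := hlift a
    refine ⟨x - z * (p : P), ?_, ?_⟩
    · change x.1.1 - z.1.1 * ((p : P) : A × B).1 = 0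
      rw [← ha]
      simp
    · rw [Ideal.Quotient.eq, sub_sub_cancel]
      exact Ideal.mul_mem_left _ _ (Ideal.mem_span_singleton_self _)
  obtain ⟨σ, hσ⟩ := exists_section θ' p (by
      rw [← map_natCast (Ideal.Quotient.mk I)]
      exact Ideal.Quotient.eq_zero_iff_mem.2 (Ideal.mem_span_singleton_self _)) hθ' (by
    intro x y hx hy
    obtain ⟨x, rfl⟩ := Ideal.Quotient.mk_surjective x
    obtain ⟨y, rfl⟩ := Ideal.Quotient.mk_surjective y
    obtain ⟨x', hx0, hx'⟩ := hkerθ x hx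
    obtain ⟨y', hy0, hy'⟩ := hkerθ y hy
    rw [hx', hy', ← map_mul]
    have h1 : x' * y' = 0 := Subtype.ext (Prod.ext (by
      change x'.1.1 * y'.1.1 = 0
      rw [hx0, zero_mul]) (hsq _ _ (by rw [← hP, hx0, map_zero]) (by rw [← hP, hy0, map_zero])))
    rw [h1, map_zero])
  have hσ' : ∀ t, θ' (σ t) = t := fun t => congrArg (fun f : k →+* k => f t) hσ
  let D : Subring P := RingHom.eqLocus (Ideal.Quotient.mk I) (σ.comp θ)
  have hD : ∀ x : D, Ideal.Quotient.mk I x.1 = σ (θ x.1) := fun x => x.2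
  let ρ : D →+* A := ((RingHom.fst A B).comp P.subtype).comp D.subtype
  have hρ : ∀ x : D, ρ x = x.1.1.1 := fun _ => rfl
  have hbij : Function.Bijective ρ := by
    constructor
    · rw [injective_iff_map_eq_zero]
      intro x hx
      have h1 : θ x.1 = 0 := by rw [hθ, ← hρ, hx, map_zero]
      have h2 := hD x
      rw [h1, map_zero, Ideal.Quotient.eq_zero_iff_mem, Ideal.mem_span_singleton'] at h2
      obtain ⟨y, hy⟩ := h2
      -- `x = y p` has first coordinate zero. Either `p = 0` and `x = 0`, or `y` has first
      -- coordinate zero, its second lies in `ker q`, and `p` kills it.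
      have h3 : y.1.1 * (p : A) = 0 := by
        rw [← hx, hρ, ← hy]
        rfl
      refine Subtype.ext (Subtype.ext (Prod.ext hx ?_))
      change x.1.1.2 = 0
      rw [← hy]
      change y.1.2 * ((p : A × B).2) = 0
      rw [Prod.snd_natCast]
      rw [mul_comm] at h3 ⊢
      rcases hreg _ h3 with h0 | h0
      · rw [h0, Nat.cast_zero, zero_mul]
      · exact hp _ (by rw [← hP, h0, map_zero])
    · intro a
      obtain ⟨x, rfl⟩ := hlift a
      obtain ⟨y, hy⟩ := Ideal.Quotient.mk_surjective (Ideal.Quotient.mk I x - σ (θ x))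
      have hy0 : θ y = 0 := by
        have h1 : θ' (Ideal.Quotient.mk I y) = θ x - θ x := by
          rw [hy, map_sub, hσ']
          rfl
        rw [sub_self] at h1
        exact h1
      obtain ⟨y', hy1, hy2⟩ := hkerθ y hy0
      have h3 : θ (x - y') = θ x := by
        rw [map_sub, hθ y', hy1, map_zero, sub_zero]
      refine ⟨⟨x - y', ?_⟩, ?_⟩
      · change Ideal.Quotient.mk I (x - y') = σ (θ (x - y'))
        rw [h3, map_sub, ← hy2, hy, sub_sub_cancel]
      · change x.1.1 - y'.1.1 = x.1.1
        rw [hy1, sub_zero]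
  let e := RingEquiv.ofBijective ρ hbij
  refine ⟨((RingHom.snd A B).comp (P.subtype.comp D.subtype)).comp e.symm.toRingHom, ?_⟩
  ext a
  obtain ⟨x, rfl⟩ := e.surjective a
  simp only [RingHom.comp_apply, RingEquiv.toRingHom_eq_coe, RingHom.coe_coe, e.symm_apply_apply]
  exact (hP x.1).symm

include π in
/-- Ring homomorphisms from a ring with maximal ideal `(p)` and torsion-free over `ℤ` lift along
surjections from a complete ring. -/
theorem exists_lift_of_isAdicComplete (hπ : Function.Surjective π)
    (hker : RingHom.ker π = Ideal.span {(p : A)}) (hreg : ∀ a : A, (p : A) * a = 0 → p = 0 ∨ a = 0)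
    {D C : Type*} [CommRing D] [CommRing C] (I : Ideal D) [IsAdicComplete I D] (hpI : (p : D) ∈ I)
    (q : D →+* C) (hq : Function.Surjective q) (hqI : RingHom.ker q ≤ I)
    (hC : IsHausdorff (I.map q) C) (φ : A →+* C) : ∃ ψ : A →+* D, q.comp ψ = φ := by
  -- Since `ker q ⊆ I`, `L 0 = ker q` and `D/L 0 = C`. Each `L n/L (n+1)` has square zero and is
  -- killed by `p ∈ I`, so the map lifts stepwise. As `L n ⊆ I ^ n`, the lifts converge in `D`.
  let L : ℕ → Ideal D := fun n => RingHom.ker q ⊓ I ^ (n + 1)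
  have hL : ∀ n, L (n + 1) ≤ L n := fun n =>
    inf_le_inf_left _ (Ideal.pow_le_pow_right (Nat.le_succ _))
  have hLI : ∀ n, L n ≤ I ^ n := fun n => inf_le_right.trans (Ideal.pow_le_pow_right (Nat.le_succ _))
  have hstep : ∀ n (f : A →+* D ⧸ L n), ∃ g : A →+* D ⧸ L (n + 1),
      (Ideal.Quotient.factor (hL n)).comp g = f := by
    intro n f
    have hk : ∀ x, Ideal.Quotient.factor (hL n) x = 0 → ∃ d ∈ L n, Ideal.Quotient.mk _ d = x := by
      intro x hx
      obtain ⟨d, rfl⟩ := Ideal.Quotient.mk_surjective x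
      exact ⟨d, Ideal.Quotient.eq_zero_iff_mem.1 hx, rfl⟩
    refine exists_lift_of_sq_zero p π hπ hker hreg _ (Ideal.Quotient.factor_surjective (hL n)) ?_ ?_ f
    · intro x y hx hy
      obtain ⟨x, hx', rfl⟩ := hk x hx
      obtain ⟨y, hy', rfl⟩ := hk y hy
      rw [← map_mul, Ideal.Quotient.eq_zero_iff_mem]
      refine ⟨Ideal.mul_mem_right _ _ hx'.1, ?_⟩
      refine Ideal.pow_le_pow_right (by omega : n + 1 + 1 ≤ (n + 1) + (n + 1)) ?_
      rw [pow_add]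
      exact Ideal.mul_mem_mul hx'.2 hy'.2
    · intro x hx
      obtain ⟨x, hx', rfl⟩ := hk x hx
      rw [← map_natCast (Ideal.Quotient.mk _), ← map_mul, Ideal.Quotient.eq_zero_iff_mem]
      refine ⟨Ideal.mul_mem_left _ _ hx'.1, ?_⟩
      rw [pow_succ']
      exact Ideal.mul_mem_mul hpI hx'.2
  choose next hnext using hstep
  have hL0 : RingHom.ker q = L 0 := by
    simp only [L, zero_add, pow_one]
    exact (inf_eq_left.2 hqI).symm
  let e0 : C ≃+* D ⧸ L 0 :=
    (RingHom.quotientKerEquivOfSurjective hq).symm.trans (Ideal.quotEquivOfEq hL0)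
  have he0 : ∀ d, e0 (q d) = Ideal.Quotient.mk _ d := fun d => by
    have h1 : (RingHom.quotientKerEquivOfSurjective hq).symm (q d) = Ideal.Quotient.mk _ d := by
      rw [RingEquiv.symm_apply_eq]
      rfl
    simp only [e0, RingEquiv.trans_apply, h1]
    rfl
  let f : (n : ℕ) → (A →+* D ⧸ L n) := fun n => Nat.rec ((e0 : C →+* D ⧸ L 0).comp φ) next n
  have hf : ∀ n a d, f n a = Ideal.Quotient.mk _ d → ∀ m, m ≤ n → f m a = Ideal.Quotient.mk _ d := by
    intro n
    induction n with
    | zero => intro a d h m hm; rw [Nat.le_zero.1 hm]; exact h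
    | succ n ih =>
      intro a d h m hm
      rcases Nat.le_succ_iff.1 hm with hm | rfl
      · refine ih a d ?_ m hm
        have h1 : f n a = Ideal.Quotient.factor (hL n) (f (n + 1) a) :=
          (congrArg (fun g : A →+* D ⧸ L n => g a) (hnext n (f n))).symm
        rw [h1, h]
        rfl
      · exact h
  let F : (n : ℕ) → (A →+* D ⧸ I ^ n) := fun n => (Ideal.Quotient.factor (hLI n)).comp (f n)
  have hF : ∀ {m n : ℕ} (hle : m ≤ n), (Ideal.Quotient.factorPow I hle).comp (F n) = F m := by
    intro m n hle
    ext a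
    obtain ⟨d, hd⟩ := Ideal.Quotient.mk_surjective (f n a)
    simp only [F, RingHom.comp_apply]
    rw [hf n a d hd.symm m hle, ← hd]
    rfl
  refine ⟨IsAdicComplete.liftRingHom I F hF, ?_⟩
  ext a
  refine sub_eq_zero.1 (hC.haus _ fun n => ?_)
  rw [smodEq_pow_smul_top_iff, sub_zero, ← Ideal.map_pow, RingHom.comp_apply]
  obtain ⟨d, hd⟩ := Ideal.Quotient.mk_surjective (f n a)
  have h1 : φ a = q d := e0.injective (by
    rw [he0]
    exact hf n a d hd.symm 0 (Nat.zero_le n))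
  rw [h1, ← map_sub]
  refine Ideal.mem_map_of_mem _ ?_
  rw [← Ideal.Quotient.eq, IsAdicComplete.mk_liftRingHom]
  simp only [F, RingHom.comp_apply]
  rw [← hd]
  rfl

end Lifting

/-! ### Construction of coefficient rings. -/

section CoefficientRing

/-- Every field is contained in the residue field of a local domain of characteristic zero in which
monic polynomials have roots. -/
lemma exists_localDomain_residueField (k : Type v) [Field k] :
    ∃ (V : Type v) (_ : CommRing V) (_ : IsDomain V) (_ : IsLocalRing V) (_ : CharZero V)
      (_ : k →+* ResidueField V),
      ∀ f : Polynomial V, f.Monic → f.natDegree ≠ 0 → ∃ r, f.eval r = 0 := by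
  let Z := MvPolynomial k ℤ
  let Ω := AlgebraicClosure (FractionRing Z)
  let ψ : Z →+* Ω := (algebraMap (FractionRing Z) Ω).comp (algebraMap Z (FractionRing Z))
  have hψ : Function.Injective ψ :=
    (algebraMap (FractionRing Z) Ω).injective.comp (IsFractionRing.injective Z (FractionRing Z))
  let φ : Z →+* k := MvPolynomial.eval₂Hom (Int.castRingHom k) id
  have hφ : Function.Surjective φ := fun t => ⟨MvPolynomial.X t, MvPolynomial.eval₂_X _ _ t⟩
  let e : Z ≃+* ψ.range := RingEquiv.ofBijective ψ.rangeRestrict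
    ⟨fun x y h => hψ (congrArg Subtype.val h), ψ.rangeRestrict_surjective⟩
  -- `k` is a quotient of `ℤ[X_t : t ∈ k]`, embedded in an algebraically closed field `Ω`. A
  -- valuation ring in which the kernel consists of nonunits receives `k` in its residue field;
  -- being integrally closed in `Ω`, it contains roots of its monic polynomials.
  obtain ⟨V, hV1, hV2⟩ := Ideal.image_subset_nonunits_valuationSubring
    (RingHom.ker (φ.comp (e.symm : ψ.range →+* Z))) (RingHom.ker_ne_top _)
  let ψV : Z →+* V := ψ.codRestrict V.toSubring fun z => hV1 ⟨z, rfl⟩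
  have hker : RingHom.ker φ ≤ RingHom.ker ((residue V).comp ψV) := by
    intro z hz
    have h1 : (ψV z : Ω) ∈ V.nonunits := hV2 ⟨e z, by
      change φ (e.symm (e z)) = 0
      rw [e.symm_apply_apply]
      exact hz, rfl⟩
    rw [RingHom.mem_ker, RingHom.comp_apply, residue_eq_zero_iff]
    exact V.coe_mem_nonunits_iff.1 h1
  have hchar : CharZero Ω := by
    have : CharZero (FractionRing Z) := charZero_of_injective_algebraMap
      (IsFractionRing.injective Z (FractionRing Z))
    exact charZero_of_injective_algebraMap (algebraMap (FractionRing Z) Ω).injective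
  refine ⟨V, inferInstance, inferInstance, inferInstance,
    charZero_of_injective_ringHom (f := ψV) fun x y h => hψ (congrArg Subtype.val h),
    RingHom.liftOfSurjective φ hφ ⟨(residue V).comp ψV, hker⟩, ?_⟩
  intro f hf hdeg
  have hdeg' : (f.map (algebraMap V Ω)).degree ≠ 0 := by
    rw [hf.degree_map, Polynomial.degree_eq_natDegree hf.ne_zero]
    exact_mod_cast hdeg
  obtain ⟨x, hx⟩ := IsAlgClosed.exists_root _ hdeg'
  rw [Polynomial.IsRoot, Polynomial.eval_map] at hx
  obtain ⟨r, rfl⟩ := IsIntegrallyClosed.isIntegral_iff.1 (⟨f, hf, hx⟩ : IsIntegral V x)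
  refine ⟨r, ?_⟩
  rw [Polynomial.eval₂_at_apply] at hx
  exact (IsFractionRing.injective V Ω) (by rw [hx, map_zero])

variable {V : Type v} [CommRing V] [IsLocalRing V]

/-- Split off roots of `f` one at a time. Modulo the maximal ideal one of the linear factors must
vanish at `β`. -/
lemma exists_root_residue_eq
    (hV : ∀ f : Polynomial V, f.Monic → f.natDegree ≠ 0 → ∃ r, f.eval r = 0) (n : ℕ) :
    ∀ f : Polynomial V, f.Monic → f.natDegree = n → ∀ β : ResidueField V,
      f.eval₂ (residue V) β = 0 → ∃ r, f.eval r = 0 ∧ residue V r = β := by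
  induction n with
  | zero =>
    intro f hf hdeg β hβ
    rw [hf.natDegree_eq_zero.1 hdeg, Polynomial.eval₂_one] at hβ
    exact absurd hβ one_ne_zero
  | succ n ih =>
    intro f hf hdeg β hβ
    obtain ⟨r, hr⟩ := hV f hf (by omega)
    obtain ⟨g, rfl⟩ := Polynomial.dvd_iff_isRoot.2 hr
    have hg : g.Monic := (Polynomial.monic_X_sub_C r).of_mul_monic_left hf
    rw [Polynomial.eval₂_mul, mul_eq_zero] at hβ
    rcases hβ with hβ | hβ
    · refine ⟨r, hr, ?_⟩
      rw [Polynomial.eval₂_sub, Polynomial.eval₂_X, Polynomial.eval₂_C, sub_eq_zero] at hβ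
      exact hβ.symm
    · rw [(Polynomial.monic_X_sub_C r).natDegree_mul hg, Polynomial.natDegree_X_sub_C] at hdeg
      obtain ⟨s, hs, hsβ⟩ := ih g hg (by omega) β hβ
      exact ⟨s, by rw [Polynomial.eval_mul, hs, mul_zero], hsβ⟩

/-- Inside a local domain of characteristic zero with roots of monic polynomials there is a subring
with maximal ideal `(p)` and prescribed residue field. -/
lemma exists_subring_residueField
    (hV : ∀ f : Polynomial V, f.Monic → f.natDegree ≠ 0 → ∃ r, f.eval r = 0)
    {k : Type*} [Field k] (p : ℕ) [CharP k p] (ι : k →+* ResidueField V) :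
    ∃ A : Subring V, (∀ a : A, residue V a = 0 → (p : A) ∣ a) ∧ (∀ a : A, ∃ t, residue V a = ι t) ∧
      (∀ t, ∃ a : A, residue V a = ι t) ∧ (∀ a : A, residue V a ≠ 0 → IsUnit a) := by
  -- Zorn's lemma on subrings `A` with `A ∩ 𝔪_V = pA` and residues in `ι k`, starting from the image
  -- of `ℤ`.
  let s : Set (Subring V) :=
    {A | (∀ a ∈ A, residue V a = 0 → ∃ b ∈ A, a = p * b) ∧ A ≤ ι.range.comap (residue V)}
  obtain ⟨A, -, ⟨hA1, hA2⟩, hmax⟩ := zorn_le_nonempty₀ s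
    (fun c hc hchain y hy => by
      have hne : c.Nonempty := ⟨y, hy⟩
      refine ⟨sSup c, ⟨fun a ha ha0 => ?_, sSup_le fun A hA => (hc hA).2⟩, fun z hz => le_sSup hz⟩
      obtain ⟨A, hA, haA⟩ := (Subring.mem_sSup_of_directedOn hne hchain.directedOn).1 ha
      obtain ⟨b, hb, rfl⟩ := (hc hA).1 a haA ha0
      exact ⟨b, le_sSup hA hb, rfl⟩)
    (⊥ : Subring V) ⟨by
      intro a ha ha0
      obtain ⟨n, rfl⟩ := Subring.mem_bot.1 ha
      rw [map_intCast, ← map_intCast ι] at ha0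
      have h1 : (n : k) = 0 := ι.injective (by rw [ha0, map_zero])
      obtain ⟨m, rfl⟩ := (CharP.intCast_eq_zero_iff k p n).1 h1
      exact ⟨m, Subring.mem_bot.2 ⟨m, rfl⟩, by push_cast; rfl⟩, bot_le⟩
  have hunit : ∀ a ∈ A, residue V a ≠ 0 → ∃ b ∈ A, a * b = 1 := by
    -- `A'` inverts the elements of `A` that are units in `V`. It stays in the family, so maximality
    -- makes such elements units of `A`.
    let A' : Subring V :=
      { carrier := {x | ∃ a ∈ A, residue V a ≠ 0 ∧ a * x ∈ A}
        mul_mem' := by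
          rintro x y ⟨a, ha, ha0, hax⟩ ⟨b, hb, hb0, hby⟩
          refine ⟨a * b, A.mul_mem ha hb, by rw [map_mul]; exact mul_ne_zero ha0 hb0, ?_⟩
          rw [mul_mul_mul_comm]
          exact A.mul_mem hax hby
        one_mem' := ⟨1, A.one_mem, by simp, by simp⟩
        add_mem' := by
          rintro x y ⟨a, ha, ha0, hax⟩ ⟨b, hb, hb0, hby⟩
          refine ⟨a * b, A.mul_mem ha hb, by rw [map_mul]; exact mul_ne_zero ha0 hb0, ?_⟩
          have : a * b * (x + y) = b * (a * x) + a * (b * y) := by ring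
          rw [this]
          exact A.add_mem (A.mul_mem hb hax) (A.mul_mem ha hby)
        zero_mem' := ⟨1, A.one_mem, by simp, by simp⟩
        neg_mem' := by
          rintro x ⟨a, ha, ha0, hax⟩
          exact ⟨a, ha, ha0, by rw [mul_neg]; exact A.neg_mem hax⟩ }
    have hAA' : A ≤ A' := fun a ha => ⟨1, A.one_mem, by simp, by simpa using ha⟩
    have hA's : A' ∈ s := by
      constructor
      · rintro x ⟨a, ha, ha0, hax⟩ hx
        obtain ⟨b, hb, hab⟩ := hA1 _ hax (by rw [map_mul, hx, mul_zero])
        obtain ⟨a', ha'⟩ := (residue_ne_zero_iff_isUnit a).1 ha0 |>.exists_right_inv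
        refine ⟨a' * b, ⟨a, ha, ha0, ?_⟩, ?_⟩
        · rwa [← mul_assoc, ha', one_mul]
        · calc x = a * a' * x := by rw [ha', one_mul]
            _ = a' * (a * x) := by ring
            _ = p * (a' * b) := by rw [hab]; ring
      · rintro x ⟨a, ha, ha0, hax⟩
        obtain ⟨t, ht⟩ := hA2 ha
        obtain ⟨u, hu⟩ := hA2 hax
        refine ⟨u / t, ?_⟩
        rw [map_div₀, hu, ht, map_mul, mul_div_cancel_left₀ _ ha0]
    intro a ha ha0
    obtain ⟨b, hb⟩ := (residue_ne_zero_iff_isUnit a).1 ha0 |>.exists_right_inv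
    exact ⟨b, hmax hA's hAA' ⟨a, ha, ha0, by rw [hb]; exact A.one_mem⟩, hb⟩
  have hdvd : ∀ a : A, residue V a = 0 → (p : A) ∣ a := fun a ha => by
    obtain ⟨b, hb, hab⟩ := hA1 a a.2 ha
    exact ⟨⟨b, hb⟩, Subtype.ext (by simpa using hab)⟩
  refine ⟨A, hdvd, fun a => ?_, fun t => ?_, fun a ha => ?_⟩
  · obtain ⟨t, ht⟩ := hA2 a.2
    exact ⟨t, ht.symm⟩
  · let ρ : A →+* ResidueField V := (residue V).comp A.subtype
    let F : Subfield (ResidueField V) := { ρ.range with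
      inv_mem' := by
        rintro _ ⟨c, rfl⟩
        by_cases h0 : ρ c = 0
        · exact ⟨0, by rw [h0, map_zero, inv_zero]⟩
        obtain ⟨b, hb, hcb⟩ := hunit c c.2 h0
        refine ⟨⟨b, hb⟩, eq_inv_of_mul_eq_one_right ?_⟩
        change residue V c * residue V b = 1
        rw [← map_mul, hcb, map_one] }
    let ρF : A →+* F := (ρ.rangeRestrict : A →+* ρ.range)
    have hρF : Function.Surjective ρF := ρ.rangeRestrict_surjective
    have hcomp : (algebraMap F (ResidueField V)).comp ρF = ρ := rfl
    set β := ι t with hβ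
    -- A good lift `b` of `β`: a root of a monic lift of the minimal polynomial if `β` is algebraic
    -- over `F`, any lift otherwise. Then an element `g(b)` of `𝔪_V` can be rewritten with
    -- coefficients in `A ∩ 𝔪_V = pA`, so `A[b]` stays in the family.
    obtain ⟨b, hb, hkey⟩ : ∃ b : V, residue V b = β ∧ ∀ g : Polynomial A,
        Polynomial.aeval β (g.map ρF) = 0 → ∃ r : Polynomial A, r.map ρF = 0 ∧
          g.eval₂ A.subtype b = r.eval₂ A.subtype b := by
      by_cases hint : IsIntegral F β
      · obtain ⟨f, hf1, hf2, hf3⟩ := Polynomial.lifts_and_natDegree_eq_and_monic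
          ((Polynomial.mem_lifts _).2 (Polynomial.map_surjective ρF hρF (minpoly F β)))
          (minpoly.monic hint)
        obtain ⟨b, hb1, hb2⟩ := exists_root_residue_eq hV _ (f.map A.subtype) (hf3.map _) rfl β (by
          rw [Polynomial.eval₂_map]
          have h1 := minpoly.aeval F β
          rw [← hf1, Polynomial.aeval_def, Polynomial.eval₂_map, hcomp] at h1
          exact h1)
        refine ⟨b, hb2, fun g hg => ⟨g %ₘ f, ?_, ?_⟩⟩
        · rw [Polynomial.map_modByMonic _ hf3, hf1, Polynomial.modByMonic_eq_zero_iff_dvd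
            (minpoly.monic hint)]
          exact minpoly.dvd F β hg
        · conv_lhs => rw [← Polynomial.modByMonic_add_div g f]
          rw [Polynomial.eval_map] at hb1
          rw [Polynomial.eval₂_add, Polynomial.eval₂_mul, hb1, zero_mul, add_zero]
      · obtain ⟨b, hb⟩ := residue_surjective β
        refine ⟨b, hb, fun g hg => ⟨g, ?_, rfl⟩⟩
        have := minpoly.dvd F β hg
        rwa [minpoly.eq_zero hint, zero_dvd_iff] at this
    let ev := Polynomial.eval₂RingHom A.subtype b
    have hle : A ≤ ev.range := fun x hx => ⟨Polynomial.C ⟨x, hx⟩, by simp [ev]⟩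
    have hmem : ev.range ∈ s := by
      constructor
      · rintro _ ⟨g, rfl⟩ hg
        obtain ⟨r, hr, hgr⟩ := hkey g (by
          rw [Polynomial.aeval_def, Polynomial.eval₂_map, hcomp, ← hg, ← hb]
          simp only [ev, Polynomial.coe_eval₂RingHom, Polynomial.hom_eval₂]
          rfl)
        obtain ⟨q, rfl⟩ := (Polynomial.C_dvd_iff_dvd_coeff (p : A) r).2 fun i => hdvd _ (by
          have h1 := congrArg (fun f => ((Polynomial.coeff f i : F) : ResidueField V)) hr
          simp only [Polynomial.coeff_map, Polynomial.coeff_zero] at h1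
          exact h1)
        refine ⟨ev q, ⟨q, rfl⟩, ?_⟩
        change Polynomial.eval₂ A.subtype b g = _
        rw [hgr, Polynomial.eval₂_mul, Polynomial.eval₂_C]
        simp [ev]
      · rintro _ ⟨g, rfl⟩
        simp only [ev, Polynomial.coe_eval₂RingHom, Polynomial.eval₂_eq_sum_range]
        refine Subring.sum_mem _ fun i _ => Subring.mul_mem _ (hA2 (g.coeff i).2)
          (Subring.pow_mem _ ?_ _)
        exact ⟨t, hb.symm⟩
    exact ⟨⟨b, hmax hmem hle ⟨Polynomial.X, by simp [ev]⟩⟩, hb⟩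
  · obtain ⟨b, hb, hab⟩ := hunit a a.2 ha
    exact IsUnit.of_mul_eq_one ⟨b, hb⟩ (Subtype.ext hab)

/-- Every field of characteristic `p` is the residue field of a domain in which every nonzero element
is a unit times a power of `p`. -/
theorem exists_coefficientRing (k : Type v) [Field k] (p : ℕ) [CharP k p] :
    ∃ (A : Type v) (_ : CommRing A) (_ : IsDomain A) (π : A →+* k), Function.Surjective π ∧
      RingHom.ker π = Ideal.span {(p : A)} ∧ ((p : A) = 0 → p = 0) ∧
      ∀ a : A, a ≠ 0 → ∃ (n : ℕ) (u : A), IsUnit u ∧ a = p ^ n * u := by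
  rcases eq_or_ne p 0 with rfl | hp
  · refine ⟨k, inferInstance, inferInstance, RingHom.id k, Function.surjective_id, ?_,
      fun _ => rfl, fun a ha => ⟨0, a, ha.isUnit, by simp⟩⟩
    rw [Nat.cast_zero, Ideal.span_singleton_eq_bot.2 rfl]
    exact (RingHom.injective_iff_ker_eq_bot _).1 fun x y h => h
  obtain ⟨V, _, _, _, _, ι, hV⟩ := exists_localDomain_residueField k
  obtain ⟨A, h1, h2, h3, h4⟩ := exists_subring_residueField hV p ι
  choose ρ' hρ' using h2
  let ρ : A →+* k :=
    { toFun := ρ'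
      map_one' := ι.injective (by rw [← hρ', map_one]; simp)
      map_mul' := fun x y => ι.injective (by rw [← hρ', map_mul, ← hρ', ← hρ']; simp)
      map_zero' := ι.injective (by rw [← hρ', map_zero]; simp)
      map_add' := fun x y => ι.injective (by rw [← hρ', map_add, ← hρ', ← hρ']; simp) }
  have hρ : ∀ a : A, residue V a = ι (ρ a) := hρ'
  have hρs : Function.Surjective ρ := fun t => by
    obtain ⟨a, ha⟩ := h3 t
    exact ⟨a, ι.injective (by rw [← hρ, ha])⟩
  have hρp : ρ (p : A) = 0 := by rw [map_natCast, CharP.cast_eq_zero]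
  have hker : ∀ a : A, ρ a = 0 ↔ (p : A) ∣ a := fun a =>
    ⟨fun h => h1 a (by rw [hρ, h, map_zero]), by
      rintro ⟨b, rfl⟩
      rw [map_mul, hρp, zero_mul]⟩
  have hunit : ∀ a : A, ¬ (p : A) ∣ a → IsUnit a := fun a ha =>
    h4 a fun h => ha (h1 a h)
  have hpu : ¬ IsUnit (p : A) := fun h => by
    have := h.map ρ
    rw [hρp] at this
    exact not_isUnit_zero this
  have hp0 : (p : A) ≠ 0 := fun h => hp (by
    have := congrArg (Subtype.val) h
    simpa using this)
  -- `A` need not be `p`-adically separated. Elements outside `P` are units times powers of `p`, so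
  -- `P` is prime and `A/P` has the required form.
  let P : Ideal A := ⨅ n : ℕ, Ideal.span {(p : A) ^ n}
  have hP : ∀ a, a ∉ P → ∃ (n : ℕ) (u : A), IsUnit u ∧ a = p ^ n * u := by
    intro a ha
    have hfin : FiniteMultiplicity (p : A) a := by
      by_contra h
      refine ha (Ideal.mem_iInf.2 fun n => Ideal.mem_span_singleton.2 ?_)
      exact FiniteMultiplicity.not_iff_forall.1 h n
    obtain ⟨u, hu, hpu'⟩ := hfin.exists_eq_pow_mul_and_not_dvd
    exact ⟨_, u, hunit u hpu', hu⟩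
  have hPn : ∀ (n : ℕ) (u : A), IsUnit u → (p : A) ^ n * u ∉ P := by
    intro n u hu hmem
    have h5 := Ideal.mem_span_singleton.1 (Ideal.mem_iInf.1 hmem (n + 1))
    rw [pow_succ, mul_dvd_mul_iff_left (pow_ne_zero n hp0)] at h5
    exact hpu (isUnit_of_dvd_unit h5 hu)
  have hprime : P.IsPrime := by
    refine Ideal.isPrime_iff.2 ⟨fun h => hPn 0 1 isUnit_one (h ▸ Submodule.mem_top), ?_⟩
    intro a b hab
    by_contra! hcon
    obtain ⟨n, u, hu, rfl⟩ := hP a hcon.1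
    obtain ⟨m, w, hw, rfl⟩ := hP b hcon.2
    refine hPn (n + m) (u * w) (hu.mul hw) ?_
    convert hab using 1
    ring
  have hPker : ∀ a ∈ P, ρ a = 0 := fun a ha => (hker a).2 (by
    simpa using Ideal.mem_span_singleton.1 (Ideal.mem_iInf.1 ha 1))
  refine ⟨A ⧸ P, inferInstance, inferInstance, Ideal.Quotient.lift P ρ hPker,
    Ideal.Quotient.lift_surjective_of_surjective P hPker hρs, ?_, fun h => ?_, ?_⟩
  · apply le_antisymm
    · intro x hx
      obtain ⟨a, rfl⟩ := Ideal.Quotient.mk_surjective x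
      obtain ⟨b, rfl⟩ := (hker a).1 hx
      exact Ideal.mem_span_singleton.2 ⟨Ideal.Quotient.mk P b, by rw [map_mul, map_natCast]⟩
    · rw [Ideal.span_singleton_le_iff_mem, RingHom.mem_ker, map_natCast, CharP.cast_eq_zero]
  · rw [← map_natCast (Ideal.Quotient.mk P), Ideal.Quotient.eq_zero_iff_mem] at h
    exact absurd (by rwa [pow_one, mul_one]) (hPn 1 1 isUnit_one)
  · intro x hx
    obtain ⟨a, rfl⟩ := Ideal.Quotient.mk_surjective x
    obtain ⟨n, u, hu, rfl⟩ := hP a fun h => hx (Ideal.Quotient.eq_zero_iff_mem.2 h)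
    exact ⟨n, _, hu.map (Ideal.Quotient.mk P), by rw [map_mul, map_pow, map_natCast]⟩

section

variable {A : Type*} [CommRing A] {p : ℕ}

lemma isPrincipalIdealRing_of_forall_eq_pow_mul_unit
    (h : ∀ a : A, a ≠ 0 → ∃ (n : ℕ) (u : A), IsUnit u ∧ a = p ^ n * u) :
    IsPrincipalIdealRing A := by
  classical
  refine ⟨fun I => ?_⟩
  rcases eq_or_ne I ⊥ with rfl | hI
  · infer_instance
  have hmem : ∀ a ∈ I, a ≠ 0 → ∃ n : ℕ, (p : A) ^ n ∈ I ∧ (p : A) ^ n ∣ a := by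
    intro a ha ha0
    obtain ⟨n, u, hu, rfl⟩ := h a ha0
    exact ⟨n, (I.mul_unit_mem_iff_mem hu).1 ha, dvd_mul_right _ _⟩
  obtain ⟨a, ha, ha0⟩ := Submodule.exists_mem_ne_zero_of_ne_bot hI
  have hex : ∃ n : ℕ, (p : A) ^ n ∈ I := (hmem a ha ha0).imp fun _ h => h.1
  refine ⟨(p : A) ^ Nat.find hex, le_antisymm (fun b hb => ?_) ?_⟩
  · rcases eq_or_ne b 0 with rfl | hb0
    · exact zero_mem _
    obtain ⟨n, hn, hd⟩ := hmem b hb hb0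
    exact Ideal.mem_span_singleton.2 ((pow_dvd_pow _ (Nat.find_min' hex hn)).trans hd)
  · exact (Ideal.span_singleton_le_iff_mem _).2 (Nat.find_spec hex)

/-- Over a principal ideal domain flat means torsion-free, and here only `p`-torsion needs checking.
The alternative `p = 0` covers the case of a field. -/
lemma flat_of_forall_eq_pow_mul_unit [IsDomain A]
    (h : ∀ a : A, a ≠ 0 → ∃ (n : ℕ) (u : A), IsUnit u ∧ a = p ^ n * u)
    {M : Type*} [AddCommGroup M] [Module A M]
    (hM : ∀ x : M, (p : A) • x = 0 → (p : A) = 0 ∨ x = 0) : Module.Flat A M := by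
  have := isPrincipalIdealRing_of_forall_eq_pow_mul_unit h
  have htf : Module.IsTorsionFree A M := by
    refine Module.isTorsionFree_iff_smul_eq_zero.2 fun a x hax => ?_
    by_contra! hcon
    obtain ⟨n, u, hu, rfl⟩ := h a hcon.1
    rw [mul_comm, mul_smul, hu.smul_eq_zero] at hax
    have hn : ∀ n : ℕ, (p : A) ^ n • x = 0 → (p : A) ^ n = 0 ∨ x = 0 := by
      intro n
      induction n with
      | zero => intro hx; right; simpa using hx
      | succ n ih =>
        intro hx
        rw [pow_succ', mul_smul] at hx
        rcases hM _ hx with h0 | h0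
        · left; rw [h0, zero_pow n.succ_ne_zero]
        · refine (ih h0).imp_left fun h => ?_
          rw [pow_succ, h, zero_mul]
    rcases hn n hax with h0 | h0
    · exact hcon.1 (by rw [h0, zero_mul])
    · exact hcon.2 h0
  infer_instance

end

end CoefficientRing

/-! ### Completed polynomial rings over a coefficient ring. -/

section FormalPowerSeries

/-- The ideal of the earlier variables is a monomial ideal, so membership is tested on supports, and
multiplying by a later variable does not alter the exponents of the earlier ones. -/
lemma MvPolynomial.isWeaklyRegular_X (A : Type*) [CommRing A] (d : ℕ) :
    RingTheory.Sequence.IsWeaklyRegular (MvPolynomial (Fin d) A)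
      (List.ofFn fun i => (MvPolynomial.X i : MvPolynomial (Fin d) A)) := by
  rw [RingTheory.Sequence.isWeaklyRegular_iff]
  intro i hi
  rw [List.length_ofFn] at hi
  rw [List.getElem_ofFn]
  have hs : (Ideal.ofList ((List.ofFn fun i => (X i : MvPolynomial (Fin d) A)).take i) • ⊤ :
      Submodule _ (MvPolynomial (Fin d) A)) = Ideal.span (X '' {j : Fin d | (j : ℕ) < i}) := by
    rw [smul_eq_mul, Ideal.mul_top]
    refine congrArg Ideal.span (Set.ext fun x => ?_)
    simp only [Set.mem_ofPred_eq, Set.mem_image, List.mem_take_iff_getElem, List.length_ofFn,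
      List.getElem_ofFn]
    constructor
    · rintro ⟨j, hj, rfl⟩
      exact ⟨⟨j, _⟩, by simpa using (lt_min_iff.1 hj).1, rfl⟩
    · rintro ⟨j, hj, rfl⟩
      exact ⟨j, lt_min hj j.2, rfl⟩
  rw [hs]
  refine isSMulRegular_iff_right_eq_zero_of_smul.2 fun x hx => ?_
  obtain ⟨f, rfl⟩ := Submodule.Quotient.mk_surjective _ x
  rw [← Submodule.Quotient.mk_smul, Submodule.Quotient.mk_eq_zero, mem_ideal_span_X_image] at hx
  rw [Submodule.Quotient.mk_eq_zero, mem_ideal_span_X_image]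
  intro m hm
  obtain ⟨j, hj, hmj⟩ := hx (Finsupp.single ⟨i, hi⟩ 1 + m) (by
    rw [smul_eq_mul, mem_support_iff, coeff_X_mul]
    exact mem_support_iff.1 hm)
  refine ⟨j, hj, ?_⟩
  have hne : (⟨i, hi⟩ : Fin d) ≠ j := fun h => by
    subst h
    exact (show ¬ (i < i) from lt_irrefl i) hj
  rwa [Finsupp.add_apply, Finsupp.single_eq_of_ne' hne, zero_add] at hmj

lemma MvPolynomial.isWeaklyRegular_quotient_X {A : Type*} [CommRing A] (d : ℕ) (p : ℕ) :
    RingTheory.Sequence.IsWeaklyRegular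
      (MvPolynomial (Fin d) A ⧸ Ideal.span {(p : MvPolynomial (Fin d) A)})
      (List.ofFn fun i => (MvPolynomial.X i : MvPolynomial (Fin d) A)) := by
  have hI : (Ideal.span {(p : A)}).map (C : A →+* MvPolynomial (Fin d) A) =
      Ideal.span {(p : MvPolynomial (Fin d) A)} := by
    rw [Ideal.map_span, Set.image_singleton, map_natCast]
  rw [← hI]
  let e := quotientEquivQuotientMvPolynomial (σ := Fin d) (Ideal.span {(p : A)})
  refine (AddEquiv.isWeaklyRegular_congr (e := e.toAddEquiv) ?_).1
    (MvPolynomial.isWeaklyRegular_X (A ⧸ Ideal.span {(p : A)}) d)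
  rw [List.forall₂_iff_get]
  refine ⟨by simp, fun i h1 h2 x => ?_⟩
  simp only [List.get_ofFn]
  change e (X _ * x) = Ideal.Quotient.mk _ (X _) * e x
  rw [map_mul]
  congr 1
  simp [e, quotientEquivQuotientMvPolynomial]

lemma MvPolynomial.ker_eval₂Hom_zero {A k σ : Type*} [CommRing A] [CommRing k] (π : A →+* k) :
    RingHom.ker (eval₂Hom π (0 : σ → k)) =
      (RingHom.ker π).map (C : A →+* MvPolynomial σ A) ⊔ Ideal.span (Set.range X) := by
  apply le_antisymm
  · intro f hf
    have h1 : C (constantCoeff f) ∈ (RingHom.ker π).map (C : A →+* MvPolynomial σ A) := by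
      refine Ideal.mem_map_of_mem _ ?_
      rw [RingHom.mem_ker] at hf ⊢
      rw [← hf]
      simp
    have h2 : f - C (constantCoeff f) ∈ Ideal.span (Set.range (X : σ → MvPolynomial σ A)) := by
      rw [← Set.image_univ, mem_ideal_span_X_image]
      intro m hm
      by_contra! hcon
      have : m = 0 := Finsupp.ext fun i => hcon i trivial
      subst this
      rw [mem_support_iff] at hm
      exact hm (by simp [constantCoeff_eq])
    rw [← sub_add_cancel f (C (constantCoeff f)), add_comm]
    exact Submodule.add_mem_sup h1 h2
  · refine sup_le (Ideal.map_le_iff_le_comap.2 fun a ha => ?_) (Ideal.span_le.2 ?_)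
    · rw [Ideal.mem_comap, RingHom.mem_ker, eval₂Hom_C]
      exact ha
    · rintro _ ⟨i, rfl⟩
      rw [SetLike.mem_coe, RingHom.mem_ker, eval₂Hom_X']
      rfl

/-- The completion of a polynomial ring over a coefficient ring at the maximal ideal generated by `p`
and the variables. -/
theorem exists_completion_mvPolynomial {A : Type v} [CommRing A] [IsDomain A] [IsNoetherianRing A]
    {k : Type*} [Field k] (p : ℕ) (π : A →+* k) (hπ : Function.Surjective π)
    (hker : RingHom.ker π = Ideal.span {(p : A)}) (d : ℕ) :
    ∃ (D : Type v) (_ : CommRing D) (_ : Algebra A D) (_ : IsLocalRing D) (_ : IsNoetherianRing D)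
      (xs : Fin d → D), IsAdicComplete (maximalIdeal D) D ∧
      maximalIdeal D = Ideal.span {(p : D)} ⊔ Ideal.span (Set.range xs) ∧
      RingTheory.Sequence.IsWeaklyRegular (D ⧸ Ideal.span {(p : D)}) (List.ofFn xs) ∧
      (∀ x : D, (p : D) * x = 0 → (p : A) = 0 ∨ x = 0) ∧
      ∀ (S : Type v) [CommRing S] (J : Ideal S) [IsAdicComplete J S] (φ : A →+* S) (y : Fin d → S),
        J = Ideal.span {(p : S)} ⊔ Ideal.span (Set.range y) →
        Function.Surjective ((Ideal.Quotient.mk J).comp φ) →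
        ∃ f : D →+* S, Function.Surjective f ∧ ∀ i, f (xs i) = y i := by
  let B := MvPolynomial (Fin d) A
  let I : Ideal B := Ideal.span {(p : B)} ⊔ Ideal.span (Set.range MvPolynomial.X)
  have hIker : I = RingHom.ker (MvPolynomial.eval₂Hom π (0 : Fin d → k)) := by
    rw [MvPolynomial.ker_eval₂Hom_zero, hker, Ideal.map_span, Set.image_singleton, map_natCast]
  have hImax : I.IsMaximal := by
    rw [hIker]
    refine RingHom.ker_isMaximal_of_surjective _ fun t => ?_
    obtain ⟨a, rfl⟩ := hπ t
    exact ⟨MvPolynomial.C a, MvPolynomial.eval₂Hom_C _ _ _⟩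
  have hI : I.FG := IsNoetherian.noetherian I
  let D := AdicCompletion I B
  have hmax : (I.map (algebraMap B D)).IsMaximal := AdicCompletion.isMaximal_map_of_le I I le_rfl hI
  have hcomp : IsAdicComplete (I.map (algebraMap B D)) D := AdicCompletion.isAdicComplete_self I hI
  have hloc : IsLocalRing D := isLocalRing_of_isAdicComplete_maximal (I.map (algebraMap B D))
  have hD : I.map (algebraMap B D) = maximalIdeal D := eq_maximalIdeal hmax
  have hflat : Module.Flat B D := AdicCompletion.flat_of_isNoetherian I
  have hp : (Ideal.span {(p : B)}).map (algebraMap B D) = Ideal.span {(p : D)} := by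
    rw [Ideal.map_span, Set.image_singleton, map_natCast]
  let xs : Fin d → D := fun i => algebraMap B D (MvPolynomial.X i)
  refine ⟨D, inferInstance, inferInstance, hloc, isNoetherianRing_adicCompletion I, xs, hD ▸ hcomp,
    ?_, ?_, ?_, ?_⟩
  · rw [← hD, Ideal.map_sup, hp, Ideal.map_span, ← Set.range_comp]
    rfl
  -- The completion is flat over the Noetherian polynomial ring, so regularity of the variables
  -- modulo `p`, and below of `p` itself, carries over.
  · have h1 := (MvPolynomial.isWeaklyRegular_quotient_X (A := A) d p).of_flat_of_isBaseChange
      (TensorProduct.isBaseChange B (B ⧸ Ideal.span {(p : B)}) D)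
    rw [List.map_ofFn] at h1
    rw [← hp]
    exact ((Ideal.qoutMapEquivTensorQout D (I := Ideal.span {(p : B)})).isWeaklyRegular_congr _).2 h1
  · intro x hx
    by_cases h0 : (p : A) = 0
    · exact Or.inl h0
    · right
      have h1 : IsSMulRegular B (p : B) := by
        refine isSMulRegular_iff_right_eq_zero_of_smul.2 fun b hb => ?_
        refine (mul_eq_zero.1 hb).resolve_left fun h => h0 ?_
        rw [← map_natCast (MvPolynomial.C : A →+* B)] at h
        exact (MvPolynomial.C_injective _ _) (by rw [h, map_zero])
      have h2 : IsSMulRegular D (algebraMap B D p) :=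
        h1.of_flat_of_isBaseChange (IsBaseChange.linearMap B D)
      rw [map_natCast] at h2
      exact isSMulRegular_iff_right_eq_zero_of_smul.1 h2 x hx
  · intro S _ J _ φ y hJ hφ
    let g : B →+* S := MvPolynomial.eval₂Hom φ y
    have hg : I.map g = J := by
      rw [hJ, Ideal.map_sup, Ideal.map_span, Ideal.map_span, Set.image_singleton, map_natCast,
        ← Set.range_comp]
      congr 3
      funext i
      exact MvPolynomial.eval₂Hom_X' _ _ _
    obtain ⟨f, hf⟩ := AdicCompletion.exists_ringHom_comp_algebraMap_eq I J g hg.le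
    refine ⟨f, surjective_of_comp_algebraMap_adicCompletion (J := J) hI f (by rw [hf, hg]) ?_,
      fun i => ?_⟩
    · intro x
      obtain ⟨a, ha⟩ := hφ x
      refine ⟨MvPolynomial.C a, ?_⟩
      rw [hf, ← ha, RingHom.comp_apply, MvPolynomial.eval₂Hom_C]
      rfl
    · have := congrArg (fun h => h (MvPolynomial.X i)) hf
      simp only [RingHom.comp_apply] at this
      rw [this]
      exact MvPolynomial.eval₂Hom_X' _ _ _

end FormalPowerSeries

/-! ### Flatness checked modulo powers of the maximal ideal. -/

section FlatCompletion

/-- A Noetherian local algebra is flat over a Noetherian local ring if it agrees with a flat module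
modulo all powers of the maximal ideal. -/
theorem flat_of_bijective_quotient_pow {R T E : Type*} [CommRing R] [IsLocalRing R]
    [IsNoetherianRing R] [CommRing T] [IsLocalRing T] [IsNoetherianRing T] [Algebra R T]
    [IsLocalHom (algebraMap R T)] [AddCommGroup E] [Module R E] [Module.Flat R E] (f : E →ₗ[R] T)
    (hf : ∀ n : ℕ, Function.Bijective (f.lTensor (R ⧸ maximalIdeal R ^ n))) : Module.Flat R T := by
  rw [Module.Flat.iff_lTensor_injective']
  intro a
  rw [injective_iff_map_eq_zero]
  intro x hx
  have key : ∀ n : ℕ, x ∈ ((maximalIdeal T) ^ n • ⊤ : Submodule T (T ⊗[R] a)) := by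
    intro n
    -- Artin–Rees gives `𝔞 ∩ 𝔪^(n+c) ⊆ 𝔪ⁿ𝔞`. It then suffices to kill `x` in `T ⊗ 𝔞/(𝔞 ∩ 𝔪^(n+c))`,
    -- where `T` may be compared with the flat module `E`.
    obtain ⟨c, hc⟩ := Ideal.exists_pow_inf_eq_pow_smul (maximalIdeal R) (a : Submodule R R)
    let I := maximalIdeal R ^ (n + c)
    let N : Submodule R a := Submodule.comap a.subtype I
    have hN : N ≤ maximalIdeal R ^ n • ⊤ := by
      intro y hy
      have h1 : (y : R) ∈ (maximalIdeal R ^ (n + c) • ⊤ ⊓ a : Submodule R R) :=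
        ⟨by rw [smul_eq_mul, Ideal.mul_top]; exact hy, y.2⟩
      rw [hc _ (Nat.le_add_left _ _), Nat.add_sub_cancel] at h1
      have h2 : (y : R) ∈ maximalIdeal R ^ n • (a : Submodule R R) :=
        Submodule.smul_mono le_rfl inf_le_right h1
      exact Submodule.mem_smul_top_iff _ _ _ |>.2 h2
    have hkill : ∀ r ∈ I, ∀ q : a ⧸ N, r • q = 0 := by
      intro r hr q
      obtain ⟨q, rfl⟩ := Submodule.Quotient.mk_surjective _ q
      rw [← Submodule.Quotient.mk_smul, Submodule.Quotient.mk_eq_zero]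
      exact I.mul_mem_right (q : R) hr
    let j : (a ⧸ N) →ₗ[R] R ⧸ I := N.mapQ I a.subtype le_rfl
    have hj : Function.Injective j := by
      rw [← LinearMap.ker_eq_bot, Submodule.ker_mapQ]
      exact N.mkQ_map_self
    have hfsurj : Function.Surjective (f.rTensor (a ⧸ N)) := by
      intro y
      induction y with
      | zero => exact ⟨0, map_zero _⟩
      | add y z hy hz =>
        obtain ⟨y, rfl⟩ := hy
        obtain ⟨z, rfl⟩ := hz
        exact ⟨y + z, map_add _ _ _⟩
      | tmul t q =>
        obtain ⟨e, he⟩ := (hf (n + c)).2 (1 ⊗ₜ t)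
        obtain ⟨e, rfl⟩ := exists_one_tmul _ e
        refine ⟨e ⊗ₜ q, ?_⟩
        rw [LinearMap.lTensor_tmul, ← sub_eq_zero, ← TensorProduct.tmul_sub,
          one_tmul_eq_zero_iff] at he
        rw [LinearMap.rTensor_tmul, ← sub_eq_zero, ← TensorProduct.sub_tmul]
        generalize f e - t = z at he
        induction he using Submodule.smul_induction_on' with
        | smul r hr t _ => rw [TensorProduct.smul_tmul, hkill r hr, TensorProduct.tmul_zero]
        | add y _ z _ hy hz => rw [TensorProduct.add_tmul, hy, hz, add_zero]
    have hfinj : Function.Injective (f.rTensor (R ⧸ I)) :=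
      rTensor_injective_of_bijective_quotient I f (hf _) (R ⧸ I) fun r hr y => by
        obtain ⟨y, rfl⟩ := Ideal.Quotient.mk_surjective y
        exact Ideal.Quotient.eq_zero_iff_mem.2 (I.mul_mem_right y hr)
    have hz : N.mkQ.lTensor T x = 0 := by
      obtain ⟨w, hw⟩ := hfsurj (N.mkQ.lTensor T x)
      have h1 : j.lTensor E w = 0 := by
        apply hfinj
        rw [map_zero]
        have h2 := LinearMap.congr_fun (LinearMap.rTensor_comp_lTensor (f := f) (g := j)) w
        have h3 := LinearMap.congr_fun (LinearMap.lTensor_comp_rTensor (f := f) (g := j)) w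
        simp only [LinearMap.comp_apply] at h2 h3
        rw [h2, ← h3, hw, ← LinearMap.comp_apply, ← LinearMap.lTensor_comp]
        have h4 : j ∘ₗ N.mkQ = Submodule.mkQ I ∘ₗ a.subtype := rfl
        rw [h4, LinearMap.lTensor_comp, LinearMap.comp_apply, hx, map_zero]
      have h2 := Module.Flat.lTensor_preserves_injective_linearMap (M := E) j hj
      rw [← hw, (injective_iff_map_eq_zero _).1 h2 w h1, map_zero]
    have ex : Function.Exact (N.subtype.lTensor T) (N.mkQ.lTensor T) :=
      lTensor_exact T (LinearMap.exact_subtype_mkQ N) N.mkQ_surjective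
    obtain ⟨y, rfl⟩ := (ex x).1 hz
    exact lTensor_subtype_mem_pow_smul_top n N hN y
  have hfin : Module.Finite T (T ⊗[R] a) := finite_tensorProduct_of_finite a
  have := Ideal.iInf_pow_smul_eq_bot_of_isLocalRing (M := T ⊗[R] a) (maximalIdeal T)
    (Ideal.IsPrime.ne_top inferInstance)
  rw [← Submodule.mem_bot T, ← this]
  simpa using key

end FlatCompletion

/-! ### The completed tensor product `R ⊗_A D`. -/

section CompletedBaseChange

lemma AdicCompletion.algebraMap_mem_map_pow_iff {E : Type*} [CommRing E] (I : Ideal E) (n : ℕ)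
    (e : E) :
    algebraMap E (AdicCompletion I E) e ∈ (I ^ n).map (algebraMap E (AdicCompletion I E)) ↔
      e ∈ I ^ n := by
  refine ⟨fun h => ?_, Ideal.mem_map_of_mem _⟩
  have h1 := Ideal.mem_map_of_mem (AdicCompletion.evalₐ I n).toRingHom h
  rw [Ideal.map_map] at h1
  have h2 : (AdicCompletion.evalₐ I n).toRingHom.comp (algebraMap E (AdicCompletion I E)) =
      Ideal.Quotient.mk (I ^ n) := (AdicCompletion.evalₐ I n).comp_algebraMap
  rw [h2, Ideal.map_quotient_self, Ideal.mem_bot] at h1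
  rw [← Ideal.Quotient.eq_zero_iff_mem, ← h2]
  exact h1

lemma AdicCompletion.exists_sub_algebraMap_mem_map_pow {E : Type*} [CommRing E] {I : Ideal E}
    (hI : I.FG) (n : ℕ) (t : AdicCompletion I E) :
    ∃ e : E, t - algebraMap E (AdicCompletion I E) e ∈
      (I ^ n).map (algebraMap E (AdicCompletion I E)) := by
  obtain ⟨e, he⟩ := Submodule.Quotient.mk_surjective _ (AdicCompletion.eval I E n t)
  refine ⟨e, ?_⟩
  rw [← mem_smul_top_iff_mem_map, AdicCompletion.pow_smul_top_eq_ker_eval hI, LinearMap.mem_ker,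
    map_sub, ← he]
  exact sub_self _

theorem AdicCompletion.flat_of_flat {R E : Type*} [CommRing R] [IsLocalRing R] [IsNoetherianRing R]
    [CommRing E] [Algebra R E] [Module.Flat R E] {I : Ideal E}
    (hI : I = (maximalIdeal R).map (algebraMap R E)) [IsLocalRing (AdicCompletion I E)]
    [IsNoetherianRing (AdicCompletion I E)] [IsLocalHom (algebraMap R (AdicCompletion I E))] :
    Module.Flat R (AdicCompletion I E) := by
  have hIfg : I.FG := hI ▸ Ideal.FG.map (IsNoetherian.noetherian _) _
  have : IsScalarTower R E (AdicCompletion I E) := IsScalarTower.of_algebraMap_eq fun _ => rfl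
  have hmap : ∀ n, (maximalIdeal R ^ n).map (algebraMap R (AdicCompletion I E)) =
      (I ^ n).map (algebraMap E (AdicCompletion I E)) := fun n => by
    rw [IsScalarTower.algebraMap_eq R E, ← Ideal.map_map, Ideal.map_pow, ← hI]
  refine flat_of_bijective_quotient_pow
    (IsScalarTower.toAlgHom R E (AdicCompletion I E)).toLinearMap fun n => ⟨?_, fun x => ?_⟩
  · rw [lTensor_quotient_injective_iff]
    intro x hx
    rw [mem_smul_top_iff_mem_map, hmap] at hx
    rw [mem_smul_top_iff_mem_map, Ideal.map_pow, ← hI]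
    exact (AdicCompletion.algebraMap_mem_map_pow_iff I n x).1 hx
  · obtain ⟨t, rfl⟩ := exists_one_tmul _ x
    obtain ⟨e, he⟩ := AdicCompletion.exists_sub_algebraMap_mem_map_pow hIfg n t
    refine ⟨1 ⊗ₜ e, ?_⟩
    rw [LinearMap.lTensor_tmul, eq_comm, ← sub_eq_zero, ← TensorProduct.tmul_sub,
      one_tmul_eq_zero_iff, mem_smul_top_iff_mem_map, hmap]
    exact he

/-- The completed base change `R ⊗ D` of a complete local ring along a map of coefficient rings. -/
theorem exists_completed_baseChange {A R D : Type v} [CommRing A] [CommRing R] [IsLocalRing R]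
    [IsNoetherianRing R] [CommRing D] [IsLocalRing D] [IsNoetherianRing D]
    [IsAdicComplete (maximalIdeal D) D] [Algebra A R] [Algebra A D] [Module.Flat A D] (p : ℕ)
    (hsurj : Function.Surjective ((residue R).comp (algebraMap A R)))
    (hker : RingHom.ker ((residue R).comp (algebraMap A R)) = Ideal.span {(p : A)}) {d : ℕ}
    (xs : Fin d → D) (hmax : maximalIdeal D = Ideal.span {(p : D)} ⊔ Ideal.span (Set.range xs))
    (hreg : RingTheory.Sequence.IsWeaklyRegular (D ⧸ Ideal.span {(p : D)}) (List.ofFn xs)) :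
    ∃ (T : Type v) (_ : CommRing T) (_ : IsLocalRing T) (_ : IsNoetherianRing T) (_ : Algebra R T)
      (g : D →+* T) (ys : List T), Module.Flat R T ∧ IsLocalHom (algebraMap R T) ∧
      IsAdicComplete (maximalIdeal T) T ∧
      maximalIdeal T = (maximalIdeal R).map (algebraMap R T) ⊔ Ideal.ofList ys ∧
      RingTheory.Sequence.IsWeaklyRegular (T ⧸ (maximalIdeal R).map (algebraMap R T)) ys ∧
      ∀ (S : Type v) [CommRing S] [IsLocalRing S] [IsAdicComplete (maximalIdeal S) S] [Algebra R S]
        [IsLocalHom (algebraMap R S)] (f : D →+* S),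
        f.comp (algebraMap A D) = (algebraMap R S).comp (algebraMap A R) →
        ∃ h : T →+* S, h.comp g = f ∧ h.comp (algebraMap R T) = algebraMap R S := by
  -- `E` is not known to be Noetherian, so Noetherianity and flatness of its completion `T` are
  -- derived from `T/𝔪T ≅ D/(p)` and from `R`-flatness of `E`.
  let E := R ⊗[A] D
  let I : Ideal E := (maximalIdeal R).map (algebraMap R E)
  have hI : I.FG := Ideal.FG.map (IsNoetherian.noetherian _) _
  let T := AdicCompletion I E
  have hRET : IsScalarTower R E T := IsScalarTower.of_algebraMap_eq fun _ => rfl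
  have hmT : (maximalIdeal R).map (algebraMap R T) = I.map (algebraMap E T) := by
    rw [IsScalarTower.algebraMap_eq R E, ← Ideal.map_map]
  have hcomp : IsAdicComplete ((maximalIdeal R).map (algebraMap R T)) T := by
    rw [hmT]
    exact AdicCompletion.isAdicComplete_self I hI
  have hpm : (p : R) ∈ maximalIdeal R := by
    have : (p : A) ∈ RingHom.ker ((residue R).comp (algebraMap A R)) :=
      hker ▸ Ideal.mem_span_singleton_self _
    rw [RingHom.mem_ker, map_natCast] at this
    rwa [← residue_eq_zero_iff, map_natCast]
  let incl : D →+* E := (Algebra.TensorProduct.includeRight : D →ₐ[A] E).toRingHom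
  let g : D →+* T := (algebraMap E T).comp incl
  let gbar : D →+* T ⧸ (maximalIdeal R).map (algebraMap R T) := (Ideal.Quotient.mk _).comp g
  -- Modulo `𝔪` every element of `R` comes from `A` and can be moved across the tensor sign into
  -- `D`.
  have hE : ∀ e : E, ∃ x : D, e - incl x ∈ I := by
    intro e
    induction e using TensorProduct.induction_on with
    | zero => exact ⟨0, by simp⟩
    | add a b ha hb =>
      obtain ⟨x, hx⟩ := ha
      obtain ⟨y, hy⟩ := hb
      refine ⟨x + y, ?_⟩
      rw [map_add, add_sub_add_comm]
      exact add_mem hx hy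
    | tmul r x =>
      obtain ⟨a, ha⟩ := hsurj (residue R r)
      have hra : r - algebraMap A R a ∈ maximalIdeal R := by
        rw [← residue_eq_zero_iff, map_sub, ← ha]
        exact sub_self _
      refine ⟨algebraMap A D a * x, ?_⟩
      have h1 : r ⊗ₜ[A] x - incl (algebraMap A D a * x) =
          algebraMap R E (r - algebraMap A R a) * (1 ⊗ₜ x) := by
        change r ⊗ₜ[A] x - (1 : R) ⊗ₜ[A] (algebraMap A D a * x) =
          (r - algebraMap A R a) ⊗ₜ[A] (1 : D) * ((1 : R) ⊗ₜ[A] x)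
        rw [Algebra.TensorProduct.tmul_mul_tmul, mul_one, one_mul, TensorProduct.sub_tmul,
          ← Algebra.smul_def, TensorProduct.tmul_smul, TensorProduct.smul_tmul',
          Algebra.algebraMap_eq_smul_one]
      rw [h1]
      exact I.mul_mem_right _ (Ideal.mem_map_of_mem _ hra)
  have hgsurj : Function.Surjective gbar := by
    intro t
    obtain ⟨t, rfl⟩ := Ideal.Quotient.mk_surjective t
    obtain ⟨e, he⟩ := AdicCompletion.exists_sub_algebraMap_mem_map_pow hI 1 t
    obtain ⟨x, hx⟩ := hE e
    refine ⟨x, ?_⟩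
    rw [pow_one, ← hmT] at he
    have h1 : algebraMap E T (e - incl x) ∈ (maximalIdeal R).map (algebraMap R T) :=
      hmT ▸ Ideal.mem_map_of_mem _ hx
    rw [eq_comm, RingHom.comp_apply, Ideal.Quotient.eq, ← sub_add_sub_cancel t (algebraMap E T e)]
    refine add_mem he ?_
    rw [map_sub] at h1
    exact h1
  have hgker : RingHom.ker gbar = Ideal.span {(p : D)} := by
    apply le_antisymm
    -- The residue field of `R` is `A/(p)`, so it maps to `D/(p)`. The resulting `ρ : R ⊗_A D →
    -- D/(p)` kills `𝔪E`, which bounds the kernel of `gbar` by `(p)`.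
    · let τ₀ : ResidueField R →+* D ⧸ Ideal.span {(p : D)} :=
        RingHom.liftOfSurjective _ hsurj ⟨(Ideal.Quotient.mk (Ideal.span {(p : D)})).comp
          (algebraMap A D), by
            rw [hker, Ideal.span_singleton_le_iff_mem, RingHom.mem_ker, RingHom.comp_apply,
              map_natCast, Ideal.Quotient.eq_zero_iff_mem]
            exact Ideal.mem_span_singleton_self _⟩
      have hτ₀ : ∀ a, τ₀ (residue R (algebraMap A R a)) = Ideal.Quotient.mk _ (algebraMap A D a) :=
        fun a => RingHom.liftOfSurjective_comp_apply _ hsurj _ a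
      let τ : R →ₐ[A] D ⧸ Ideal.span {(p : D)} :=
        { τ₀.comp (residue R) with commutes' := hτ₀ }
      let ρ : E →ₐ[A] D ⧸ Ideal.span {(p : D)} :=
        Algebra.TensorProduct.lift τ (Ideal.Quotient.mkₐ A _) fun _ _ => Commute.all _ _
      have hρI : I ≤ RingHom.ker ρ := by
        refine Ideal.map_le_iff_le_comap.2 fun r hr => ?_
        change ρ (r ⊗ₜ 1) = 0
        rw [Algebra.TensorProduct.lift_tmul, map_one, mul_one]
        change τ₀ (residue R r) = 0
        rw [(residue_eq_zero_iff r).2 hr, map_zero]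
      intro x hx
      have h1 : algebraMap E T (incl x) ∈ (maximalIdeal R).map (algebraMap R T) :=
        Ideal.Quotient.eq_zero_iff_mem.1 hx
      have h2 : ρ ((1 : R) ⊗ₜ x) = 0 := by
        have h3 := AdicCompletion.algebraMap_mem_map_pow_iff I 1 (incl x)
        rw [pow_one, ← hmT] at h3
        exact hρI (h3.1 h1)
      rw [Algebra.TensorProduct.lift_tmul, map_one, one_mul] at h2
      exact Ideal.Quotient.eq_zero_iff_mem.1 h2
    · rw [Ideal.span_singleton_le_iff_mem, RingHom.mem_ker, map_natCast,
        ← map_natCast (Ideal.Quotient.mk _), Ideal.Quotient.eq_zero_iff_mem,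
        ← map_natCast (algebraMap R T)]
      exact Ideal.mem_map_of_mem _ hpm
  have hnoeth : IsNoetherianRing T :=
    isNoetherianRing_of_isAdicComplete ((maximalIdeal R).map (algebraMap R T))
      (Ideal.FG.map (IsNoetherian.noetherian _) _) g hgsurj
  have hnt : Nontrivial (T ⧸ (maximalIdeal R).map (algebraMap R T)) := by
    refine ⟨0, 1, fun h => ?_⟩
    have h1 : (1 : D) ∈ RingHom.ker gbar := by rw [RingHom.mem_ker, map_one, h]
    rw [hgker] at h1
    have h2 : (1 : D) ∈ maximalIdeal D := hmax ▸ Ideal.mem_sup_left h1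
    exact (Ideal.ne_top_iff_one _).1 (Ideal.IsPrime.ne_top inferInstance) h2
  have hloc' : IsLocalRing (T ⧸ (maximalIdeal R).map (algebraMap R T)) :=
    IsLocalRing.of_surjective' gbar hgsurj
  -- `T` is complete along `𝔪T`, so `𝔪T` lies in the Jacobson radical and locality passes from
  -- `T/𝔪T` up to `T`.
  have hmk : IsLocalHom (Ideal.Quotient.mk ((maximalIdeal R).map (algebraMap R T))) :=
    isLocalHom_of_le_jacobson_bot _ (IsAdicComplete.le_jacobson_bot _)
  have hloc : IsLocalRing T :=
    RingHom.domain_isLocalRing (Ideal.Quotient.mk ((maximalIdeal R).map (algebraMap R T)))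
  have hmle : (maximalIdeal R).map (algebraMap R T) ≤ maximalIdeal T :=
    le_maximalIdeal (Ideal.Quotient.nontrivial_iff.1 hnt)
  have hlocal : IsLocalHom (algebraMap R T) := ((local_hom_TFAE (algebraMap R T)).out 2 0).1 hmle
  have hcomp' : IsAdicComplete (maximalIdeal (T ⧸ (maximalIdeal R).map (algebraMap R T)))
      (T ⧸ (maximalIdeal R).map (algebraMap R T)) := by
    rw [← map_maximalIdeal_of_surjective gbar hgsurj]
    have := IsAdicComplete.of_surjective_ringHom gbar hgsurj
    rwa [← map_maximalIdeal_of_surjective gbar hgsurj] at this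
  refine ⟨T, inferInstance, hloc, hnoeth, inferInstance, g, List.ofFn (g ∘ xs),
    AdicCompletion.flat_of_flat rfl, hlocal,
    isAdicComplete_maximalIdeal_of_quotient ((maximalIdeal R).map (algebraMap R T)), ?_, ?_, ?_⟩
  · have h1 : maximalIdeal T = (maximalIdeal D).map g ⊔ (maximalIdeal R).map (algebraMap R T) := by
      have h0 : (maximalIdeal _).comap (Ideal.Quotient.mk ((maximalIdeal R).map (algebraMap R T))) =
          maximalIdeal T := ((local_hom_TFAE _).out 0 4 rfl rfl).1 hmk
      rw [← h0, ← map_maximalIdeal_of_surjective gbar hgsurj, ← Ideal.map_map,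
        Ideal.comap_map_of_surjective _ Ideal.Quotient.mk_surjective, ← RingHom.ker_eq_comap_bot,
        Ideal.mk_ker]
    have h2 : (Ideal.span {(p : D)}).map g ≤ (maximalIdeal R).map (algebraMap R T) := by
      rw [Ideal.map_span, Set.image_singleton, map_natCast, Ideal.span_singleton_le_iff_mem,
        ← map_natCast (algebraMap R T)]
      exact Ideal.mem_map_of_mem _ hpm
    have h3 : (Ideal.span (Set.range xs)).map g = Ideal.ofList (List.ofFn (g ∘ xs)) := by
      rw [Ideal.map_span, ← Set.range_comp]
      refine congrArg Ideal.span (Set.ext fun x => ?_)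
      simp [List.mem_ofFn]
    rw [h1, hmax, Ideal.map_sup, h3, sup_comm, ← sup_assoc, sup_of_le_left h2]
  · let e : D ⧸ Ideal.span {(p : D)} ≃+* T ⧸ (maximalIdeal R).map (algebraMap R T) :=
      (Ideal.quotEquivOfEq hgker.symm).trans (RingHom.quotientKerEquivOfSurjective hgsurj)
    refine (AddEquiv.isWeaklyRegular_congr (e := e.toAddEquiv) ?_).1 hreg
    rw [List.forall₂_iff_get]
    refine ⟨by simp, fun i h1 h2 x => ?_⟩
    simp only [List.get_ofFn]
    change e (Ideal.Quotient.mk _ (xs _) * x) = Ideal.Quotient.mk _ (g (xs _)) * e x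
    rw [map_mul]
    rfl
  · intro S _ _ _ _ _ f hf
    let : Algebra A S := ((algebraMap R S).comp (algebraMap A R)).toAlgebra
    let τ : R →ₐ[A] S := { algebraMap R S with commutes' := fun _ => rfl }
    let f' : D →ₐ[A] S := { f with commutes' := fun a => congrArg (fun h => h a) hf }
    let q : E →ₐ[A] S := Algebra.TensorProduct.lift τ f' fun _ _ => Commute.all _ _
    have hqR : ∀ r, q (algebraMap R E r) = algebraMap R S r := fun r => by
      change q (r ⊗ₜ 1) = _
      rw [Algebra.TensorProduct.lift_tmul, map_one, mul_one]
      rfl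
    have hqI : I.map (q : E →+* S) ≤ maximalIdeal S := by
      rw [Ideal.map_map, Ideal.map_le_iff_le_comap]
      intro r hr
      rw [Ideal.mem_comap]
      change q (algebraMap R E r) ∈ maximalIdeal S
      rw [hqR]
      exact map_nonunit (algebraMap R S) r hr
    obtain ⟨h, hh⟩ := AdicCompletion.exists_ringHom_comp_algebraMap_eq I (maximalIdeal S)
      (q : E →+* S) hqI
    refine ⟨h, ?_, ?_⟩
    · rw [← RingHom.comp_assoc, hh]
      ext x
      change q (1 ⊗ₜ x) = _
      rw [Algebra.TensorProduct.lift_tmul, map_one, one_mul]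
      rfl
    · rw [IsScalarTower.algebraMap_eq R E, ← RingHom.comp_assoc, hh]
      exact RingHom.ext hqR

end CompletedBaseChange

/-! ### Cohen factorizations and the conclusion. -/

section CohenFactorization

lemma exists_lift_residue (R : Type v) [CommRing R] [IsLocalRing R]
    [IsAdicComplete (maximalIdeal R) R] {A : Type v} [CommRing A] [IsDomain A] (p : ℕ)
    [CharP (ResidueField R) p] (π : A →+* ResidueField R) (hπ : Function.Surjective π)
    (hker : RingHom.ker π = Ideal.span {(p : A)}) (hp : (p : A) = 0 → p = 0) :
    ∃ φ : A →+* R, (residue R).comp φ = π := by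
  have hbot : (maximalIdeal R).map (residue R) = ⊥ := Ideal.map_quotient_self _
  refine exists_lift_of_isAdicComplete p π hπ hker (fun a ha => (mul_eq_zero.1 ha).imp_left hp)
    (maximalIdeal R) ?_ (residue R) residue_surjective (ker_residue (R := R)).le ?_ π
  · rw [← residue_eq_zero_iff, map_natCast, CharP.cast_eq_zero]
  · rw [hbot]
    infer_instance

/-- Cohen factorizations exist for local homomorphisms of complete local rings. -/
theorem exists_cohenFactorization_of_universe (R S : Type v) [CommRing R] [IsLocalRing R]
    [IsNoetherianRing R] [IsAdicComplete (maximalIdeal R) R] [CommRing S] [IsLocalRing S]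
    [IsNoetherianRing S] [IsAdicComplete (maximalIdeal S) S] [Algebra R S]
    [IsLocalHom (algebraMap R S)] :
    ∃ (T : Type v) (_ : CommRing T) (_ : IsLocalRing T) (_ : IsNoetherianRing T) (_ : Algebra R T)
      (_ : Algebra T S) (ys : List T), IsScalarTower R T S ∧
      Function.Surjective (algebraMap T S) ∧ Module.Flat R T ∧ IsLocalHom (algebraMap R T) ∧
      IsAdicComplete (maximalIdeal T) T ∧
      maximalIdeal T = (maximalIdeal R).map (algebraMap R T) ⊔ Ideal.ofList ys ∧
      RingTheory.Sequence.IsWeaklyRegular (T ⧸ (maximalIdeal R).map (algebraMap R T)) ys := by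
  let p := ringChar (ResidueField R)
  have hpR : CharP (ResidueField R) p := ringChar.charP _
  have hpS : CharP (ResidueField S) p :=
    charP_of_injective_algebraMap (algebraMap (ResidueField R) (ResidueField S)).injective p
  obtain ⟨A, _, _, π, hπ, hπker, hpA, hA⟩ := exists_coefficientRing (ResidueField R) p
  obtain ⟨B, _, _, θ, hθ, hθker, hpB, hB⟩ := exists_coefficientRing (ResidueField S) p
  have hAnoeth := isPrincipalIdealRing_of_forall_eq_pow_mul_unit hA
  have hBnoeth := isPrincipalIdealRing_of_forall_eq_pow_mul_unit hB
  obtain ⟨φ, hφ⟩ := exists_lift_residue R p π hπ hπker hpA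
  obtain ⟨ψ, hψ⟩ := exists_lift_residue S p θ hθ hθker hpB
  obtain ⟨d, y, hy⟩ := Submodule.fg_iff_exists_fin_generating_family.1
    (IsNoetherian.noetherian (maximalIdeal S))
  have hpS' : (p : S) ∈ maximalIdeal S := by
    rw [← residue_eq_zero_iff, map_natCast, CharP.cast_eq_zero]
  obtain ⟨D, _, _, _, _, xs, hDc, hDmax, hDreg, hDp, hD⟩ :=
    exists_completion_mvPolynomial p θ hθ hθker d
  obtain ⟨f, hf, hfx⟩ := hD S (maximalIdeal S) ψ y
    (by
      have : Ideal.span (Set.range y) = maximalIdeal S := hy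
      rw [this, eq_comm, sup_eq_right, Ideal.span_singleton_le_iff_mem]
      exact hpS')
    (by
      intro t
      obtain ⟨b, hb⟩ := hθ t
      exact ⟨b, by rw [← hb, ← hψ]; rfl⟩)
  have hfm : (maximalIdeal D).map f = maximalIdeal S := map_maximalIdeal_of_surjective f hf
  -- The coefficient rings `A` and `B` are chosen independently. Lifting `A → R → S` through `D → S`
  -- makes them compatible and turns `D` into an `A`-algebra.
  obtain ⟨χ, hχ⟩ := exists_lift_of_isAdicComplete p π hπ hπker
    (fun a ha => (mul_eq_zero.1 ha).imp_left hpA) (maximalIdeal D)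
    (hDmax ▸ Ideal.mem_sup_left (Ideal.mem_span_singleton_self _)) f hf
    (le_maximalIdeal (RingHom.ker_ne_top f)) (hfm ▸ inferInstance) ((algebraMap R S).comp φ)
  let : Algebra A R := φ.toAlgebra
  let : Algebra A D := χ.toAlgebra
  -- Both residue fields have characteristic `p`. Either `p = 0` and `A` is covered by the field
  -- alternative, or `D` has no `p`-torsion.
  have hflat : Module.Flat A D := flat_of_forall_eq_pow_mul_unit hA fun x hx => by
    rw [Algebra.smul_def, map_natCast] at hx
    exact (hDp x hx).imp_left fun h => by rw [hpB h, Nat.cast_zero]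
  obtain ⟨T, _, _, _, _, g, ys, h1, h2, h3, h4, h5, h6⟩ := exists_completed_baseChange (A := A)
    (R := R) (D := D) p (hφ ▸ hπ) (by rw [← hπker, ← hφ]; rfl) xs hDmax hDreg
  obtain ⟨h, hg, hR⟩ := h6 S f hχ
  let : Algebra T S := h.toAlgebra
  refine ⟨T, inferInstance, inferInstance, inferInstance, inferInstance, inferInstance, ys,
    IsScalarTower.of_algebraMap_eq fun r => (congrArg (fun q => q r) hR).symm, ?_, h1, h2, h3, h4,
    h5⟩
  intro s
  obtain ⟨x, rfl⟩ := hf s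
  exact ⟨g x, congrArg (fun q => q x) hg⟩

/-- Cohen factorizations exist for flat local homomorphisms of complete local rings. -/
theorem exists_cohenFactorization (R : Type u) (S : Type v) [CommRing R] [IsLocalRing R]
    [IsNoetherianRing R] [IsAdicComplete (maximalIdeal R) R] [CommRing S] [IsLocalRing S]
    [IsNoetherianRing S] [IsAdicComplete (maximalIdeal S) S] [Algebra R S] [Module.Flat R S]
    [IsLocalHom (algebraMap R S)] :
    ∃ (T : Type v) (_ : CommRing T) (_ : IsLocalRing T) (_ : IsNoetherianRing T) (_ : Algebra R T)
      (_ : Algebra T S) (ys : List T), IsScalarTower R T S ∧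
      Function.Surjective (algebraMap T S) ∧ Module.Flat R T ∧ IsLocalHom (algebraMap R T) ∧
      IsAdicComplete (maximalIdeal T) T ∧
      maximalIdeal T = (maximalIdeal R).map (algebraMap R T) ⊔ Ideal.ofList ys ∧
      RingTheory.Sequence.IsWeaklyRegular (T ⧸ (maximalIdeal R).map (algebraMap R T)) ys := by
  have hff : Module.FaithfullyFlat R S := Module.FaithfullyFlat.of_flat_of_isLocalHom
  -- Faithful flatness makes `R` isomorphic to its image in `S`. That image lives in the universe of
  -- `S`, so the one-universe construction applies to it.
  have hinj : Function.Injective (algebraMap R S) := FaithfulSMul.algebraMap_injective R S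
  let R' := (algebraMap R S).range
  let e : R ≃+* R' := RingEquiv.ofBijective (algebraMap R S).rangeRestrict
    ⟨fun x y h => hinj (congrArg Subtype.val h), (algebraMap R S).rangeRestrict_surjective⟩
  have he : ∀ r, algebraMap R' S (e r) = algebraMap R S r := fun _ => rfl
  have hloc : IsLocalRing R' := e.isLocalRing
  have hnoeth : IsNoetherianRing R' := isNoetherianRing_of_ringEquiv R e
  have hmap : (maximalIdeal R).map (e : R →+* R') = maximalIdeal R' :=
    map_maximalIdeal_of_surjective _ e.surjective
  have hcomp : IsAdicComplete (maximalIdeal R') R' :=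
    IsAdicComplete.of_surjective_ringHom (e : R →+* R') e.surjective
  have hlocal : IsLocalHom (algebraMap R' S) := ⟨fun x hx => by
    obtain ⟨r, rfl⟩ := e.surjective x
    rw [he] at hx
    exact (isUnit_of_map_unit (algebraMap R S) r hx).map e⟩
  obtain ⟨T, _, _, _, _, _, ys, htower, h1, h2, h3, h4, h5, h6⟩ :=
    exists_cohenFactorization_of_universe R' S
  let : Algebra R T := ((algebraMap R' T).comp (e : R →+* R')).toAlgebra
  have hmapT : (maximalIdeal R).map (algebraMap R T) = (maximalIdeal R').map (algebraMap R' T) := by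
    rw [← hmap, Ideal.map_map]
    rfl
  refine ⟨T, inferInstance, inferInstance, inferInstance, inferInstance, inferInstance, ys,
    IsScalarTower.of_algebraMap_eq fun r => ?_, h1, ?_, ?_, h4, by rw [hmapT, h5],
    by rw [hmapT]; exact h6⟩
  · rw [← he, IsScalarTower.algebraMap_apply R' T S]
    rfl
  · rw [← RingHom.flat_algebraMap_iff]
    exact (RingHom.Flat.of_bijective e.bijective).comp (RingHom.flat_algebraMap_iff.2 h2)
  · exact ⟨fun r hr => (isUnit_map_iff e r).1 (h3.map_nonunit (e r) hr)⟩

end CohenFactorization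

theorem mainTheorem7
    (R : Type u) [CommRing R] [IsLocalRing R] [IsNoetherianRing R]
    [IsAdicComplete (maximalIdeal R) R]
    (S : Type v) [CommRing S] [IsLocalRing S] [IsNoetherianRing S]
    [IsAdicComplete (maximalIdeal S) S]
    [Algebra R S] [Module.Flat R S] [IsLocalHom (algebraMap R S)]
    (hdim : ringKrullDim R = ringKrullDim S)
    (c : ℤ) (hc : (edim S : ℤ) - (edim R : ℤ) = c) :
    ∃ (T : Type v) (_ : CommRing T) (_ : IsLocalRing T) (_ : IsNoetherianRing T)
      (_ : Algebra R T) (_ : Algebra T S) (_ : IsScalarTower R T S) (J : Ideal T),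
      Function.Surjective (algebraMap T S) ∧
      J = RingHom.ker (algebraMap T S) ∧
      Module.Flat R T ∧
      IsLocalHom (algebraMap R T) ∧
      IsAdicComplete (maximalIdeal T) T ∧
      IsCompleteIntersectionLocalRing (T ⧸ (maximalIdeal R).map (algebraMap R T)) ∧
      IsPerfectIdeal J ∧
      (∃ n : ℕ, (n : ℤ) = c ∧ projectiveDimension (ModuleCat.of T S) = (n : WithBot ℕ∞)) ∧
      J ≤ maximalIdeal T ^ 2 := by
  obtain ⟨T, _, _, _, _, _, ys, _, hsurj, _, _, _, hmax, hreg⟩ := exists_cohenFactorization R S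
  exact exists_completeIntersection_factorization R S hdim T hsurj ys hmax hreg c hc
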